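/- For $\sigma>0$, a real random variable $X$ is $\sigma$-subgaussian if $\Pr[|X|\ge t]\le 2e^{-\frac12(t/\sigma)^2}$ for all $t\ge 0$; a random vector $Y\in\mathbb R^m$ is $\sigma$-subgaussian if $\langle Y,\theta\rangle$ is $\sigma$-subgaussian for every unit vector $\theta$. Running times are counted on a real random access machine: finite programs with natural-number index registers and real arrays, in which real arithmetic ($+,-,\times,/$, square root), comparisons, addition and subtraction of indices, memory accesses and tosses of a fair coin cost one unit each. For $n\ge 2$ put $$\gamma=\frac{2\log_2 2n}{n^{5/2}},\qquad \delta=\frac{2\sqrt{2\ln 2\,\log_2 2n}}{n},\qquad T=\lceil 2/\gamma^2\rceil\cdot\lceil\log_2 2n\rceil .$$ Let $v_1,\dots,v_n\in\mathbb R^m$ and let $V$ be the matrix with columns $v_1,\dots,v_n$. The *SDP-guided random walk* from $\chi(0)\in[-1,1]^n$ is the following algorithm. Let $A(1)=\{1,\dots,n\}$. For $t=1,\dots,T$, choose, depending only on $t$, $\chi(t-1)$ and $A(t)$, an $n\times n$ matrix $U(t)$ such that $\Sigma(t)=U(t)U(t)^{\mathsf T}$ solves the vector Komlós program $$\Sigma(t)\succeq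 0,\qquad \Sigma(t)_{ii}=1\ (i\in A(t)),\qquad \Sigma(t)_{ii}=0\ (i\notin A(t)),\qquad V\Sigma(t)V^{\mathsf T}\preceq I_m ;$$ pick $r(t)\in\{-1,1\}^n$ uniformly at random, and let $\chi(t)=\chi(t-1)+\gamma U(t)r(t)$ and $A(t+1)=\{i:|\chi(t)_i|<1-\delta\}$. If $|\chi(T)_i|\ge 1-\delta$ for all $i$, output $\chi=(\operatorname{sign}(\chi(T)_i))_{i=1}^n$, where $\operatorname{sign}(0)=1$; otherwise restart from $\chi(0)$ with fresh random signs. **Theorem.** There are an absolute constant $C>0$ and absolute constants $K,d\in\mathbb N$ such that the following hold. 1. There is one program which, for all $n\ge 2$ and $m\ge 0$, on input $v_1,\dots,v_n\in\mathbb R^m$ of Euclidean norm at most $1$ and $y\in\sum_{i=1}^n[-v_i,v_i]$, has expected running time at most $K(n+m)^d$ and outputs, almost surely, signs $\chi\in\{-1,1\}^n$ such that $\sum_{i=1}^n\chi_iv_i-y$ is $C\sqrt{\log n}$-subgaussian. 2. Let $n\ge2$, $m\ge 0$, let $v_1,\dots,v_n\in\mathbb R^m$ have norm at most $1$ and let $y\in\sum_{i=1}^n[-v_i,v_i]$.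 There is $\chi(0)\in[-1,1]^n$ with $\sum_i\chi(0)_iv_i=y$, and the vector Komlós programs above are feasible for all active sets. For every such $\chi(0)$ and every rule for choosing the matrices $U(t)$, the SDP-guided random walk performs in expectation at most $Kn^d$ steps in total, restarts included, and its output $\chi$ is such that $\sum_{i=1}^n\chi_iv_i-y$ is $C\sqrt{\log n}$-subgaussian. 3. There is one program which, for all $n\ge 2$ and $m\ge 0$, given $v_1,\dots,v_n\in\mathbb R^m$ of norm at most $1$, $\chi(0)\in[-1,1]^n$ and the numbers $\gamma,\delta,T$, has expected running time at most $K(n+m)^d$ and whose output has the distribution of the output of the SDP-guided random walk from $\chi(0)$ for some rule for choosing the matrices $U(t)$. -/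

import Mathlib

open MeasureTheory
open scoped ENNReal Pointwise

noncomputable section

/-! ## Fair coins and subgaussian random vectors -/

/-- The law of a family of independent fair coins indexed by `ι`. -/
def fairCoins (ι : Type) : Measure (ι → Bool) :=
  Measure.infinitePi fun _ : ι => (PMF.uniformOfFintype Bool).toMeasure

/-- The sign carried by a coin. -/
def coinSign (b : Bool) : ℝ := if b then 1 else -1

/-- A real random variable is `σ`-subgaussian, for `σ > 0`, if
`Pr[|X| ≥ t] ≤ 2 exp (-(t / σ) ^ 2 / 2)` for all `t ≥ 0`. -/
def IsSubgaussianReal {Ω : Type*} [MeasurableSpace Ω] (μ : Measure Ω) (X : Ω → ℝ) (σ : ℝ) :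
    Prop :=
  0 < σ ∧ ∀ t : ℝ, 0 ≤ t → μ.real {ω | t ≤ |X ω|} ≤ 2 * Real.exp (-(1 / 2) * (t / σ) ^ 2)

/-- A random vector is `σ`-subgaussian if all its one-dimensional marginals are. -/
def IsSubgaussian {Ω : Type*} [MeasurableSpace Ω] {m : ℕ} (μ : Measure Ω)
    (X : Ω → EuclideanSpace ℝ (Fin m)) (σ : ℝ) : Prop :=
  0 < σ ∧ ∀ θ : EuclideanSpace ℝ (Fin m), ‖θ‖ = 1 →
    IsSubgaussianReal μ (fun ω => inner ℝ (X ω) θ) σ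

/-! ## A randomized real random access machine

A program works on natural-number registers (indices and counters) and on doubly indexed arrays
of real numbers. Its text is finite and mentions only natural-number constants. Each elementary
operation costs one unit of time: arithmetic operations, square roots and comparisons of reals,
additions, (truncated) subtractions and comparisons of indices, memory accesses, and the toss of
a fair coin. There is no conversion from real numbers to indices other than by comparisons, and no
multiplication of indices. -/

namespace RealRAM

/-- Memory contents, the number of coins tossed so far, and the time elapsed so far. -/
@[ext] structure State where
  /-- natural-number registers -/
  nat : ℕ → ℕ
  /-- `real a i j` is the entry `(i, j)` of the real array `a` -/
  real : ℕ → ℕ → ℕ → ℝ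
  coins : ℕ
  clock : ℕ

/-- Index expressions. -/
inductive NExpr where
  | const (k : ℕ)
  | var (x : ℕ)
  | add (e f : NExpr)
  | sub (e f : NExpr)

/-- Value of an index expression. -/
def NExpr.eval (s : State) : NExpr → ℕ
  | .const k => k
  | .var x => s.nat x
  | .add e f => e.eval s + f.eval s
  | .sub e f => e.eval s - f.eval s

/-- Number of elementary operations needed to evaluate an index expression. -/
def NExpr.cost : NExpr → ℕ
  | .const _ => 1
  | .var _ => 1
  | .add e f => e.cost + f.cost + 1
  | .sub e f => e.cost + f.cost + 1

/-- Real expressions. -/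
inductive RExpr where
  | cast (e : NExpr)
  | get (a : ℕ) (i j : NExpr)
  | add (e f : RExpr)
  | sub (e f : RExpr)
  | mul (e f : RExpr)
  | div (e f : RExpr)
  | sqrt (e : RExpr)

/-- Value of a real expression. -/
def RExpr.eval (s : State) : RExpr → ℝ
  | .cast e => (e.eval s : ℝ)
  | .get a i j => s.real a (i.eval s) (j.eval s)
  | .add e f => e.eval s + f.eval s
  | .sub e f => e.eval s - f.eval s
  | .mul e f => e.eval s * f.eval s
  | .div e f => e.eval s / f.eval s
  | .sqrt e => Real.sqrt (e.eval s)

/-- Number of elementary operations needed to evaluate a real expression. -/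
def RExpr.cost : RExpr → ℕ
  | .cast e => e.cost + 1
  | .get _ i j => i.cost + j.cost + 1
  | .add e f => e.cost + f.cost + 1
  | .sub e f => e.cost + f.cost + 1
  | .mul e f => e.cost + f.cost + 1
  | .div e f => e.cost + f.cost + 1
  | .sqrt e => e.cost + 1

/-- Tests. -/
inductive Test where
  | natLt (e f : NExpr)
  | realLt (e f : RExpr)
  | neg (b : Test)

/-- Truth of a test. -/
def Test.Holds (s : State) : Test → Prop
  | .natLt e f => e.eval s < f.eval s
  | .realLt e f => e.eval s < f.eval s
  | .neg b => ¬ b.Holds s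

/-- Number of elementary operations needed to evaluate a test. -/
def Test.cost : Test → ℕ
  | .natLt e f => e.cost + f.cost + 1
  | .realLt e f => e.cost + f.cost + 1
  | .neg b => b.cost + 1

/-- Programs. -/
inductive Prog where
  | skip
  /-- store the value of an index expression in register `x` -/
  | setNat (x : ℕ) (e : NExpr)
  /-- store the value of a real expression in entry `(i, j)` of array `a` -/
  | setReal (a : ℕ) (i j : NExpr) (e : RExpr)
  /-- toss a fair coin and store the outcome, `0` or `1`, in register `x` -/
  | flip (x : ℕ)
  | seq (p q : Prog)
  | ite (b : Test) (p q : Prog)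
  | loop (b : Test) (p : Prog)

/-- Let `k` units of time pass. -/
def State.tick (s : State) (k : ℕ) : State := { s with clock := s.clock + k }

/-- Write `k` to register `x`. -/
def State.writeNat (s : State) (x k : ℕ) : State :=
  { s with nat := fun x' => if x' = x then k else s.nat x' }

/-- Write `z` to entry `(i, j)` of array `a`. -/
def State.writeReal (s : State) (a i j : ℕ) (z : ℝ) : State :=
  { s with real := fun a' i' j' => if a' = a ∧ i' = i ∧ j' = j then z else s.real a' i' j' }

/-- Toss the next coin of the stream `ω` and store the outcome in register `x`. -/
def State.toss (s : State) (ω : ℕ → Bool) (x : ℕ) : State :=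
  { s.writeNat x (if ω s.coins then 1 else 0) with coins := s.coins + 1 }

/-- `Exec ω p s s'`: on the coin stream `ω`, program `p` started in state `s` halts in state `s'`.
`loop b p` repeats `p` as long as `b` holds. -/
inductive Exec (ω : ℕ → Bool) : Prog → State → State → Prop
  | skip (s : State) : Exec ω .skip s (s.tick 1)
  | setNat (x : ℕ) (e : NExpr) (s : State) :
      Exec ω (.setNat x e) s ((s.writeNat x (e.eval s)).tick (e.cost + 1))
  | setReal (a : ℕ) (i j : NExpr) (e : RExpr) (s : State) :
      Exec ω (.setReal a i j e) s
        ((s.writeReal a (i.eval s) (j.eval s) (e.eval s)).tick (i.cost + j.cost + e.cost + 1))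
  | flip (x : ℕ) (s : State) : Exec ω (.flip x) s ((s.toss ω x).tick 1)
  | seq {p q : Prog} {s s' s'' : State} :
      Exec ω p s s' → Exec ω q s' s'' → Exec ω (.seq p q) s s''
  | ite_true {b : Test} {p q : Prog} {s s' : State} :
      b.Holds s → Exec ω p (s.tick b.cost) s' → Exec ω (.ite b p q) s s'
  | ite_false {b : Test} {p q : Prog} {s s' : State} :
      ¬ b.Holds s → Exec ω q (s.tick b.cost) s' → Exec ω (.ite b p q) s s'
  | loop_true {b : Test} {p : Prog} {s s' s'' : State} :
      b.Holds s → Exec ω p (s.tick b.cost) s' → Exec ω (.loop b p) s' s'' →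
        Exec ω (.loop b p) s s''
  | loop_false {b : Test} {p : Prog} {s : State} :
      ¬ b.Holds s → Exec ω (.loop b p) s (s.tick b.cost)

/-- The final state is unique. -/
theorem Exec.unique {ω : ℕ → Bool} {p : Prog} {s s₁ s₂ : State} (h₁ : Exec ω p s s₁)
    (h₂ : Exec ω p s s₂) : s₁ = s₂ := by
  induction h₁ generalizing s₂ with
  | skip => cases h₂; rfl
  | setNat => cases h₂; rfl
  | setReal => cases h₂; rfl
  | flip => cases h₂; rfl
  | seq _ _ ih₁ ih₂ =>
    cases h₂ with
    | seq a b => have := ih₁ a; subst this; exact ih₂ b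
  | ite_true hb _ ih =>
    cases h₂ with
    | ite_true _ a => exact ih a
    | ite_false hn _ => exact absurd hb hn
  | ite_false hb _ ih =>
    cases h₂ with
    | ite_true hn _ => exact absurd hn hb
    | ite_false _ a => exact ih a
  | loop_true hb _ _ ih₁ ih₂ =>
    cases h₂ with
    | loop_true _ a b => have := ih₁ a; subst this; exact ih₂ b
    | loop_false hn => exact absurd hb hn
  | loop_false hb =>
    cases h₂ with
    | loop_true hn _ _ => exact absurd hn hb
    | loop_false _ => rfl

open Classical in
/-- The final state of a run; the initial state if the run does not halt. -/
def Prog.final (p : Prog) (s : State) (ω : ℕ → Bool) : State :=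
  if h : ∃ s', Exec ω p s s' then h.choose else s

/-- The running time, which is `∞` for a run that does not halt. -/
def Prog.time (p : Prog) (s : State) (ω : ℕ → Bool) : ℝ≥0∞ :=
  ⨅ (s' : State) (_ : Exec ω p s s'), ((s'.clock - s.clock : ℕ) : ℝ≥0∞)

/-- The output of length `n` of a run: the first `n` entries of the zeroth column of array `2`. -/
def Prog.output (p : Prog) (s : State) (n : ℕ) (ω : ℕ → Bool) : Fin n → ℝ :=
  fun i => (p.final s ω).real 2 i 0

/-- The real array `a` of shape `k × l` that holds `x`, padded by zeros. -/
def pad {k l : ℕ} (x : Fin k → Fin l → ℝ) (i j : ℕ) : ℝ :=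
  if h : i < k ∧ j < l then x ⟨i, h.1⟩ ⟨j, h.2⟩ else 0

/-- Initial state for the input `v₁, …, vₙ, y ∈ ℝᵐ`: registers `0`, `1` hold `n`, `m`; row `i` of
array `0` holds `vᵢ`; the zeroth column of array `1` holds `y`. Everything else is zero. -/
def balancingInput {n m : ℕ} (v : Fin n → EuclideanSpace ℝ (Fin m))
    (y : EuclideanSpace ℝ (Fin m)) : State where
  nat x := if x = 0 then n else if x = 1 then m else 0
  real a :=
    if a = 0 then pad fun i j => v i j
    else if a = 1 then pad fun j (_ : Fin 1) => y j
    else fun _ _ => 0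
  coins := 0
  clock := 0

/-- Initial state for a walk that is started from `χ₀` with step size `γ`, threshold `δ` and `T`
steps: registers `0`, `1`, `2` hold `n`, `m`, `T`; row `i` of array `0` holds `vᵢ`; the zeroth
column of array `1` holds `χ₀`; entry `(0, 0)` of arrays `3` and `4` holds `γ` and `δ`. Everything
else is zero. -/
def walkInput {n m : ℕ} (v : Fin n → EuclideanSpace ℝ (Fin m)) (χ₀ : Fin n → ℝ) (γ δ : ℝ)
    (T : ℕ) : State where
  nat x := if x = 0 then n else if x = 1 then m else if x = 2 then T else 0
  real a :=
    if a = 0 then pad fun i j => v i j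
    else if a = 1 then pad fun i (_ : Fin 1) => χ₀ i
    else if a = 3 then pad fun (_ : Fin 1) (_ : Fin 1) => γ
    else if a = 4 then pad fun (_ : Fin 1) (_ : Fin 1) => δ
    else fun _ _ => 0
  coins := 0
  clock := 0

end RealRAM

/-! ## The random walk guided by solutions of the vector Komlós program -/

namespace KomlosWalk

/-- The step size `γ = 2 log₂(2n) / n^(5/2)`. -/
def stepSize (n : ℕ) : ℝ := 2 * Real.logb 2 (2 * n) / (n : ℝ) ^ (5 / 2 : ℝ)

/-- The threshold `δ = 2 √(2 ln 2 · log₂(2n)) / n`. -/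
def threshold (n : ℕ) : ℝ := 2 * Real.sqrt (2 * Real.log 2 * Real.logb 2 (2 * n)) / n

/-- The number of steps `T = ⌈2 / γ²⌉ · ⌈log₂(2n)⌉` of one attempt. -/
def numSteps (n : ℕ) : ℕ := ⌈2 / stepSize n ^ 2⌉₊ * ⌈Real.logb 2 (2 * n)⌉₊

variable {n m : ℕ}

/-- The `m × n` matrix with columns `v₁, …, vₙ`. -/
def colMatrix (v : Fin n → EuclideanSpace ℝ (Fin m)) : Matrix (Fin m) (Fin n) ℝ :=
  Matrix.of fun j i => v i j

/-- `S` solves the vector Komlós program for the active set `A`: `S ⪰ 0`, `S i i = 1` for `i ∈ A`,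
`S i i = 0` for `i ∉ A`, and `V S Vᵀ ⪯ I`. -/
def IsKomlosSolution (v : Fin n → EuclideanSpace ℝ (Fin m)) (A : Finset (Fin n))
    (S : Matrix (Fin n) (Fin n) ℝ) : Prop :=
  S.PosSemidef ∧ (∀ i ∈ A, S i i = 1) ∧ (∀ i ∉ A, S i i = 0) ∧
    (1 - colMatrix v * S * (colMatrix v).transpose).PosSemidef

/-- A guide selects the matrix `U(t)` used in step `t` from `t`, the current point `χ(t-1)` and the
active set `A(t)`. -/
abbrev Guide (n : ℕ) : Type :=
  ℕ → (Fin n → ℝ) → Finset (Fin n) → Matrix (Fin n) (Fin n) ℝ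

/-- The matrices `Σ(t) = U(t) U(t)ᵀ` solve the vector Komlós program. -/
def Guide.Solves (U : Guide n) (v : Fin n → EuclideanSpace ℝ (Fin m)) : Prop :=
  ∀ t χ A, IsKomlosSolution v A (U t χ A * (U t χ A).transpose)

/-- The pair `(χ(t), A(t+1))`: `χ(0) = χ₀`, `A(1)` is the full index set,
`χ(t) = χ(t-1) + γ U(t) r(t)` and `A(t+1) = {i : |χ(t)ᵢ| < 1 - δ}`. -/
def walk (U : Guide n) (χ₀ : Fin n → ℝ) (γ δ : ℝ) (r : ℕ → Fin n → ℝ) :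
    ℕ → (Fin n → ℝ) × Finset (Fin n)
  | 0 => (χ₀, Finset.univ)
  | t + 1 =>
    let χ := (walk U χ₀ γ δ r t).1
    let A := (walk U χ₀ γ δ r t).2
    let χ' := χ + γ • (U (t + 1) χ A).mulVec (r (t + 1))
    (χ', Finset.univ.filter fun i => |χ' i| < 1 - δ)

/-- The coins of the walk: coin `(k, t, i)` is the sign `r(t)ᵢ` of attempt `k`. -/
abbrev Coins (n : ℕ) : Type := ℕ × ℕ × Fin n → Bool

/-- The end point `χ(T)` of attempt `k`. -/
def endPoint (U : Guide n) (χ₀ : Fin n → ℝ) (γ δ : ℝ) (T : ℕ) (ω : Coins n) (k : ℕ) : Fin n → ℝ :=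
  (walk U χ₀ γ δ (fun t i => coinSign (ω (k, t, i))) T).1

/-- Attempt `k` succeeds if `|χ(T)ᵢ| ≥ 1 - δ` for all `i`. -/
def Succeeds (U : Guide n) (χ₀ : Fin n → ℝ) (γ δ : ℝ) (T : ℕ) (ω : Coins n) (k : ℕ) : Prop :=
  ∀ i, 1 - δ ≤ |endPoint U χ₀ γ δ T ω k i|

/-- The number of attempts until the first success, `∞` if there is none. -/
def attempts (U : Guide n) (χ₀ : Fin n → ℝ) (γ δ : ℝ) (T : ℕ) (ω : Coins n) : ℝ≥0∞ :=
  ⨅ (k : ℕ) (_ : Succeeds U χ₀ γ δ T ω k), ((k + 1 : ℕ) : ℝ≥0∞)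

/-- The output: the signs of the end point of the first successful attempt. -/
def output (U : Guide n) (χ₀ : Fin n → ℝ) (γ δ : ℝ) (T : ℕ) (ω : Coins n) : Fin n → ℝ :=
  fun i => if 0 ≤ endPoint U χ₀ γ δ T ω (sInf {k | Succeeds U χ₀ γ δ T ω k}) i then 1 else -1

end KomlosWalk

end

/-! Given the past, the increment of ⟨Vχ, θ⟩ in a step of the walk is a Rademacher sum with
coefficient vector γ(VU)ᵀθ, and VΣVᵀ ⪯ I bounds the sum of squares of its entries by γ². Hence the
moment generating function after T steps is at most exp(l²γ²T/2) (`avg_exp_walk_le`), where γ²T is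
of order log n. At the same time Σᵢᵢ = 1 makes active coordinates diffuse: the potential cos(9x/10),
set to 0 once the coordinate is frozen, shrinks on average by exp(-(729/2000)γ²) per step
(`avg_alive_le`). A union bound over the coordinates then shows that one attempt succeeds with
probability at least 1/10 (`measure_not_good_le`).

Attempts are independent, so their expected number is at most 10, and an event has for the first
successful attempt at most ten times the probability that it has for a single one
(`measure_first_le`). Rounding moves each coordinate by at most δ, hence each marginal by at most nδ
= O(√log n). Both losses are absorbed by the constant, because the tail bound is void for t ≤ σ
(`isSubgaussian_of_eq_signOut`).

Feasibility of the programs is shown by an explicit solution. Every active index has budget 1. In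
each round let p be the largest index with budget left, let w = ∑ zᵢvᵢ with z_p = 1 be the part of
v_p orthogonal to the earlier vectors with budget left, and add c·zzᵀ to Σ with the largest c ≤ 1
for which c·zᵢ² never exceeds the budget of i; then lower the budgets. Each round exhausts a budget,
so n rounds produce the right diagonal (`budget_end`). The vectors w have norm at most 1, those of
different pivots are orthogonal, and the weights c of one pivot add up to at most 1, so ∑ c·wwᵀ ⪯ I
(`sum_inner_sq_le`, `sum_len_mul_inner_sq_le`). This takes only arithmetic, comparisons and square
roots, so the machine finds U exactly (`solverProg_runs`).

Programs are verified in a logic of total correctness that also bounds time, given a bound B on the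
lengths of the counting loops. The program for the balancing problem is not given a starting point;
a greedy averaging scheme finds one whose image is within distance 1 of y (`startProg_runs`), and
simpler parameters γ = 1/n², δ = 1/n, T = 4Ln⁴ with 2n ≤ 2^L ≤ 4n avoid logarithms. Finally, machine
and abstract walk compute the same function `signOut` of coins indexed by attempt, step and
coordinate, read along injections, and injections preserve the law of fair coins
(`measurePreserving_comp`). -/

noncomputable section

namespace RealRAM

/-! ## Program logic for the real random access machine -/

/-- Sequential composition. -/
local infixr:60 " ;; " => Prog.seq

/-- Does the program write to register `x`? -/
def Prog.modNat : Prog → ℕ → Bool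
  | .skip, _ => false
  | .setNat x _, y => x == y
  | .setReal _ _ _ _, _ => false
  | .flip x, y => x == y
  | .seq p q, y => p.modNat y || q.modNat y
  | .ite _ p q, y => p.modNat y || q.modNat y
  | .loop _ p, y => p.modNat y

/-- Does the program write to array `a`? -/
def Prog.modReal : Prog → ℕ → Bool
  | .skip, _ => false
  | .setNat _ _, _ => false
  | .setReal a _ _ _, b => a == b
  | .flip _, _ => false
  | .seq p q, b => p.modReal b || q.modReal b
  | .ite _ p q, b => p.modReal b || q.modReal b
  | .loop _ p, b => p.modReal b

/-- Does the program contain coin tosses? -/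
def Prog.tosses : Prog → Bool
  | .skip => false
  | .setNat _ _ => false
  | .setReal _ _ _ _ => false
  | .flip _ => true
  | .seq p q => p.tosses || q.tosses
  | .ite _ p q => p.tosses || q.tosses
  | .loop _ p => p.tosses

/-- The parts of the memory that `p` does not mention as targets agree in `s` and `s'`. -/
structure Frame (p : Prog) (s s' : State) : Prop where
  nat : ∀ x, p.modNat x = false → s'.nat x = s.nat x
  real : ∀ a, p.modReal a = false → s'.real a = s.real a
  coins : p.tosses = false → s'.coins = s.coins

/-- The write sets are Boolean functions of the program text, so that later claims about untouched
registers and arrays of a concrete program close by `rfl` or `decide`. -/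
theorem Exec.frame {ω : ℕ → Bool} {p : Prog} {s s' : State} (h : Exec ω p s s') :
    Frame p s s' := by
  induction h with
  | skip s => exact ⟨fun _ _ => rfl, fun _ _ => rfl, fun _ => rfl⟩
  | setNat x e s =>
    refine ⟨fun y hy => ?_, fun _ _ => rfl, fun _ => rfl⟩
    have : ¬ y = x := by rintro rfl; simp [Prog.modNat] at hy
    simp [State.tick, State.writeNat, this]
  | setReal a i j e s =>
    refine ⟨fun _ _ => rfl, fun b hb => ?_, fun _ => rfl⟩
    have : ¬ b = a := by rintro rfl; simp [Prog.modReal] at hb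
    simp [State.tick, State.writeReal, this]
  | flip x s =>
    refine ⟨fun y hy => ?_, fun _ _ => rfl, fun h => by simp [Prog.tosses] at h⟩
    have : ¬ y = x := by rintro rfl; simp [Prog.modNat] at hy
    simp [State.tick, State.toss, State.writeNat, this]
  | seq _ _ ih₁ ih₂ =>
    refine ⟨fun y hy => ?_, fun y hy => ?_, fun hy => ?_⟩
    · simp only [Prog.modNat, Bool.or_eq_false_iff] at hy
      rw [ih₂.nat _ hy.2, ih₁.nat _ hy.1]
    · simp only [Prog.modReal, Bool.or_eq_false_iff] at hy
      rw [ih₂.real _ hy.2, ih₁.real _ hy.1]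
    · simp only [Prog.tosses, Bool.or_eq_false_iff] at hy
      rw [ih₂.coins hy.2, ih₁.coins hy.1]
  | ite_true _ _ ih =>
    refine ⟨fun y hy => ?_, fun y hy => ?_, fun hy => ?_⟩
    · simp only [Prog.modNat, Bool.or_eq_false_iff] at hy
      exact ih.nat _ hy.1
    · simp only [Prog.modReal, Bool.or_eq_false_iff] at hy
      exact ih.real _ hy.1
    · simp only [Prog.tosses, Bool.or_eq_false_iff] at hy
      exact ih.coins hy.1
  | ite_false _ _ ih =>
    refine ⟨fun y hy => ?_, fun y hy => ?_, fun hy => ?_⟩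
    · simp only [Prog.modNat, Bool.or_eq_false_iff] at hy
      exact ih.nat _ hy.2
    · simp only [Prog.modReal, Bool.or_eq_false_iff] at hy
      exact ih.real _ hy.2
    · simp only [Prog.tosses, Bool.or_eq_false_iff] at hy
      exact ih.coins hy.2
  | loop_true _ _ _ ih₁ ih₂ =>
    exact ⟨fun y hy => (ih₂.nat y hy).trans (ih₁.nat y hy),
      fun y hy => (ih₂.real y hy).trans (ih₁.real y hy),
      fun hy => (ih₂.coins hy).trans (ih₁.coins hy)⟩
  | loop_false _ => exact ⟨fun _ _ => rfl, fun _ _ => rfl, fun _ => rfl⟩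

/-- An upper bound for the running time of runs in which every loop is executed at most `B` times
in a row. -/
def Prog.timeBound (B : ℕ) : Prog → ℕ
  | .skip => 1
  | .setNat _ e => e.cost + 1
  | .setReal _ i j e => i.cost + j.cost + e.cost + 1
  | .flip _ => 1
  | .seq p q => p.timeBound B + q.timeBound B
  | .ite b p q => b.cost + p.timeBound B + q.timeBound B
  | .loop b p => B * (b.cost + p.timeBound B) + b.cost

/-- A loop multiplies the bound by at most B + 1 and everything else adds, so the bound is
polynomial in B with constants that depend only on the text of the program. -/
theorem Prog.exists_timeBound_le (p : Prog) :
    ∃ K d : ℕ, ∀ B, p.timeBound B ≤ K * (B + 1) ^ d := by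
  have mono : ∀ (K d d' B : ℕ), d ≤ d' → K * (B + 1) ^ d ≤ K * (B + 1) ^ d' := fun K d d' B h =>
    Nat.mul_le_mul_left _ (Nat.pow_le_pow_right (Nat.succ_pos B) h)
  have one : ∀ d B : ℕ, 1 ≤ (B + 1) ^ d := fun d B => Nat.one_le_pow _ _ (Nat.succ_pos B)
  induction p with
  | skip => exact ⟨1, 0, fun B => by simp [Prog.timeBound]⟩
  | setNat x e => exact ⟨e.cost + 1, 0, fun B => by simp [Prog.timeBound]⟩
  | setReal a i j e => exact ⟨i.cost + j.cost + e.cost + 1, 0, fun B => by simp [Prog.timeBound]⟩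
  | flip x => exact ⟨1, 0, fun B => by simp [Prog.timeBound]⟩
  | seq p q ihp ihq =>
    obtain ⟨K₁, d₁, h₁⟩ := ihp
    obtain ⟨K₂, d₂, h₂⟩ := ihq
    refine ⟨K₁ + K₂, d₁ + d₂, fun B => ?_⟩
    have a := (h₁ B).trans (mono K₁ d₁ (d₁ + d₂) B (by omega))
    have b := (h₂ B).trans (mono K₂ d₂ (d₁ + d₂) B (by omega))
    simp only [Prog.timeBound, add_mul]
    omega
  | ite b p q ihp ihq =>
    obtain ⟨K₁, d₁, h₁⟩ := ihp
    obtain ⟨K₂, d₂, h₂⟩ := ihq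
    refine ⟨b.cost + K₁ + K₂, d₁ + d₂, fun B => ?_⟩
    have h := (h₁ B).trans (mono K₁ d₁ (d₁ + d₂) B (by omega))
    have h' := (h₂ B).trans (mono K₂ d₂ (d₁ + d₂) B (by omega))
    have h'' := Nat.le_mul_of_pos_right b.cost (one (d₁ + d₂) B)
    simp only [Prog.timeBound, add_mul]
    omega
  | loop b p ihp =>
    obtain ⟨K, d, h⟩ := ihp
    refine ⟨b.cost + K + b.cost, d + 1, fun B => ?_⟩
    have h₁ : b.cost + p.timeBound B ≤ (b.cost + K) * (B + 1) ^ d := by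
      rw [add_mul]
      exact Nat.add_le_add (Nat.le_mul_of_pos_right _ (one d B)) (h B)
    have h₂ := Nat.le_mul_of_pos_right b.cost (one (d + 1) B)
    have h₃ : B * (b.cost + p.timeBound B) ≤ (b.cost + K) * (B + 1) ^ (d + 1) :=
      calc B * (b.cost + p.timeBound B) ≤ (B + 1) * ((b.cost + K) * (B + 1) ^ d) :=
            Nat.mul_le_mul (Nat.le_succ B) h₁
        _ = (b.cost + K) * (B + 1) ^ (d + 1) := by ring
    simp only [Prog.timeBound]
    rw [add_mul (b.cost + K)]
    omega

/-- On the coins `ω`, the program halts within its time bound in a state that satisfies `Q`. -/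
def Runs (B : ℕ) (ω : ℕ → Bool) (p : Prog) (s : State) (Q : State → Prop) : Prop :=
  ∃ s', Exec ω p s s' ∧ s'.clock ≤ s.clock + p.timeBound B ∧ Q s'

variable {B : ℕ} {ω : ℕ → Bool} {p q : Prog} {s : State} {Q R : State → Prop}

theorem Runs.mono (h : Runs B ω p s Q) (hQ : ∀ s', Frame p s s' → Q s' → R s') :
    Runs B ω p s R := by
  obtain ⟨s', h₁, h₂, h₃⟩ := h
  exact ⟨s', h₁, h₂, hQ s' h₁.frame h₃⟩

theorem Runs.skip (h : Q (s.tick 1)) : Runs B ω .skip s Q :=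
  ⟨_, .skip s, le_rfl, h⟩

theorem Runs.setNat {x : ℕ} {e : NExpr} (h : Q ((s.writeNat x (e.eval s)).tick (e.cost + 1))) :
    Runs B ω (.setNat x e) s Q :=
  ⟨_, .setNat x e s, le_rfl, h⟩

theorem Runs.setReal {a : ℕ} {i j : NExpr} {e : RExpr}
    (h : Q ((s.writeReal a (i.eval s) (j.eval s) (e.eval s)).tick
      (i.cost + j.cost + e.cost + 1))) :
    Runs B ω (.setReal a i j e) s Q :=
  ⟨_, .setReal a i j e s, le_rfl, h⟩

theorem Runs.flip {x : ℕ} (h : Q ((s.toss ω x).tick 1)) : Runs B ω (.flip x) s Q :=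
  ⟨_, .flip x s, le_rfl, h⟩

theorem Runs.seq (h₁ : Runs B ω p s R) (h₂ : ∀ s', Frame p s s' → R s' → Runs B ω q s' Q) :
    Runs B ω (p ;; q) s Q := by
  obtain ⟨s', e₁, c₁, r₁⟩ := h₁
  obtain ⟨s'', e₂, c₂, r₂⟩ := h₂ s' e₁.frame r₁
  refine ⟨s'', .seq e₁ e₂, ?_, r₂⟩
  simp only [Prog.timeBound]
  omega

theorem Runs.ite {b : Test} (h₁ : b.Holds s → Runs B ω p (s.tick b.cost) Q)
    (h₂ : ¬ b.Holds s → Runs B ω q (s.tick b.cost) Q) : Runs B ω (.ite b p q) s Q := by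
  by_cases hb : b.Holds s
  · obtain ⟨s', e, c, r⟩ := h₁ hb
    refine ⟨s', .ite_true hb e, ?_, r⟩
    simp only [Prog.timeBound, State.tick] at c ⊢
    omega
  · obtain ⟨s', e, c, r⟩ := h₂ hb
    refine ⟨s', .ite_false hb e, ?_, r⟩
    simp only [Prog.timeBound, State.tick] at c ⊢
    omega

/-- `for x = 0, 1, …, y - 1 do p`, where `y` is a register. -/
def Prog.forTo (x y : ℕ) (p : Prog) : Prog :=
  .setNat x (.const 0) ;;
    .loop (.natLt (.var x) (.var y)) (p ;; .setNat x (.add (.var x) (.const 1)))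

/-- The counter and the clock change between rounds, so the invariant has to ignore both (`hI`).
Every round sees the frame relative to the state before the loop, which saves carrying unchanged
memory in the invariant. -/
theorem Runs.forTo {x y : ℕ} (N : ℕ) (I : ℕ → State → Prop) (hx : p.modNat x = false)
    (hy : (Prog.forTo x y p).modNat y = false) (hN : s.nat y = N) (hB : N ≤ B)
    (hI : ∀ k s v c, I k s → I k ((s.writeNat x v).tick c)) (h₀ : I 0 s)
    (hstep : ∀ k < N, ∀ s', Frame (Prog.forTo x y p) s s' → s'.nat x = k → I k s' →
      Runs B ω p s' (I (k + 1))) :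
    Runs B ω (Prog.forTo x y p) s (I N) := by
  have hxy : ¬ y = x := by
    rintro rfl
    simp [Prog.forTo, Prog.modNat] at hy
  have hpy : p.modNat y = false := by
    simp only [Prog.forTo, Prog.modNat, Bool.or_eq_false_iff] at hy
    exact hy.2.1
  set body := p ;; Prog.setNat x (.add (.var x) (.const 1)) with hbody
  set lp := Prog.loop (.natLt (.var x) (.var y)) body with hlp
  -- Induction on the number `j` of rounds still to come; 3 is the cost of the loop test.
  have key : ∀ (j k : ℕ) (s' : State), k + j = N → Frame (Prog.forTo x y p) s s' → s'.nat x = k →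
      I k s' → ∃ s'', Exec ω lp s' s'' ∧
        s''.clock ≤ s'.clock + (j * (3 + body.timeBound B) + 3) ∧ I N s'' := by
    intro j
    induction j with
    | zero =>
      intro k s' hk hf hkx hIk
      refine ⟨s'.tick 3, ?_, by simp [State.tick], ?_⟩
      · apply Exec.loop_false (b := .natLt (.var x) (.var y))
        simp only [Test.Holds, NExpr.eval]
        rw [hf.nat y hy, hN, hkx]
        omega
      · have := hI k s' (s'.nat x) 3 hIk
        -- Overwriting a register with its own value changes nothing, so `hI` also covers the mere
        -- passing of time.
        have e : (s'.writeNat x (s'.nat x)).tick 3 = s'.tick 3 := by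
          ext z <;> simp [State.tick, State.writeNat]
          rintro rfl; rfl
        rw [e] at this
        have : k = N := by omega
        subst this; assumption
    | succ j ih =>
      intro k s' hk hf hkx hIk
      have hI' : I k (s'.tick 3) := by
        have := hI k s' (s'.nat x) 3 hIk
        have e : (s'.writeNat x (s'.nat x)).tick 3 = s'.tick 3 := by
          ext z <;> simp [State.tick, State.writeNat]
          rintro rfl; rfl
        rwa [e] at this
      have hf' : Frame (Prog.forTo x y p) s (s'.tick 3) := ⟨hf.nat, hf.real, hf.coins⟩
      obtain ⟨s₁, e₁, c₁, r₁⟩ := hstep k (by omega) (s'.tick 3) hf' hkx hI'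
      have fr := e₁.frame
      set s₂ := (s₁.writeNat x (k + 1)).tick 4 with hs₂
      have hx₁ : s₁.nat x = k := (fr.nat x hx).trans hkx
      have eb : Exec ω body (s'.tick 3) s₂ := by
        have e₂ := Exec.setNat (ω := ω) x (.add (.var x) (.const 1)) s₁
        simp only [NExpr.eval, hx₁, NExpr.cost] at e₂
        exact .seq e₁ e₂
      have hf₂ : Frame (Prog.forTo x y p) s s₂ := by
        have fb := eb.frame
        refine ⟨fun z hz => ?_, fun z hz => ?_, fun hz => ?_⟩
        · rw [fb.nat z, hf'.nat z hz]
          simp only [Prog.forTo, Prog.modNat, Bool.or_eq_false_iff, hbody] at hz ⊢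
          exact hz.2
        · rw [fb.real z, hf'.real z hz]
          simp only [Prog.forTo, Prog.modReal, Bool.or_eq_false_iff, hbody] at hz ⊢
          exact hz.2
        · rw [fb.coins, hf'.coins hz]
          simp only [Prog.forTo, Prog.tosses, Bool.or_eq_false_iff, hbody] at hz ⊢
          exact hz.2
      obtain ⟨s₃, e₃, c₃, r₃⟩ := ih (k + 1) s₂ (by omega) hf₂
        (by simp [hs₂, State.tick, State.writeNat]) (hI _ _ _ _ r₁)
      refine ⟨s₃, Exec.loop_true ?_ eb e₃, ?_, r₃⟩
      · simp only [Test.Holds, NExpr.eval]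
        rw [hf.nat y hy, hN, hkx]
        omega
      · have : s₂.clock = s₁.clock + 4 := rfl
        have h4 : body.timeBound B = p.timeBound B + 4 := by
          simp [hbody, Prog.timeBound, NExpr.cost]
        have h5 : (s'.tick 3).clock = s'.clock + 3 := rfl
        rw [this] at c₃
        rw [h5] at c₁
        have : (j + 1) * (3 + body.timeBound B) =
          j * (3 + body.timeBound B) + (3 + body.timeBound B) := by ring
        rw [this]
        omega
  have f₀ : Frame (Prog.forTo x y p) s ((s.writeNat x 0).tick 2) := by
    refine ⟨fun z hz => ?_, fun _ _ => rfl, fun _ => rfl⟩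
    have : ¬ z = x := by rintro rfl; simp [Prog.forTo, Prog.modNat] at hz
    simp [State.tick, State.writeNat, this]
  obtain ⟨s', e, c, r⟩ := key N 0 ((s.writeNat x 0).tick 2) (by omega) f₀
    (by simp [State.tick, State.writeNat]) (hI _ _ _ _ h₀)
  refine ⟨s', .seq (Exec.setNat x (.const 0) s) e, ?_, r⟩
  refine c.trans ?_
  have h1 : ((s.writeNat x 0).tick 2).clock = s.clock + 2 := rfl
  have h2 : (Prog.forTo x y p).timeBound B = 2 + (B * (3 + body.timeBound B) + 3) := rfl
  have h3 := Nat.mul_le_mul_right (3 + body.timeBound B) hB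
  rw [h1, h2]
  omega

theorem Prog.final_eq {s' : State} (h : Exec ω p s s') : p.final s ω = s' := by
  have hex : ∃ s', Exec ω p s s' := ⟨s', h⟩
  rw [Prog.final, dif_pos hex]
  exact hex.choose_spec.unique h

theorem Prog.time_le {s' : State} (h : Exec ω p s s') :
    p.time s ω ≤ ((s'.clock - s.clock : ℕ) : ℝ≥0∞) :=
  iInf₂_le s' h

end RealRAM
end

noncomputable section

namespace KomlosSolver

open Finset

/-! ## An exact solver for the vector Komlós program -/

variable (M : ℕ → ℕ → ℝ) (n : ℕ)

/-- Entry `i` of `M u`, for an `n × n` matrix `M`. -/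
def dotRow (u : ℕ → ℝ) (i : ℕ) : ℝ := ∑ l ∈ range n, M i l * u l

/-- Coefficients of the Gram-Schmidt vectors of those `vᵢ` with `bᵢ > 0`, where `M` is the Gram
matrix of the `vᵢ`. -/
def gsRow (b : ℕ → ℝ) (i : ℕ) : ℕ → ℝ :=
  if 0 < b i then
    Pi.single i 1 - ∑ j ∈ (range i).attach,
      (dotRow M n (gsRow b j.1) i / dotRow M n (gsRow b j.1) j.1) • gsRow b j.1
  else 0
termination_by i
decreasing_by all_goals exact mem_range.1 j.2

/-- The first `k` summands of the Gram-Schmidt procedure for row `i`. -/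
def gsPartial (b : ℕ → ℝ) (i k : ℕ) : ℕ → ℝ :=
  Pi.single i 1 - ∑ j ∈ range k,
    (dotRow M n (gsRow M n b j) i / dotRow M n (gsRow M n b j) j) • gsRow M n b j

/-- The row of the largest `i < k` with `bᵢ > 0`. -/
def pivotRow (b : ℕ → ℝ) : ℕ → ℕ → ℝ
  | 0 => 0
  | k + 1 => if 0 < b k then gsRow M n b k else pivotRow b k

/-- The largest `c ≤ 1` with `c zᵢ² ≤ bᵢ` for all `i < k`. -/
def stepLen (b z : ℕ → ℝ) : ℕ → ℝ
  | 0 => 1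
  | k + 1 => if b k < stepLen b z k * (z k * z k) then b k / (z k * z k) else stepLen b z k

/-- The budgets that are left after `s` rounds. -/
def budget (b : ℕ → ℝ) : ℕ → ℕ → ℝ
  | 0 => b
  | s + 1 => fun i => budget b s i -
      stepLen (budget b s) (pivotRow M n (budget b s) n) n *
        (pivotRow M n (budget b s) n i * pivotRow M n (budget b s) n i)

/-- The direction of round `s`. -/
def dir (b : ℕ → ℝ) (s : ℕ) : ℕ → ℝ := pivotRow M n (budget M n b s) n

/-- The step length of round `s`. -/
def len (b : ℕ → ℝ) (s : ℕ) : ℝ := stepLen (budget M n b s) (dir M n b s) n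

/-- Entry `(i, s)` of the matrix `U`. -/
def entry (b : ℕ → ℝ) (i s : ℕ) : ℝ := Real.sqrt (len M n b s) * dir M n b s i

variable {M n} {b z : ℕ → ℝ}

theorem gsRow_eq (i : ℕ) : gsRow M n b i = if 0 < b i then gsPartial M n b i i else 0 := by
  rw [gsRow, gsPartial]
  congr 2
  exact sum_attach (range i)
    (fun j => (dotRow M n (gsRow M n b j) i / dotRow M n (gsRow M n b j) j) • gsRow M n b j)

theorem gsPartial_succ (i k : ℕ) : gsPartial M n b i (k + 1) = gsPartial M n b i k -
    (dotRow M n (gsRow M n b k) i / dotRow M n (gsRow M n b k) k) • gsRow M n b k := by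
  simp only [gsPartial, sum_range_succ]
  abel

theorem budget_succ (s i : ℕ) : budget M n b (s + 1) i =
    budget M n b s i - len M n b s * (dir M n b s i * dir M n b s i) := rfl

/-- Triangularity has two uses: a round spends only budgets that are still positive, and a direction
involves no vector beyond its pivot, which gives orthogonality across pivots. -/
theorem gsRow_supp (i l : ℕ) (h : gsRow M n b i l ≠ 0) : l ≤ i ∧ 0 < b l := by
  induction i using Nat.strong_induction_on with
  | _ i ih =>
    rw [gsRow_eq] at h
    split_ifs at h with hb
    · by_cases hl : l = i
      · subst hl; exact ⟨le_rfl, hb⟩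
      · simp only [gsPartial, Pi.sub_apply, Pi.single_apply, hl, if_false, Finset.sum_apply,
          zero_sub, ne_eq, neg_eq_zero] at h
        obtain ⟨j, hj, hne⟩ := exists_ne_zero_of_sum_ne_zero h
        have hj' := mem_range.1 hj
        have := ih j hj' (fun h0 => hne (by simp [h0]))
        exact ⟨this.1.trans hj'.le, this.2⟩
    · exact absurd rfl h

theorem gsRow_self (i : ℕ) (hb : 0 < b i) : gsRow M n b i i = 1 := by
  rw [gsRow_eq, if_pos hb, gsPartial]
  have : (∑ j ∈ range i, (dotRow M n (gsRow M n b j) i / dotRow M n (gsRow M n b j) j) •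
      gsRow M n b j) i = 0 := by
    rw [Finset.sum_apply]
    refine sum_eq_zero fun j hj => ?_
    by_contra hne
    have := (gsRow_supp (M := M) (n := n) (b := b) j i (fun h0 => hne (by simp [h0]))).1
    have := mem_range.1 hj
    omega
  simp [this]

/-- The pivot: the largest `i < k` with `bᵢ > 0`. -/
theorem pivotRow_spec (k : ℕ) : (∀ i < k, ¬ 0 < b i) ∧ pivotRow M n b k = 0 ∨
    ∃ p < k, 0 < b p ∧ (∀ i < k, 0 < b i → i ≤ p) ∧ pivotRow M n b k = gsRow M n b p := by
  induction k with
  | zero => exact .inl ⟨fun i hi => absurd hi (Nat.not_lt_zero i), rfl⟩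
  | succ k ih =>
    by_cases hb : 0 < b k
    · exact .inr ⟨k, Nat.lt_succ_self k, hb, fun i hi _ => Nat.lt_succ_iff.1 hi,
        by simp [pivotRow, hb]⟩
    · have e : pivotRow M n b (k + 1) = pivotRow M n b k := by simp [pivotRow, hb]
      rw [e]
      rcases ih with ⟨h1, h2⟩ | ⟨p, hp, hbp, hmax, hr⟩
      · refine .inl ⟨fun i hi => ?_, h2⟩
        rcases Nat.lt_succ_iff_lt_or_eq.1 hi with h | rfl
        · exact h1 i h
        · exact hb
      · refine .inr ⟨p, by omega, hbp, fun i hi hbi => ?_, hr⟩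
        rcases Nat.lt_succ_iff_lt_or_eq.1 hi with h | rfl
        · exact hmax i h hbi
        · exact absurd hbi hb

/-- The minimum of 1 and the ratios bᵢ/zᵢ² is attained. A ratio is formed only if bᵢ < c·zᵢ², which
forces zᵢ ≠ 0, so there is never a division by zero. -/
theorem stepLen_spec (hb : ∀ i, 0 ≤ b i) (k : ℕ) : 0 ≤ stepLen b z k ∧ stepLen b z k ≤ 1 ∧
    (∀ i < k, stepLen b z k * (z i * z i) ≤ b i) ∧
    (stepLen b z k = 1 ∨ ∃ i < k, z i ≠ 0 ∧ stepLen b z k * (z i * z i) = b i) := by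
  induction k with
  | zero => simp [stepLen]
  | succ k ih =>
    obtain ⟨h0, h1, hle, hor⟩ := ih
    by_cases h : b k < stepLen b z k * (z k * z k)
    · have hz : z k ≠ 0 := by
        intro hz
        rw [hz] at h
        simp only [mul_zero] at h
        exact absurd (hb k) (not_le.2 h)
      have hpos : 0 < z k * z k := mul_self_pos.2 hz
      have e : stepLen b z (k + 1) = b k / (z k * z k) := by simp [stepLen, h]
      have hlt : stepLen b z (k + 1) ≤ stepLen b z k := by
        rw [e, div_le_iff₀ hpos]; exact h.le
      have heq : stepLen b z (k + 1) * (z k * z k) = b k := by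
        rw [e, div_mul_cancel₀ _ hpos.ne']
      refine ⟨by rw [e]; exact div_nonneg (hb k) hpos.le, hlt.trans h1, fun i hi => ?_,
        .inr ⟨k, Nat.lt_succ_self k, hz, heq⟩⟩
      rcases Nat.lt_succ_iff_lt_or_eq.1 hi with h | rfl
      · exact (mul_le_mul_of_nonneg_right hlt (mul_self_nonneg _)).trans (hle i h)
      · exact heq.le
    · have e : stepLen b z (k + 1) = stepLen b z k := by simp [stepLen, h]
      rw [e]
      refine ⟨h0, h1, fun i hi => ?_, ?_⟩
      · rcases Nat.lt_succ_iff_lt_or_eq.1 hi with h' | rfl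
        · exact hle i h'
        · exact not_lt.1 h
      · rcases hor with h | ⟨i, hi, h2⟩
        · exact .inl h
        · exact .inr ⟨i, by omega, h2⟩

theorem pivotRow_supp {k l : ℕ} (h : pivotRow M n b k l ≠ 0) : l < k ∧ 0 < b l := by
  rcases pivotRow_spec (M := M) (n := n) (b := b) k with ⟨_, h0⟩ | ⟨p, hp, _, _, hr⟩
  · rw [h0] at h; exact absurd rfl h
  · rw [hr] at h
    have := gsRow_supp p l h
    exact ⟨by omega, this.2⟩

theorem budget_nonneg (hb : ∀ i, 0 ≤ b i) (s : ℕ) : ∀ i, 0 ≤ budget M n b s i := by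
  induction s with
  | zero => exact hb
  | succ s ih =>
    intro i
    rw [budget_succ, sub_nonneg]
    by_cases hz : dir M n b s i = 0
    · simp [hz, ih i]
    · exact (stepLen_spec ih n).2.2.1 i (pivotRow_supp hz).1

theorem len_nonneg (hb : ∀ i, 0 ≤ b i) (s : ℕ) : 0 ≤ len M n b s :=
  (stepLen_spec (budget_nonneg hb s) n).1

theorem budget_succ_le (hb : ∀ i, 0 ≤ b i) (s i : ℕ) :
    budget M n b (s + 1) i ≤ budget M n b s i := by
  rw [budget_succ, sub_le_self_iff]
  exact mul_nonneg (len_nonneg hb s) (mul_self_nonneg _)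

theorem budget_antitone (hb : ∀ i, 0 ≤ b i) (i : ℕ) :
    Antitone fun s => budget M n b s i :=
  antitone_nat_of_succ_le fun s => budget_succ_le hb s i

theorem budget_eq (s i : ℕ) : budget M n b s i =
    b i - ∑ t ∈ range s, len M n b t * (dir M n b t i * dir M n b t i) := by
  induction s with
  | zero => simp [budget]
  | succ s ih => rw [budget_succ, ih, sum_range_succ]; ring

/-- Every round exhausts a budget. -/
theorem exists_budget_exhausted (hb : ∀ i, 0 ≤ b i) (hb1 : ∀ i, b i ≤ 1) (s : ℕ)
    (h : ∃ i < n, 0 < budget M n b s i) :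
    ∃ i < n, 0 < budget M n b s i ∧ budget M n b (s + 1) i = 0 := by
  have hnn := budget_nonneg (M := M) (n := n) hb s
  rcases pivotRow_spec (M := M) (n := n) (b := budget M n b s) n with ⟨h0, _⟩ | ⟨p, hp, hbp, _, hr⟩
  · obtain ⟨i, hi, h'⟩ := h
    exact absurd h' (h0 i hi)
  · obtain ⟨_, _, hle, hor⟩ := stepLen_spec (z := dir M n b s) hnn n
    -- With c = 1 the pivot itself is exhausted: its coefficient is 1, so 1 ≤ budget ≤ 1. Otherwise
    -- the index that limits c is exhausted.
    rcases hor with h1 | ⟨i, hi, hz, he⟩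
    · refine ⟨p, hp, hbp, ?_⟩
      have hz : dir M n b s p = 1 := by rw [dir, hr]; exact gsRow_self p hbp
      have h3 := hle p hp
      rw [h1, hz] at h3
      have h4 := (budget_antitone (M := M) (n := n) hb p (Nat.zero_le s)).trans (hb1 p)
      have h5 : budget M n b s p = 1 := le_antisymm h4 (by simpa using h3)
      rw [budget_succ, len, h1, hz, h5]; norm_num
    · refine ⟨i, hi, (pivotRow_supp hz).2, ?_⟩
      rw [budget_succ, len, he, sub_self]

/-- At least one positive budget disappears per round, so n rounds are enough; this is why U can be
an n × n matrix. -/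
theorem budget_end (hb : ∀ i, 0 ≤ b i) (hb1 : ∀ i, b i ≤ 1) {i : ℕ} (hi : i < n) :
    budget M n b n i = 0 := by
  have key : ∀ s, ((range n).filter fun i => 0 < budget M n b s i).card ≤ n - s := by
    intro s
    induction s with
    | zero => simpa using card_filter_le (range n) _
    | succ s ih =>
      have sub : ((range n).filter fun i => 0 < budget M n b (s + 1) i) ⊆
          ((range n).filter fun i => 0 < budget M n b s i) := by
        intro j hj
        simp only [mem_filter, mem_range] at hj ⊢
        exact ⟨hj.1, hj.2.trans_le (budget_succ_le hb s j)⟩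
      by_cases h : ∃ i < n, 0 < budget M n b s i
      · obtain ⟨j, hj, h1, h2⟩ := exists_budget_exhausted hb hb1 s h
        have : ((range n).filter fun i => 0 < budget M n b (s + 1) i).card <
            ((range n).filter fun i => 0 < budget M n b s i).card := by
          refine card_lt_card ⟨sub, fun hsub => ?_⟩
          have := hsub (mem_filter.2 ⟨mem_range.2 hj, h1⟩)
          simp [h2] at this
        omega
      · have : ((range n).filter fun i => 0 < budget M n b s i) = ∅ :=
          filter_eq_empty_iff.2 fun i hi h' => h ⟨i, mem_range.1 hi, h'⟩
        rw [this] at sub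
        rw [subset_empty.1 sub]
        simp
  have h0 := key n
  rw [Nat.sub_self, Nat.le_zero, card_eq_zero, filter_eq_empty_iff] at h0
  exact le_antisymm (not_lt.1 (h0 (mem_range.2 hi))) (budget_nonneg hb n i)

/-! ### The Gram-Schmidt vectors behind the coefficient rows. -/

section Inner

variable {E : Type*} [NormedAddCommGroup E] [InnerProductSpace ℝ E] {v : ℕ → E}

/-- The linear combination of the first `n` vectors with coefficients `u`. -/
def combo (v : ℕ → E) (n : ℕ) (u : ℕ → ℝ) : E := ∑ l ∈ range n, u l • v l

theorem dotRow_gram (u : ℕ → ℝ) (i : ℕ) :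
    dotRow (fun a b => inner ℝ (v a) (v b)) n u i = inner ℝ (v i) (combo v n u) := by
  simp only [dotRow, combo, inner_sum, inner_smul_right]
  exact sum_congr rfl fun l _ => mul_comm _ _

/-- The vector fⱼ differs from its Gram-Schmidt vector wⱼ by a combination of earlier ones, all
orthogonal to wⱼ. This lets `gsRow` divide by ⟨vⱼ, wⱼ⟩, which is linear in the coefficients, in
place of ‖wⱼ‖². If wⱼ = 0, numerator and denominator both vanish, and 0 / 0 = 0 skips the
projection. -/
theorem inner_gramSchmidt_self (f : ℕ → E) (j : ℕ) :
    inner ℝ (f j) (InnerProductSpace.gramSchmidt ℝ f j) =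
      ‖InnerProductSpace.gramSchmidt ℝ f j‖ ^ 2 := by
  have hsum : f j - InnerProductSpace.gramSchmidt ℝ f j =
      ∑ i ∈ Iio j, (inner ℝ (InnerProductSpace.gramSchmidt ℝ f i) (f j) /
        (‖InnerProductSpace.gramSchmidt ℝ f i‖ : ℝ) ^ 2) •
          InnerProductSpace.gramSchmidt ℝ f i := by
    nth_rewrite 1 [InnerProductSpace.gramSchmidt_def'' ℝ f j]
    simp
  have h1 : inner ℝ (f j - InnerProductSpace.gramSchmidt ℝ f j)
      (InnerProductSpace.gramSchmidt ℝ f j) = 0 := by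
    rw [hsum, sum_inner]
    refine sum_eq_zero fun k hk => ?_
    rw [inner_smul_left,
      InnerProductSpace.gramSchmidt_orthogonal ℝ f (Finset.mem_Iio.1 hk).ne]
    simp
  rw [inner_sub_left, sub_eq_zero] at h1
  rw [h1, real_inner_self_eq_norm_sq]

theorem norm_gramSchmidt_le (f : ℕ → E) (j : ℕ) :
    ‖InnerProductSpace.gramSchmidt ℝ f j‖ ≤ ‖f j‖ := by
  have h := real_inner_le_norm (f j) (InnerProductSpace.gramSchmidt ℝ f j)
  rw [inner_gramSchmidt_self, sq] at h
  rcases (norm_nonneg (InnerProductSpace.gramSchmidt ℝ f j)).eq_or_lt with h0 | h0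
  · rw [← h0]; exact norm_nonneg _
  · exact le_of_mul_le_mul_right h h0

/-- Vectors without budget are replaced by 0, so that the usual Gram-Schmidt process over all
indices projects off only the vectors with budget left. -/
theorem combo_gsRow {i : ℕ} (hi : i < n) :
    combo v n (gsRow (fun a b => inner ℝ (v a) (v b)) n b i) =
      InnerProductSpace.gramSchmidt ℝ (fun i => if 0 < b i then v i else 0) i := by
  set f : ℕ → E := fun i => if 0 < b i then v i else 0 with hf
  induction i using Nat.strong_induction_on with
  | _ i ih =>
    rw [gsRow_eq]
    split_ifs with hb
    · have lin : combo v n (gsPartial (fun a b => inner ℝ (v a) (v b)) n b i i) =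
          v i - ∑ j ∈ range i, (inner ℝ (v i) (combo v n (gsRow (fun a b => inner ℝ (v a) (v b)) n b j)) /
            inner ℝ (v j) (combo v n (gsRow (fun a b => inner ℝ (v a) (v b)) n b j))) •
            combo v n (gsRow (fun a b => inner ℝ (v a) (v b)) n b j) := by
        simp only [← dotRow_gram]
        rw [combo]
        simp only [gsPartial, Pi.sub_apply, Finset.sum_apply, Pi.smul_apply, sub_smul,
          sum_sub_distrib]
        congr 1
        · rw [sum_eq_single_of_mem i (mem_range.2 hi)]
          · simp
          · intro l _ hl; simp [hl]
        · simp only [sum_smul, combo, smul_sum]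
          rw [sum_comm]
          simp only [smul_eq_mul, mul_smul]
      rw [lin, InnerProductSpace.gramSchmidt_def]
      have hfi : f i = v i := by simp [hf, hb]
      rw [hfi, Nat.Iio_eq_range]
      congr 1
      refine sum_congr rfl fun j hj => ?_
      have hj' := mem_range.1 hj
      rw [ih j hj' (hj'.trans hi), Submodule.starProjection_singleton]
      by_cases hbj : 0 < b j
      · congr 1
        rw [real_inner_comm]
        congr 1
        have hfj : f j = v j := by simp [hf, hbj]
        have h1 := inner_gramSchmidt_self f j
        rw [hfj] at h1
        rw [h1]
        simp
      · have : InnerProductSpace.gramSchmidt ℝ f j = 0 := by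
          rw [← ih j hj' (hj'.trans hi), gsRow_eq, if_neg hbj]
          simp [combo]
        simp [this]
    · have hz : f i = 0 := by simp [hf, hb]
      rw [InnerProductSpace.gramSchmidt_def, hz]
      simp [combo]

end Inner
end KomlosSolver
end

/-! ### Feasibility of the explicit solution. -/

noncomputable section

namespace KomlosSolver

open Finset

/-- A Bessel-type inequality for vectors that come in mutually orthogonal groups of total weight
at most `1`. -/
theorem sum_inner_sq_le {E ι κ : Type*} [NormedAddCommGroup E] [InnerProductSpace ℝ E]
    [DecidableEq κ] (s : Finset ι) (w : ι → E) (c : ι → ℝ) (p : ι → κ)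
    (hc : ∀ i ∈ s, 0 ≤ c i) (hw : ∀ i ∈ s, ‖w i‖ ≤ 1)
    (horth : ∀ i ∈ s, ∀ j ∈ s, p i ≠ p j → inner ℝ (w i) (w j) = 0)
    (hsum : ∀ i ∈ s, ∑ j ∈ s with p j = p i, c j ≤ 1) (θ : E) :
    ∑ i ∈ s, c i * inner ℝ (w i) θ ^ 2 ≤ ‖θ‖ ^ 2 := by
  set x : ι → ℝ := fun i => inner ℝ (w i) θ with hx
  set Q := ∑ i ∈ s, c i * x i ^ 2 with hQ
  -- The vector η satisfies ⟨η, θ⟩ = Q. In ‖η‖² only pairs within a group survive; bounding xᵢxⱼ by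
  -- (xᵢ² + xⱼ²)/2 and using group weight at most 1 gives ‖η‖² ≤ Q. Then Q ≤ ‖η‖‖θ‖ ≤ (Q + ‖θ‖²)/2.
  set η := ∑ i ∈ s, (c i * x i) • w i with hη
  have h1 : inner ℝ η θ = Q := by
    rw [hη, sum_inner]
    refine sum_congr rfl fun i _ => ?_
    rw [real_inner_smul_left]; ring
  have h2 : ‖η‖ ^ 2 ≤ Q := by
    have e : ‖η‖ ^ 2 = ∑ i ∈ s, ∑ j ∈ s, c i * x i * (c j * x j) * inner ℝ (w i) (w j) := by
      rw [← real_inner_self_eq_norm_sq, hη, sum_inner]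
      refine sum_congr rfl fun i _ => ?_
      rw [real_inner_smul_left, inner_sum, mul_sum]
      refine sum_congr rfl fun j _ => ?_
      rw [real_inner_smul_right]; ring
    have hle : ∀ i ∈ s, ∀ j ∈ s, c i * x i * (c j * x j) * inner ℝ (w i) (w j) ≤
        if p j = p i then c i * c j * (x i ^ 2 + x j ^ 2) / 2 else 0 := by
      intro i hi j hj
      split_ifs with hp
      · have h3 : |inner ℝ (w i) (w j)| ≤ 1 :=
          (abs_real_inner_le_norm _ _).trans
            (mul_le_one₀ (hw i hi) (norm_nonneg _) (hw j hj))
        have h4 : x i * x j * inner ℝ (w i) (w j) ≤ (x i ^ 2 + x j ^ 2) / 2 := by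
          calc x i * x j * inner ℝ (w i) (w j) ≤ |x i * x j * inner ℝ (w i) (w j)| := le_abs_self _
            _ = |x i * x j| * |inner ℝ (w i) (w j)| := abs_mul _ _
            _ ≤ |x i * x j| * 1 := mul_le_mul_of_nonneg_left h3 (abs_nonneg _)
            _ ≤ (x i ^ 2 + x j ^ 2) / 2 := by
              rw [mul_one, abs_le]
              constructor <;> nlinarith [sq_nonneg (x i - x j), sq_nonneg (x i + x j)]
        have h5 := mul_le_mul_of_nonneg_left h4 (mul_nonneg (hc i hi) (hc j hj))
        linarith
      · rw [horth i hi j hj (fun h => hp h.symm), mul_zero]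
    have half : ∑ i ∈ s, ∑ j ∈ s, (if p j = p i then c i * c j * x i ^ 2 else 0) ≤ Q := by
      refine sum_le_sum fun i hi => ?_
      rw [← sum_filter]
      have : ∑ j ∈ s with p j = p i, c i * c j * x i ^ 2 =
          c i * x i ^ 2 * ∑ j ∈ s with p j = p i, c j := by
        rw [mul_sum]; exact sum_congr rfl fun j _ => by ring
      rw [this]
      exact mul_le_of_le_one_right (mul_nonneg (hc i hi) (sq_nonneg _)) (hsum i hi)
    have half' : ∑ i ∈ s, ∑ j ∈ s, (if p j = p i then c i * c j * x j ^ 2 else 0) ≤ Q := by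
      rw [sum_comm]
      refine le_trans (le_of_eq ?_) half
      refine sum_congr rfl fun i _ => sum_congr rfl fun j _ => ?_
      simp only [eq_comm (a := p i)]
      split_ifs <;> ring
    rw [e]
    calc _ ≤ ∑ i ∈ s, ∑ j ∈ s,
          (if p j = p i then c i * c j * (x i ^ 2 + x j ^ 2) / 2 else 0) :=
          sum_le_sum fun i hi => sum_le_sum fun j hj => hle i hi j hj
      _ = (∑ i ∈ s, ∑ j ∈ s, (if p j = p i then c i * c j * x i ^ 2 else 0)) / 2 +
          (∑ i ∈ s, ∑ j ∈ s, (if p j = p i then c i * c j * x j ^ 2 else 0)) / 2 := by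
          simp only [sum_div, ← sum_add_distrib]
          refine sum_congr rfl fun i _ => sum_congr rfl fun j _ => ?_
          split_ifs <;> ring
      _ ≤ Q := by linarith
  have h3 : Q ≤ ‖η‖ * ‖θ‖ := h1 ▸ real_inner_le_norm η θ
  have hQ0 : 0 ≤ Q := sum_nonneg fun i hi => mul_nonneg (hc i hi) (sq_nonneg _)
  nlinarith [norm_nonneg η, norm_nonneg θ, sq_nonneg (‖η‖ - ‖θ‖)]

variable {n m : ℕ}

/-- Extension of a finite family of vectors by zero. -/
def extend (v : Fin n → EuclideanSpace ℝ (Fin m)) (a : ℕ) : EuclideanSpace ℝ (Fin m) :=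
  if h : a < n then v ⟨a, h⟩ else 0

/-- The Gram matrix. -/
def gram (v : Fin n → EuclideanSpace ℝ (Fin m)) (a b : ℕ) : ℝ :=
  inner ℝ (extend v a) (extend v b)

open Classical in
/-- The indicator function of a set of indices. -/
def indicator (A : Finset (Fin n)) (i : ℕ) : ℝ :=
  if ∃ h : i < n, (⟨i, h⟩ : Fin n) ∈ A then 1 else 0

/-- A solution of the vector Komlós program, factored. -/
def solver (v : Fin n → EuclideanSpace ℝ (Fin m)) (A : Finset (Fin n)) :
    Matrix (Fin n) (Fin n) ℝ :=
  Matrix.of fun i s => entry (gram v) n (indicator A) i s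

theorem indicator_nonneg (A : Finset (Fin n)) (i : ℕ) : 0 ≤ indicator A i := by
  rw [indicator]; split_ifs <;> norm_num

theorem indicator_le_one (A : Finset (Fin n)) (i : ℕ) : indicator A i ≤ 1 := by
  rw [indicator]; split_ifs <;> norm_num

theorem indicator_val (A : Finset (Fin n)) (i : Fin n) :
    indicator A i = if i ∈ A then 1 else 0 := by
  simp [indicator]

/-- The Bessel-type inequality applies with the rounds grouped by their pivot. -/
theorem sum_len_mul_inner_sq_le {E : Type*} [NormedAddCommGroup E] [InnerProductSpace ℝ E]
    {v : ℕ → E} (hv : ∀ i, ‖v i‖ ≤ 1) {b : ℕ → ℝ} (hb : ∀ i, 0 ≤ b i) (hb1 : ∀ i, b i ≤ 1)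
    (θ : E) :
    ∑ s ∈ range n, len (fun i j => inner ℝ (v i) (v j)) n b s *
      inner ℝ (combo v n (dir (fun i j => inner ℝ (v i) (v j)) n b s)) θ ^ 2 ≤ ‖θ‖ ^ 2 := by
  classical
  set M : ℕ → ℕ → ℝ := fun i j => inner ℝ (v i) (v j) with hM
  -- Rounds in which all budgets are spent have no pivot. Their direction is 0, so they can be left
  -- out.
  set R := (range n).filter fun s => ∃ i < n, 0 < budget M n b s i with hR
  have hex : ∀ s, (∃ i < n, 0 < budget M n b s i) → ∃ p < n, 0 < budget M n b s p ∧
      (∀ i < n, 0 < budget M n b s i → i ≤ p) ∧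
      dir M n b s = gsRow M n (budget M n b s) p := by
    rintro s ⟨i, hi, h⟩
    rcases pivotRow_spec (M := M) (n := n) (b := budget M n b s) n with ⟨h0, _⟩ | h
    · exact absurd h (h0 i hi)
    · exact h
  choose! p hpn hpb hpmax hpdir using hex
  have hRm : ∀ {s}, s ∈ R → ∃ i < n, 0 < budget M n b s i := fun h => (mem_filter.1 h).2
  set f : ℕ → ℕ → E := fun s i => if 0 < budget M n b s i then v i else 0 with hf
  have hcombo : ∀ s ∈ R, combo v n (dir M n b s) =
      InnerProductSpace.gramSchmidt ℝ (f s) (p s) := fun s hs => by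
    rw [hpdir s (hRm hs)]
    exact combo_gsRow (hpn s (hRm hs))
  -- The pivot of the later round t still had budget in round s, so it lies below the pivot of s.
  -- Hence the vector of round t is a combination of vectors that had all been projected off in
  -- round s.
  have hlt : ∀ s ∈ R, ∀ t ∈ R, s < t → p s ≠ p t →
      inner ℝ (combo v n (dir M n b s)) (combo v n (dir M n b t)) = 0 := by
    intro s hs t ht hst hne
    rw [hcombo s hs, combo, inner_sum]
    have hanti : ∀ i, budget M n b t i ≤ budget M n b s i := fun i => budget_antitone hb i hst.le
    refine sum_eq_zero fun l hl => ?_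
    rw [real_inner_smul_right]
    by_cases h0 : dir M n b t l = 0
    · simp [h0]
    · have h1 := h0
      rw [hpdir t (hRm ht)] at h1
      obtain ⟨h2, h3⟩ := gsRow_supp _ _ h1
      have h4 := hpmax s (hRm hs) (p t) (hpn t (hRm ht)) ((hpb t (hRm ht)).trans_le (hanti _))
      have h5 : f s l = v l := if_pos (h3.trans_le (hanti l))
      rw [← h5, InnerProductSpace.gramSchmidt_inv_triangular ℝ (f s) (by omega), mul_zero]
  have key := sum_inner_sq_le R (fun s => combo v n (dir M n b s)) (len M n b) p
    (fun s _ => len_nonneg hb s)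
    (fun s hs => by
      rw [hcombo s hs]
      refine (norm_gramSchmidt_le _ _).trans ?_
      simp only [hf]
      split_ifs
      · exact hv _
      · simp)
    (fun s hs t ht hne => by
      rcases lt_trichotomy s t with h | h | h
      · exact hlt s hs t ht h hne
      · exact absurd (congrArg p h) hne
      · rw [real_inner_comm]; exact hlt t ht s hs h hne.symm)
    -- The pivot has coefficient 1 in its own direction, so all rounds with this pivot draw their
    -- full weight from its budget, which is at most 1.
    (fun s hs => by
      have h1 := budget_eq (M := M) (n := n) (b := b) n (p s)
      have h2 := budget_nonneg (M := M) (n := n) hb n (p s)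
      have h3 : ∑ t ∈ R with p t = p s, len M n b t ≤
          ∑ t ∈ range n, len M n b t * (dir M n b t (p s) * dir M n b t (p s)) := by
        calc _ = ∑ t ∈ R with p t = p s,
              len M n b t * (dir M n b t (p s) * dir M n b t (p s)) := by
              refine sum_congr rfl fun t ht => ?_
              obtain ⟨ht, hpt⟩ := mem_filter.1 ht
              rw [← hpt, hpdir t (hRm ht), gsRow_self _ (hpb t (hRm ht))]
              ring
          _ ≤ _ := by
              refine sum_le_sum_of_subset_of_nonneg
                ((filter_subset _ _).trans (filter_subset _ _)) fun t _ _ => ?_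
              exact mul_nonneg (len_nonneg hb t) (mul_self_nonneg _)
      linarith [hb1 (p s)]) θ
  refine le_trans (le_of_eq ?_) key
  refine (sum_subset (filter_subset _ _) fun s hs hsR => ?_).symm
  have hno : ¬ ∃ i < n, 0 < budget M n b s i := fun h => hsR (mem_filter.2 ⟨hs, h⟩)
  have : dir M n b s = 0 := by
    rcases pivotRow_spec (M := M) (n := n) (b := budget M n b s) n with ⟨_, h⟩ | ⟨q, hq, hbq, _⟩
    · exact h
    · exact absurd ⟨q, hq, hbq⟩ hno
  simp [this, combo]

/-- With Σ = ∑ cₛzₛzₛᵀ, the diagonal records the budget spent, which is all of it, and the quadratic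
form of VΣVᵀ is the sum bounded by `sum_len_mul_inner_sq_le`. -/
theorem solver_solves (v : Fin n → EuclideanSpace ℝ (Fin m)) (hv : ∀ i, ‖v i‖ ≤ 1)
    (A : Finset (Fin n)) :
    KomlosWalk.IsKomlosSolution v A (solver v A * (solver v A).transpose) := by
  have hb := indicator_nonneg A
  have hb1 := indicator_le_one A
  have hdiag : ∀ i, (solver v A * (solver v A).transpose) i i = indicator A i := by
    intro i
    have h := budget_eq (M := gram v) (n := n) (b := indicator A) n i
    rw [budget_end hb hb1 i.2] at h
    have h' : indicator A i = ∑ t ∈ range n, len (gram v) n (indicator A) t *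
        (dir (gram v) n (indicator A) t i * dir (gram v) n (indicator A) t i) := by linarith
    rw [h', Matrix.mul_apply, ← Fin.sum_univ_eq_sum_range (fun t => len (gram v) n (indicator A) t *
        (dir (gram v) n (indicator A) t i * dir (gram v) n (indicator A) t i))]
    refine sum_congr rfl fun s _ => ?_
    simp only [solver, Matrix.transpose_apply, Matrix.of_apply, entry]
    linear_combination (dir (gram v) n (indicator A) s i) ^ 2 *
      Real.mul_self_sqrt (len_nonneg (M := gram v) (n := n) hb s)
  refine ⟨?_, fun i hi => ?_, fun i hi => ?_, ?_⟩
  · rw [← Matrix.conjTranspose_eq_transpose_of_trivial]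
    exact Matrix.posSemidef_self_mul_conjTranspose _
  · rw [hdiag, indicator_val, if_pos hi]
  · rw [hdiag, indicator_val, if_neg hi]
  · refine Matrix.PosSemidef.of_dotProduct_mulVec_nonneg ?_ fun x => ?_
    · rw [Matrix.IsHermitian, Matrix.conjTranspose_eq_transpose_of_trivial]
      simp [Matrix.transpose_mul, Matrix.mul_assoc]
    · have hext : ∀ i, ‖extend v i‖ ≤ 1 := fun i => by
        rw [extend]; split_ifs
        · exact hv _
        · simp
      have key := sum_len_mul_inner_sq_le (n := n) hext hb hb1 (WithLp.toLp 2 x)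
      set V := KomlosWalk.colMatrix v
      set U := solver v A
      have e1 : star x ⬝ᵥ (1 - V * (U * U.transpose) * V.transpose).mulVec x =
          x ⬝ᵥ x - ((V * U).transpose.mulVec x) ⬝ᵥ ((V * U).transpose.mulVec x) := by
        rw [Matrix.sub_mulVec, Matrix.one_mulVec, dotProduct_sub, star_trivial]
        congr 1
        have : V * (U * U.transpose) * V.transpose = (V * U) * (V * U).transpose := by
          simp [Matrix.transpose_mul, Matrix.mul_assoc]
        rw [this, ← Matrix.mulVec_mulVec, Matrix.dotProduct_mulVec, ← Matrix.mulVec_transpose]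
      have e2 : ∀ s : Fin n, (V * U).transpose.mulVec x s =
          Real.sqrt (len (gram v) n (indicator A) s) *
          inner ℝ (combo (extend v) n (dir (gram v) n (indicator A) s)) (WithLp.toLp 2 x) := by
        intro s
        simp only [combo, sum_inner, real_inner_smul_left]
        rw [← Fin.sum_univ_eq_sum_range (fun l => dir (gram v) n (indicator A) s l *
          inner ℝ (extend v l) (WithLp.toLp 2 x)), Matrix.transpose_mul, ← Matrix.mulVec_mulVec]
        rw [Matrix.mulVec, dotProduct, mul_sum]
        refine sum_congr rfl fun i _ => ?_
        simp only [Matrix.transpose_apply, U, solver, Matrix.of_apply, entry, mul_assoc]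
        congr 2
        simp [Matrix.mulVec, dotProduct, V, KomlosWalk.colMatrix, extend, PiLp.inner_apply,
          mul_comm]
      rw [e1, sub_nonneg]
      have e3 : x ⬝ᵥ x = ‖(WithLp.toLp 2 x : EuclideanSpace ℝ (Fin m))‖ ^ 2 := by
        rw [EuclideanSpace.norm_sq_eq]
        simp [dotProduct, sq]
      rw [e3]
      refine le_trans (le_of_eq ?_) key
      rw [← Fin.sum_univ_eq_sum_range (fun s => len (fun i j => inner ℝ (extend v i) (extend v j)) n
        (indicator A) s * inner ℝ (combo (extend v) n (dir (fun i j => inner ℝ (extend v i)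
          (extend v j)) n (indicator A) s)) (WithLp.toLp 2 x) ^ 2), dotProduct]
      refine sum_congr rfl fun s _ => ?_
      rw [e2]
      have := Real.mul_self_sqrt (len_nonneg (M := gram v) (n := n) hb s)
      change _ = len (gram v) n (indicator A) s * inner ℝ (combo (extend v) n
        (dir (gram v) n (indicator A) s)) (WithLp.toLp 2 x) ^ 2
      linear_combination (inner ℝ (combo (extend v) n (dir (gram v) n (indicator A) s))
        (WithLp.toLp 2 x)) ^ 2 * this

end KomlosSolver
end

noncomputable section

/-! ## Independent fair coins -/

namespace FairCoins

open Finset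

instance (ι : Type) : IsProbabilityMeasure (fairCoins ι) := by
  rw [fairCoins]; infer_instance

/-- The preimage of a box over `s` is a box over the image of `s`, and injectivity keeps the factors
in bijection. All comparisons of differently indexed coin streams rest on this. -/
theorem measurePreserving_comp {ι κ : Type} {f : ι → κ} (hf : Function.Injective f) :
    MeasurePreserving (fun ω : κ → Bool => ω ∘ f) (fairCoins κ) (fairCoins ι) := by
  have hm : Measurable (fun ω : κ → Bool => ω ∘ f) :=
    measurable_pi_lambda _ fun i => measurable_pi_apply (f i)
  refine ⟨hm, ?_⟩
  refine Measure.eq_infinitePi _ fun s t ht => ?_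
  classical
  rw [Measure.map_apply hm (MeasurableSet.pi s.countable_toSet fun i _ => ht i)]
  have hpre : (fun ω : κ → Bool => ω ∘ f) ⁻¹' Set.pi s t =
      Set.pi (s.image f) (Function.extend f t fun _ => Set.univ) := by
    ext ω
    simp [Set.mem_pi, hf.extend_apply]
  rw [hpre, fairCoins, Measure.infinitePi_pi]
  · rw [prod_image fun a _ b _ h => hf h]
    exact prod_congr rfl fun i _ => by rw [hf.extend_apply]
  · intro i _
    exact MeasurableSet.of_discrete

variable {κ : Type}

/-- The coins of attempt `k`. -/
def attempt (k : ℕ) (ω : ℕ × κ → Bool) : κ → Bool := fun x => ω (k, x)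

theorem measurable_attempt (k : ℕ) : Measurable (attempt (κ := κ) k) :=
  measurable_pi_lambda _ fun x => measurable_pi_apply (k, x)

/-- The number of the first attempt that is in `S`. -/
def first (S : Set (κ → Bool)) (ω : ℕ × κ → Bool) : ℕ := sInf {k | attempt k ω ∈ S}

/-- The number of attempts up to the first one in `S`. -/
def count (S : Set (κ → Bool)) (ω : ℕ × κ → Bool) : ℝ≥0∞ :=
  ⨅ (k : ℕ) (_ : attempt k ω ∈ S), ((k + 1 : ℕ) : ℝ≥0∞)

theorem attempt_first {S : Set (κ → Bool)} {ω : ℕ × κ → Bool} (h : ∃ k, attempt k ω ∈ S) :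
    attempt (first S ω) ω ∈ S :=
  Nat.sInf_mem (s := {k | attempt k ω ∈ S}) h

/-- The number of attempts is the number of k such that all attempts before k fail; this remains
true if it is infinite. The void condition on attempt k fits the form of `measure_attempts`. -/
theorem count_eq_tsum (S : Set (κ → Bool)) (ω : ℕ × κ → Bool) :
    count S ω = ∑' k : ℕ, Set.indicator
      {ω | (∀ j < k, attempt j ω ∈ Sᶜ) ∧ attempt k ω ∈ Set.univ} (fun _ => (1 : ℝ≥0∞)) ω := by
  classical
  by_cases h : ∃ k, attempt k ω ∈ S
  · have hspec := Nat.find_spec h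
    set K := Nat.find h with hK
    have h1 : count S ω = ((K + 1 : ℕ) : ℝ≥0∞) := by
      refine le_antisymm (iInf₂_le K hspec) (le_iInf₂ fun k hk => ?_)
      have := Nat.find_min' h hk
      exact_mod_cast Nat.succ_le_succ this
    rw [h1, tsum_eq_sum (s := range (K + 1))]
    · rw [sum_congr rfl (g := fun _ => 1)]
      · simp
      · intro k hk
        refine Set.indicator_of_mem ?_ _
        exact ⟨fun j hj => Nat.find_min h (by have := mem_range.1 hk; omega), trivial⟩
    · intro k hk
      refine Set.indicator_of_notMem ?_ _
      rintro ⟨h2, -⟩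
      exact h2 K (Nat.lt_of_succ_le (not_lt.1 (mem_range.not.1 hk))) hspec
  · push Not at h
    have h1 : count S ω = ∞ := by
      simp [count, h]
    rw [h1, tsum_congr (g := fun _ => 1)]
    · exact (ENNReal.tsum_const_eq_top_of_ne_zero one_ne_zero).symm
    · intro k
      refine Set.indicator_of_mem ?_ _
      exact ⟨fun j _ => h j, trivial⟩

variable [Finite κ]

theorem measurableSet_attempt (k : ℕ) (S : Set (κ → Bool)) :
    MeasurableSet {ω | attempt k ω ∈ S} :=
  measurable_attempt k (Set.toFinite S).measurableSet

/-- Currying turns the coins into a sequence of independent blocks, one per attempt. -/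
theorem measure_attempts (F G : Set (κ → Bool)) (k : ℕ) :
    fairCoins (ℕ × κ) {ω | (∀ j < k, attempt j ω ∈ F) ∧ attempt k ω ∈ G} =
      fairCoins κ F ^ k * fairCoins κ G := by
  have hc := Measure.infinitePi_map_curry (fun (_ : ℕ) (_ : κ) =>
    (PMF.uniformOfFintype Bool).toMeasure)
  have hset : {ω : ℕ × κ → Bool | (∀ j < k, attempt j ω ∈ F) ∧ attempt k ω ∈ G} =
      (MeasurableEquiv.curry ℕ κ Bool) ⁻¹'
        Set.pi (range (k + 1)) (fun j => if j < k then F else G) := by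
    ext ω
    simp only [Set.mem_ofPred_eq, Set.mem_preimage, Set.mem_pi, coe_range, Set.mem_Iio,
      MeasurableEquiv.coe_curry]
    constructor
    · rintro ⟨h1, h2⟩ j hj
      split_ifs with h
      · exact h1 j h
      · obtain rfl : j = k := by omega
        exact h2
    · intro h
      refine ⟨fun j hj => ?_, ?_⟩
      · have := h j (by omega); rwa [if_pos hj] at this
      · have := h k (by omega); rwa [if_neg (lt_irrefl k)] at this
  have hm : MeasurableSet (Set.pi (range (k + 1) : Set ℕ) (fun j => if j < k then F else G)) :=
    MeasurableSet.pi (range (k + 1)).countable_toSet fun i _ => (Set.toFinite _).measurableSet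
  rw [hset, ← MeasurableEquiv.map_apply, fairCoins]
  refine (congrFun (congrArg _ hc) _).trans ?_
  rw [Measure.infinitePi_pi _ fun i _ => (Set.toFinite _).measurableSet, prod_range_succ]
  congr 1
  · rw [prod_congr rfl (g := fun _ => fairCoins κ F)]
    · simp
    · intro j hj
      rw [if_pos (mem_range.1 hj), fairCoins]
  · rw [if_neg (lt_irrefl k), fairCoins]

theorem measurableSet_attempts (F G : Set (κ → Bool)) (k : ℕ) :
    MeasurableSet {ω | (∀ j < k, attempt j ω ∈ F) ∧ attempt k ω ∈ G} := by
  have : {ω | (∀ j < k, attempt j ω ∈ F) ∧ attempt k ω ∈ G} =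
      (⋂ j ∈ range k, {ω | attempt j ω ∈ F}) ∩ {ω | attempt k ω ∈ G} := by
    ext ω; simp
  rw [this]
  exact (Finset.measurableSet_biInter _ fun j _ => measurableSet_attempt j F).inter
    (measurableSet_attempt k G)

theorem measurable_count (S : Set (κ → Bool)) : Measurable (count S) := by
  have : count S = fun ω => ∑' k : ℕ, Set.indicator
      {ω | (∀ j < k, attempt j ω ∈ Sᶜ) ∧ attempt k ω ∈ Set.univ} (fun _ => (1 : ℝ≥0∞)) ω :=
    funext (count_eq_tsum S)
  rw [this]
  exact Measurable.tsum fun k =>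
    measurable_const.indicator (measurableSet_attempts _ _ k)

/-- Summing the tails gives a geometric series in the failure probability. In extended nonnegative
reals no case distinction is needed when that probability is 1. -/
theorem lintegral_count (S : Set (κ → Bool)) :
    ∫⁻ ω, count S ω ∂fairCoins (ℕ × κ) = (1 - fairCoins κ Sᶜ)⁻¹ := by
  simp only [count_eq_tsum]
  rw [lintegral_tsum fun k =>
    (measurable_const.indicator (measurableSet_attempts _ _ k)).aemeasurable]
  rw [← ENNReal.tsum_geometric]
  refine tsum_congr fun k => ?_
  rw [lintegral_indicator_const (measurableSet_attempts _ _ k), measure_attempts]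
  simp

variable {S : Set (κ → Bool)} {ε : ℝ≥0∞}

theorem lintegral_count_le (hS : fairCoins κ Sᶜ ≤ 9 / 10) :
    ∫⁻ ω, count S ω ∂fairCoins (ℕ × κ) ≤ 10 := by
  rw [lintegral_count, ENNReal.inv_le_iff_inv_le]
  refine le_trans ?_ (tsub_le_tsub_left hS 1)
  rw [← ENNReal.toReal_le_toReal (by simp) (by simp), ENNReal.toReal_sub_of_le]
  · norm_num
  · rw [ENNReal.div_le_iff (by simp) (by simp)]; norm_num
  · simp

theorem ae_exists_attempt (hS : fairCoins κ Sᶜ ≤ 9 / 10) :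
    ∀ᵐ ω ∂fairCoins (ℕ × κ), ∃ k, attempt k ω ∈ S := by
  have h := ae_lt_top (measurable_count S)
    ((lintegral_count_le hS).trans_lt (by simp)).ne
  filter_upwards [h] with ω hω
  by_contra hne
  push Not at hne
  simp [count, hne] at hω

/-- The output of the first successful attempt, as compared to that of a single attempt. -/
theorem measure_first_le (hS : fairCoins κ Sᶜ ≤ 9 / 10) (G : Set (κ → Bool)) :
    fairCoins (ℕ × κ) {ω | attempt (first S ω) ω ∈ G} ≤ 10 * fairCoins κ G := by
  -- That the final attempt succeeds is dropped from the event; only the failures before it are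
  -- kept. The probabilities of those failures sum to the mean number of attempts.
  have hsub : {ω | attempt (first S ω) ω ∈ G} ⊆ {ω | ¬ ∃ k, attempt k ω ∈ S} ∪
      ⋃ k, {ω | (∀ j < k, attempt j ω ∈ Sᶜ) ∧ attempt k ω ∈ G} := by
    intro ω hω
    by_cases h : ∃ k, attempt k ω ∈ S
    · exact .inr (Set.mem_iUnion.2 ⟨first S ω, fun j hj => Nat.notMem_of_lt_sInf hj, hω⟩)
    · exact .inl h
  refine (measure_mono hsub).trans ((measure_union_le _ _).trans ?_)
  have h0 : fairCoins (ℕ × κ) {ω | ¬ ∃ k, attempt k ω ∈ S} = 0 := ae_exists_attempt hS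
  rw [h0, zero_add]
  refine (measure_iUnion_le _).trans ?_
  simp only [measure_attempts]
  rw [ENNReal.tsum_mul_right, ENNReal.tsum_geometric, ← lintegral_count]
  exact mul_le_mul_left (lintegral_count_le hS) _

/-- The infimum of the empty set is 0, so attempt 0 is selected if none succeeds; the first part of
the union accounts for this. -/
theorem measurableSet_first (S G : Set (κ → Bool)) :
    MeasurableSet {ω | attempt (first S ω) ω ∈ G} := by
  have h : {ω | attempt (first S ω) ω ∈ G} = ({ω | attempt 0 ω ∈ G} ∩
      ⋂ j, {ω | attempt j ω ∈ Sᶜ}) ∪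
      ⋃ k, {ω | (∀ j < k, attempt j ω ∈ Sᶜ) ∧ attempt k ω ∈ S ∩ G} := by
    ext ω
    by_cases h : ∃ k, attempt k ω ∈ S
    · constructor
      · intro hω
        exact .inr (Set.mem_iUnion.2
          ⟨first S ω, fun j hj => Nat.notMem_of_lt_sInf hj, attempt_first h, hω⟩)
      · rintro (⟨-, hω⟩ | hω)
        · obtain ⟨k, hk⟩ := h
          exact absurd hk (Set.mem_iInter.1 hω k)
        · obtain ⟨k, h1, h2, h3⟩ := Set.mem_iUnion.1 hω
          have : first S ω = k := by
            refine le_antisymm (Nat.sInf_le h2) (not_lt.1 fun hlt => ?_)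
            exact h1 _ hlt (attempt_first h)
          change attempt (first S ω) ω ∈ G
          rwa [this]
    · push Not at h
      have hf : first S ω = 0 := by
        have : {k | attempt k ω ∈ S} = ∅ := Set.eq_empty_iff_forall_notMem.2 h
        rw [first, this, Nat.sInf_empty]
      constructor
      · intro hω
        change attempt (first S ω) ω ∈ G at hω
        rw [hf] at hω
        exact .inl ⟨hω, Set.mem_iInter.2 h⟩
      · rintro (⟨hω, -⟩ | hω)
        · change attempt (first S ω) ω ∈ G
          rwa [hf]
        · obtain ⟨k, -, h2, -⟩ := Set.mem_iUnion.1 hω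
          exact absurd h2 (h k)
  rw [h]
  exact ((measurableSet_attempt 0 G).inter (.iInter fun j => measurableSet_attempt j _)).union
    (.iUnion fun k => measurableSet_attempts _ _ k)

/-! ### Averages over finitely many coins -/

/-- The average of a function of finitely many coins. -/
def avg {α : Type*} [Fintype α] (f : α → ℝ) : ℝ := (∑ x, f x) / Fintype.card α

theorem avg_mono {α : Type*} [Fintype α] {f g : α → ℝ} (h : ∀ x, f x ≤ g x) : avg f ≤ avg g :=
  div_le_div_of_nonneg_right (sum_le_sum fun x _ => h x) (Nat.cast_nonneg _)

theorem avg_mul {α : Type*} [Fintype α] (c : ℝ) (f : α → ℝ) :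
    avg (fun x => c * f x) = c * avg f := by
  rw [avg, avg, ← mul_sum, mul_div_assoc]

theorem avg_sum {α ι : Type*} [Fintype α] (s : Finset ι) (f : ι → α → ℝ) :
    avg (fun x => ∑ i ∈ s, f i x) = ∑ i ∈ s, avg (f i) := by
  simp only [avg]
  rw [sum_comm, sum_div]

theorem avg_equiv {α β : Type*} [Fintype α] [Fintype β] (e : α ≃ β) (f : β → ℝ) :
    avg (fun x => f (e x)) = avg f := by
  rw [avg, avg, Fintype.card_congr e, e.sum_comp]

theorem avg_prod {α β : Type*} [Fintype α] [Fintype β] (f : α × β → ℝ) :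
    avg f = avg fun y => avg fun x => f (x, y) := by
  simp only [avg]
  rw [← sum_div, Fintype.sum_prod_type_right, Fintype.card_prod, div_div, Nat.cast_mul]

-- From here on an attempt is analysed on a finite uniform sample space, where every set is
-- measurable; the guide may therefore be an arbitrary function.
open Classical in
theorem measureReal_eq_avg [Fintype κ] [DecidableEq κ] (G : Set (κ → Bool)) :
    (fairCoins κ).real G = avg fun x => if x ∈ G then 1 else 0 := by
  have h1 : ∀ x : κ → Bool, (fairCoins κ).real {x} = 1 / Fintype.card (κ → Bool) := by
    intro x
    rw [Measure.real, fairCoins, Measure.infinitePi_singleton_of_fintype]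
    simp
  have h2 : G = ⋃ x ∈ (univ.filter fun x => x ∈ G : Finset (κ → Bool)), {x} := by
    ext x; simp
  rw [avg, sum_boole]
  conv_lhs => rw [h2]
  rw [measureReal_biUnion_finset]
  · simp only [h1]
    simp [div_eq_mul_inv]
  · intro a _ b _ hab
    simpa using hab
  · intro b _
    exact (Set.toFinite _).measurableSet

end FairCoins
end

noncomputable section

namespace KomlosWalk

open Finset FairCoins

/-! ## Analysis of the random walk -/

variable {n m : ℕ}

/-- One step of the walk. -/
def step (U : Guide n) (γ δ : ℝ) (t : ℕ) (st : (Fin n → ℝ) × Finset (Fin n)) (ρ : Fin n → ℝ) :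
    (Fin n → ℝ) × Finset (Fin n) :=
  (st.1 + γ • (U t st.1 st.2).mulVec ρ,
    univ.filter fun i => |(st.1 + γ • (U t st.1 st.2).mulVec ρ) i| < 1 - δ)

theorem walk_succ (U : Guide n) (χ₀ : Fin n → ℝ) (γ δ : ℝ) (r : ℕ → Fin n → ℝ) (t : ℕ) :
    walk U χ₀ γ δ r (t + 1) = step U γ δ (t + 1) (walk U χ₀ γ δ r t) (r (t + 1)) := rfl

theorem walk_congr (U : Guide n) (χ₀ : Fin n → ℝ) (γ δ : ℝ) {r r' : ℕ → Fin n → ℝ} {T : ℕ}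
    (h : ∀ t < T, r (t + 1) = r' (t + 1)) : walk U χ₀ γ δ r T = walk U χ₀ γ δ r' T := by
  induction T with
  | zero => rfl
  | succ T ih =>
    rw [walk_succ, walk_succ, ih fun t ht => h t (by omega), h T (by omega)]

/-- The signs carried by the coins of an attempt. -/
def signs {T : ℕ} (x : Fin T → Fin n → Bool) (t : ℕ) (i : Fin n) : ℝ :=
  if h : t - 1 < T then coinSign (x ⟨t - 1, h⟩ i) else 0

theorem signs_snoc_of_lt {T t : ℕ} (x : Fin T → Fin n → Bool) (b : Fin n → Bool) (ht : t < T) :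
    signs (Fin.snoc x b : Fin (T + 1) → Fin n → Bool) (t + 1) = signs x (t + 1) := by
  funext i
  simp only [signs, Nat.add_sub_cancel, ht, dif_pos, ht.trans (Nat.lt_succ_self T)]
  congr 2
  exact congrFun (Fin.snoc_castSucc (α := fun _ => Fin n → Bool) b x ⟨t, ht⟩) i

theorem signs_snoc_last {T : ℕ} (x : Fin T → Fin n → Bool) (b : Fin n → Bool) :
    signs (Fin.snoc x b : Fin (T + 1) → Fin n → Bool) (T + 1) = fun i => coinSign (b i) := by
  funext i
  simp only [signs, Nat.add_sub_cancel, Nat.lt_succ_self, dif_pos]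
  congr 2
  exact congrFun (Fin.snoc_last (α := fun _ => Fin n → Bool) b x) i

theorem walk_snoc (U : Guide n) (χ₀ : Fin n → ℝ) (γ δ : ℝ) {T : ℕ} (x : Fin T → Fin n → Bool)
    (b : Fin n → Bool) :
    walk U χ₀ γ δ (signs (Fin.snoc x b : Fin (T + 1) → Fin n → Bool)) (T + 1) =
      step U γ δ (T + 1) (walk U χ₀ γ δ (signs x) T) fun i => coinSign (b i) := by
  rw [walk_succ, signs_snoc_last, walk_congr U χ₀ γ δ fun t ht => signs_snoc_of_lt x b ht]

/-- This is conditioning on all steps but the last. -/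
theorem avg_snoc {β : Type*} [Fintype β] {T : ℕ} (f : (Fin (T + 1) → β) → ℝ) :
    avg f = avg fun x : Fin T → β => avg fun b : β => f (Fin.snoc x b) := by
  rw [← avg_equiv (Fin.snocEquiv fun _ : Fin (T + 1) => β) f]
  exact avg_prod _

theorem coinSign_sq (b : Bool) : coinSign b ^ 2 = 1 := by
  cases b <;> simp [coinSign]

section Invariant

variable {U : Guide n} {χ₀ : Fin n → ℝ} {γ δ : ℝ} {Inv : (Fin n → ℝ) × Finset (Fin n) → Prop}

theorem walk_invariant (h₀ : Inv (χ₀, univ))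
    (hinv : ∀ t st (b : Fin n → Bool), Inv st → Inv (step U γ δ t st fun i => coinSign (b i)))
    {T : ℕ} (x : Fin T → Fin n → Bool) : Inv (walk U χ₀ γ δ (signs x) T) := by
  induction T with
  | zero => exact h₀
  | succ T ih =>
    obtain ⟨x, b, rfl⟩ : ∃ (y : Fin T → Fin n → Bool) (b : Fin n → Bool), x = Fin.snoc y b :=
      ⟨Fin.init x, x (Fin.last T), (Fin.snoc_init_self x).symm⟩
    rw [walk_snoc]
    exact hinv _ _ _ (ih x)

/-- A function that decreases on average by a factor `c` in every step does so by a factor `c ^ T`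
in `T` steps. -/
theorem avg_walk_le (h₀ : Inv (χ₀, univ))
    (hinv : ∀ t st (b : Fin n → Bool), Inv st → Inv (step U γ δ t st fun i => coinSign (b i)))
    (F : (Fin n → ℝ) × Finset (Fin n) → ℝ) {c : ℝ} (hc : 0 ≤ c)
    (hstep : ∀ t st, Inv st →
      avg (fun b : Fin n → Bool => F (step U γ δ t st fun i => coinSign (b i))) ≤ c * F st)
    (T : ℕ) :
    avg (fun x : Fin T → Fin n → Bool => F (walk U χ₀ γ δ (signs x) T)) ≤ c ^ T * F (χ₀, univ) := by
  induction T with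
  | zero => simp [avg, walk]
  | succ T ih =>
    rw [avg_snoc]
    calc _ ≤ avg (fun x : Fin T → Fin n → Bool => c * F (walk U χ₀ γ δ (signs x) T)) := by
          refine avg_mono fun x => ?_
          simp only [walk_snoc]
          exact hstep _ _ (walk_invariant h₀ hinv x)
      _ ≤ c * (c ^ T * F (χ₀, univ)) := by
          rw [avg_mul]
          exact mul_le_mul_of_nonneg_left ih hc
      _ = _ := by ring

end Invariant

/-! ### Rademacher sums -/

/-- The average factors into a product of cosh aᵢ, and cosh a ≤ exp(a²/2). -/
theorem avg_exp_sum_le (a : Fin n → ℝ) :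
    avg (fun b : Fin n → Bool => Real.exp (∑ i, a i * coinSign (b i))) ≤
      Real.exp ((∑ i, a i ^ 2) / 2) := by
  have h : avg (fun b : Fin n → Bool => Real.exp (∑ i, a i * coinSign (b i))) =
      ∏ i, Real.cosh (a i) := by
    have e := Finset.prod_univ_sum (fun _ : Fin n => (univ : Finset Bool))
      (fun i b => Real.exp (a i * coinSign b))
    rw [Fintype.piFinset_univ] at e
    simp only [avg, Real.exp_sum]
    rw [← e]
    simp only [Fintype.sum_bool, Real.cosh_eq, coinSign]
    simp [prod_div_distrib]
  rw [h, sum_div, Real.exp_sum]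
  exact prod_le_prod (fun i _ => (Real.cosh_pos _).le) fun i _ => Real.cosh_le_exp_half_sq _

/-- As the real part of a character, the cosine averages to a product; the sines cancel by the
symmetry of each sign. -/
theorem avg_cos_sum (y : ℝ) (a : Fin n → ℝ) :
    avg (fun b : Fin n → Bool => Real.cos (y + ∑ i, a i * coinSign (b i))) =
      Real.cos y * ∏ i, Real.cos (a i) := by
  have e := Finset.prod_univ_sum (fun _ : Fin n => (univ : Finset Bool))
    (fun i b => Complex.exp ((a i * coinSign b : ℝ) * Complex.I))
  rw [Fintype.piFinset_univ] at e
  have h1 : ∀ b : Fin n → Bool, Real.cos (y + ∑ i, a i * coinSign (b i)) =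
      (Complex.exp (y * Complex.I) *
        ∏ i, Complex.exp ((a i * coinSign (b i) : ℝ) * Complex.I)).re := by
    intro b
    rw [← Complex.exp_sum, ← Complex.exp_add, ← sum_mul, ← add_mul, ← Complex.ofReal_sum,
      ← Complex.ofReal_add, Complex.exp_ofReal_mul_I_re]
  have h2 : ∀ i, ∑ b : Bool, Complex.exp ((a i * coinSign b : ℝ) * Complex.I) =
      ((2 * Real.cos (a i) : ℝ) : ℂ) := by
    intro i
    simp only [Fintype.sum_bool, coinSign, Complex.ofReal_mul, Complex.ofReal_cos]
    simp [Complex.two_cos]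
  simp only [avg, h1]
  rw [← Complex.re_sum, ← mul_sum, ← e]
  simp only [h2]
  rw [← Complex.ofReal_prod, Complex.re_mul_ofReal, Complex.exp_ofReal_mul_I_re,
    prod_mul_distrib]
  simp
  field_simp

/-- The gap between 1/2 and 9/20 pays for the fourth-order error: (5/96)x⁴ ≤ x²/20 when x² ≤ 96/100.
-/
theorem cos_le_exp {x : ℝ} (hx : |x| ≤ 97 / 100) :
    Real.cos x ≤ Real.exp (-(9 / 20) * x ^ 2) := by
  have h := (abs_le.1 (Real.cos_bound (hx.trans (by norm_num)))).2
  have h2 : x ^ 2 ≤ 96 / 100 := by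
    rw [← sq_abs]; nlinarith [abs_nonneg x]
  have h4 : |x| ^ 4 = x ^ 2 * x ^ 2 := by
    rw [show |x| ^ 4 = (|x| ^ 2) ^ 2 by ring, sq_abs]; ring
  rw [h4] at h
  have := Real.add_one_le_exp (-(9 / 20) * x ^ 2)
  nlinarith [sq_nonneg x]

theorem avg_cos_sum_le {y : ℝ} (hy : 0 ≤ Real.cos y) {a : Fin n → ℝ}
    (ha : ∀ i, |a i| ≤ 97 / 100) :
    avg (fun b : Fin n → Bool => Real.cos (y + ∑ i, a i * coinSign (b i))) ≤
      Real.exp (-(9 / 20) * ∑ i, a i ^ 2) * Real.cos y := by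
  rw [avg_cos_sum, mul_comm]
  refine mul_le_mul_of_nonneg_right ?_ hy
  rw [mul_sum, Real.exp_sum]
  refine prod_le_prod (fun i _ => Real.cos_nonneg_of_mem_Icc ?_) fun i _ => cos_le_exp (ha i)
  have := abs_le.1 (ha i)
  constructor <;> linarith [Real.pi_gt_three]

/-! ### Solutions of the vector Komlós program -/

theorem IsKomlosSolution.sum_row_sq {v : Fin n → EuclideanSpace ℝ (Fin m)} {A : Finset (Fin n)}
    {U : Matrix (Fin n) (Fin n) ℝ} (h : IsKomlosSolution v A (U * U.transpose)) (i : Fin n) :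
    ∑ j, U i j ^ 2 = if i ∈ A then 1 else 0 := by
  have e : (U * U.transpose) i i = ∑ j, U i j ^ 2 := by
    simp [Matrix.mul_apply, sq]
  split_ifs with hi
  · rw [← e, h.2.1 i hi]
  · rw [← e, h.2.2.1 i hi]

/-- The left side is ‖(VU)ᵀθ‖². In this form VΣVᵀ ⪯ I controls the variance of a step in direction
θ. -/
theorem IsKomlosSolution.sum_inner_sq_le {v : Fin n → EuclideanSpace ℝ (Fin m)}
    {A : Finset (Fin n)} {U : Matrix (Fin n) (Fin n) ℝ}
    (h : IsKomlosSolution v A (U * U.transpose)) (θ : EuclideanSpace ℝ (Fin m)) :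
    ∑ j, (∑ i, U i j * inner ℝ (v i) θ) ^ 2 ≤ ‖θ‖ ^ 2 := by
  have key := h.2.2.2.dotProduct_mulVec_nonneg θ
  set V := colMatrix v
  have e1 : star (θ : Fin m → ℝ) ⬝ᵥ (1 - V * (U * U.transpose) * V.transpose).mulVec θ =
      (θ : Fin m → ℝ) ⬝ᵥ θ -
        ((V * U).transpose.mulVec θ) ⬝ᵥ ((V * U).transpose.mulVec θ) := by
    rw [Matrix.sub_mulVec, Matrix.one_mulVec, dotProduct_sub, star_trivial]
    congr 1
    have : V * (U * U.transpose) * V.transpose = (V * U) * (V * U).transpose := by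
      simp [Matrix.transpose_mul, Matrix.mul_assoc]
    rw [this, ← Matrix.mulVec_mulVec, Matrix.dotProduct_mulVec, ← Matrix.mulVec_transpose]
  rw [e1, sub_nonneg] at key
  have e3 : (θ : Fin m → ℝ) ⬝ᵥ θ = ‖θ‖ ^ 2 := by
    rw [EuclideanSpace.norm_sq_eq]
    simp [dotProduct, sq]
  rw [e3] at key
  refine le_trans (le_of_eq ?_) key
  rw [dotProduct]
  refine sum_congr rfl fun j _ => ?_
  rw [sq]
  have : (V * U).transpose.mulVec θ j = ∑ i, U i j * inner ℝ (v i) θ := by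
    rw [Matrix.transpose_mul, ← Matrix.mulVec_mulVec]
    rw [Matrix.mulVec, dotProduct]
    refine sum_congr rfl fun i _ => ?_
    simp [V, colMatrix, Matrix.mulVec, dotProduct, PiLp.inner_apply, mul_comm]
  rw [this]

/-- By Cauchy-Schwarz, a row of norm at most 1 meets a sign vector of norm √n. -/
theorem IsKomlosSolution.abs_mulVec_le {v : Fin n → EuclideanSpace ℝ (Fin m)}
    {A : Finset (Fin n)} {U : Matrix (Fin n) (Fin n) ℝ}
    (h : IsKomlosSolution v A (U * U.transpose)) (b : Fin n → Bool) (i : Fin n) :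
    |U.mulVec (fun i => coinSign (b i)) i| ≤ Real.sqrt n := by
  refine Real.abs_le_sqrt ?_
  have h1 := sum_mul_sq_le_sq_mul_sq univ (fun j => U i j) (fun j => coinSign (b j))
  refine h1.trans ?_
  rw [h.sum_row_sq]
  simp only [coinSign_sq]
  split_ifs <;> simp

/-- A zero diagonal entry of UUᵀ annihilates the whole row of U. Thus frozen coordinates stay where
they are. -/
theorem IsKomlosSolution.mulVec_eq_zero {v : Fin n → EuclideanSpace ℝ (Fin m)}
    {A : Finset (Fin n)} {U : Matrix (Fin n) (Fin n) ℝ}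
    (h : IsKomlosSolution v A (U * U.transpose)) (ρ : Fin n → ℝ) {i : Fin n} (hi : i ∉ A) :
    U.mulVec ρ i = 0 := by
  have h1 := h.sum_row_sq i
  rw [if_neg hi, sum_eq_zero_iff_of_nonneg fun j _ => sq_nonneg _] at h1
  rw [Matrix.mulVec, dotProduct]
  exact sum_eq_zero fun j hj => by rw [pow_eq_zero_iff two_ne_zero |>.1 (h1 j hj), zero_mul]

/-! ### One attempt -/

variable {v : Fin n → EuclideanSpace ℝ (Fin m)} {U : Guide n} {χ₀ : Fin n → ℝ} {γ δ : ℝ}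

/-- Frozen coordinates are close to `±1`, and no coordinate is far outside of `[-1, 1]`. -/
def Tame (γ δ : ℝ) (st : (Fin n → ℝ) × Finset (Fin n)) : Prop :=
  ∀ i, (i ∈ st.2 → |st.1 i| ≤ 1) ∧ (i ∉ st.2 → 1 - δ ≤ |st.1 i|) ∧
    |st.1 i| ≤ 1 + γ * Real.sqrt n

/-- Every coordinate starts active, even beyond 1 - δ. This is why `Tame` bounds active coordinates
only by 1. -/
theorem tame_start (hγ : 0 ≤ γ) (hχ : ∀ i, χ₀ i ∈ Set.Icc (-1) 1) :
    Tame γ δ (χ₀, (univ : Finset (Fin n))) := fun i => by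
  have h : |χ₀ i| ≤ 1 := abs_le.2 (hχ i)
  exact ⟨fun _ => h, fun h => absurd (mem_univ i) h,
    h.trans (le_add_of_nonneg_right (mul_nonneg hγ (Real.sqrt_nonneg _)))⟩

/-- A coordinate moves only while it is in [-1, 1], by at most γ√n per step, so it overshoots at
most once and is then frozen for good. -/
theorem tame_step (hU : U.Solves v) (hγ : 0 ≤ γ) (hδ : 0 ≤ δ) (t : ℕ)
    (st : (Fin n → ℝ) × Finset (Fin n)) (b : Fin n → Bool) (h : Tame γ δ st) :
    Tame γ δ (step U γ δ t st fun i => coinSign (b i)) := by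
  intro i
  have hs := hU t st.1 st.2
  refine ⟨fun hi => ?_, fun hi => ?_, ?_⟩
  · have := (mem_filter.1 hi).2
    exact (this.trans_le (by linarith)).le
  · simp only [step, mem_filter, mem_univ, true_and, not_lt] at hi
    exact hi
  · by_cases hi : i ∈ st.2
    · calc |st.1 i + γ * (U t st.1 st.2).mulVec (fun i => coinSign (b i)) i| ≤
          |st.1 i| + |γ * (U t st.1 st.2).mulVec (fun i => coinSign (b i)) i| := abs_add_le _ _
        _ ≤ 1 + γ * Real.sqrt n := by
          rw [abs_mul, abs_of_nonneg hγ]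
          exact add_le_add ((h i).1 hi) (mul_le_mul_of_nonneg_left (hs.abs_mulVec_le b i) hγ)
    · have e : (step U γ δ t st fun i => coinSign (b i)).1 i = st.1 i := by
        simp [step, hs.mulVec_eq_zero _ hi]
      rw [e]
      exact (h i).2.2

theorem tame_walk (hU : U.Solves v) (hγ : 0 ≤ γ) (hδ : 0 ≤ δ) (hχ : ∀ i, χ₀ i ∈ Set.Icc (-1) 1)
    {T : ℕ} (x : Fin T → Fin n → Bool) : Tame γ δ (walk U χ₀ γ δ (signs x) T) :=
  walk_invariant (Inv := Tame γ δ) (tame_start hγ hχ) (tame_step hU hγ hδ) x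

/-- The moment generating function of the walk. -/
theorem avg_exp_walk_le (hU : U.Solves v) {θ : EuclideanSpace ℝ (Fin m)} (hθ : ‖θ‖ = 1) (l : ℝ)
    (T : ℕ) :
    avg (fun x : Fin T → Fin n → Bool =>
      Real.exp (l * ∑ i, ((walk U χ₀ γ δ (signs x) T).1 i - χ₀ i) * inner ℝ (v i) θ)) ≤
      Real.exp (l ^ 2 * (γ ^ 2 * T) / 2) := by
  have h := avg_walk_le (U := U) (χ₀ := χ₀) (γ := γ) (δ := δ) (Inv := fun _ => True) trivial
    (fun _ _ _ _ => trivial)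
    (fun st => Real.exp (l * ∑ i, (st.1 i - χ₀ i) * inner ℝ (v i) θ))
    (Real.exp_pos (l ^ 2 * γ ^ 2 / 2)).le (fun t st _ => by
      -- The entries of lγ(VU)ᵀθ: the increment of the exponent is the Rademacher sum with these
      -- coefficients.
      set a : Fin n → ℝ := fun j => l * γ * ∑ i, U t st.1 st.2 i j * inner ℝ (v i) θ with ha
      have h1 : ∀ b : Fin n → Bool,
          l * ∑ i, ((step U γ δ t st fun i => coinSign (b i)).1 i - χ₀ i) * inner ℝ (v i) θ =
          l * ∑ i, (st.1 i - χ₀ i) * inner ℝ (v i) θ + ∑ j, a j * coinSign (b j) := by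
        intro b
        have h2 : ∑ j, a j * coinSign (b j) =
            l * ∑ i, γ * (U t st.1 st.2).mulVec (fun i => coinSign (b i)) i *
              inner ℝ (v i) θ := by
          simp only [ha, Matrix.mulVec, dotProduct, mul_sum, sum_mul]
          rw [sum_comm]
          exact sum_congr rfl fun i _ => sum_congr rfl fun j _ => by ring
        rw [h2, ← mul_add, ← sum_add_distrib]
        congr 1
        refine sum_congr rfl fun i _ => ?_
        simp only [step, Pi.add_apply, Pi.smul_apply, smul_eq_mul]
        ring
      simp only [h1, Real.exp_add]
      rw [avg_mul, mul_comm]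
      refine mul_le_mul_of_nonneg_right ((avg_exp_sum_le a).trans ?_) (Real.exp_pos _).le
      rw [Real.exp_le_exp]
      have h3 := (hU t st.1 st.2).sum_inner_sq_le θ
      rw [hθ, one_pow] at h3
      have h4 : ∑ j, a j ^ 2 =
          l ^ 2 * γ ^ 2 * ∑ j, (∑ i, U t st.1 st.2 i j * inner ℝ (v i) θ) ^ 2 := by
        rw [mul_sum]
        exact sum_congr rfl fun j _ => by simp only [ha]; ring
      rw [h4]
      have := mul_le_mul_of_nonneg_left h3 (by positivity : 0 ≤ l ^ 2 * γ ^ 2)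
      linarith) T
  refine h.trans (le_of_eq ?_)
  rw [← Real.exp_nat_mul]
  simp only [sub_self, zero_mul, sum_const_zero, mul_zero, Real.exp_zero, mul_one]
  congr 1
  ring

/-- Averaging over a step multiplies cos(9x/10) by ∏ⱼ cos(9γUᵢⱼ/10) ≤ exp(-(9/20)(81/100)γ²), as
active rows have norm 1. On [-1, 1] the cosine is at least 0.56. It is nonnegative up to the largest
overshoot because (9/10)(1 + 7/10) < π/2, so setting it to 0 on freezing can only decrease the
potential. -/
theorem avg_alive_le (hU : U.Solves v) (hγ : 0 < γ) (hδ : 0 ≤ δ)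
    (hγn : γ * Real.sqrt n ≤ 7 / 10) (hχ : ∀ i, χ₀ i ∈ Set.Icc (-1) 1) (T : ℕ) (i : Fin n) :
    avg (fun x : Fin T → Fin n → Bool => if i ∈ (walk U χ₀ γ δ (signs x) T).2 then 1 else 0) ≤
      Real.exp (-(729 / 2000) * (γ ^ 2 * T)) / (56 / 100) := by
  have hcos : (56 / 100 : ℝ) ≤ Real.cos (9 / 10) := by
    have := (abs_le.1 (Real.cos_bound (x := 9 / 10) (by rw [abs_of_pos] <;> norm_num))).1
    rw [abs_of_pos (by norm_num)] at this
    norm_num at this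
    linarith
  have hcos_of : ∀ z : ℝ, |z| ≤ 17 / 10 → 0 ≤ Real.cos (9 / 10 * z) := fun z hz => by
    have hp := Real.pi_gt_d2
    have := abs_le.1 hz
    refine Real.cos_nonneg_of_mem_Icc ⟨?_, ?_⟩ <;> linarith
  set F : (Fin n → ℝ) × Finset (Fin n) → ℝ :=
    fun st => if i ∈ st.2 then Real.cos (9 / 10 * st.1 i) else 0 with hF
  have hFle : ∀ st, Tame γ δ st → (if i ∈ st.2 then (1 : ℝ) else 0) ≤ F st / (56 / 100) := by
    intro st hst
    simp only [hF]
    split_ifs with hi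
    · rw [le_div_iff₀ (by norm_num), one_mul]
      refine hcos.trans ?_
      rw [← Real.cos_abs (9 / 10 * st.1 i), abs_mul, abs_of_pos (by norm_num : (0 : ℝ) < 9 / 10)]
      refine Real.cos_le_cos_of_nonneg_of_le_pi (by positivity)
        (by linarith [Real.pi_gt_three]) ?_
      have := (hst i).1 hi
      linarith
    · simp
  have h := avg_walk_le (Inv := Tame γ δ) (tame_start hγ.le hχ) (tame_step hU hγ.le hδ) F
    (Real.exp_pos (-(729 / 2000) * γ ^ 2)).le (fun t st hst => by
      by_cases hi : i ∈ st.2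
      · set a : Fin n → ℝ := fun j => 9 / 10 * γ * U t st.1 st.2 i j with ha
        have hrow := (hU t st.1 st.2).sum_row_sq i
        rw [if_pos hi] at hrow
        have hle : ∀ j, |U t st.1 st.2 i j| ≤ 1 := fun j => by
          rw [← sq_le_one_iff_abs_le_one, ← hrow]
          exact single_le_sum (f := fun j => U t st.1 st.2 i j ^ 2)
            (fun k _ => sq_nonneg _) (mem_univ j)
        have hn : (1 : ℝ) ≤ Real.sqrt n := by
          rw [Real.one_le_sqrt]
          exact_mod_cast (Nat.succ_le_of_lt i.pos)
        have hγ1 : γ ≤ 7 / 10 := by nlinarith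
        have hsum : ∑ j, a j ^ 2 = 81 / 100 * γ ^ 2 := by
          have : ∀ j, a j ^ 2 = 81 / 100 * γ ^ 2 * U t st.1 st.2 i j ^ 2 := fun j => by
            simp only [ha]; ring
          simp only [this]
          rw [← mul_sum, hrow, mul_one]
        have hFi : F st = Real.cos (9 / 10 * st.1 i) := if_pos hi
        have h1 := avg_cos_sum_le (y := 9 / 10 * st.1 i) (a := a)
          (hcos_of _ (((hst i).1 hi).trans (by norm_num))) (fun j => by
            simp only [ha]
            rw [abs_mul, abs_of_pos (by positivity)]
            have := hle j
            nlinarith [abs_nonneg (U t st.1 st.2 i j)])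
        rw [hFi]
        have h2 : -(729 / 2000) * γ ^ 2 = -(9 / 20) * ∑ j, a j ^ 2 := by rw [hsum]; ring
        rw [h2]
        refine le_trans (avg_mono fun b => ?_) h1
        have h3 : 9 / 10 * st.1 i + ∑ j, a j * coinSign (b j) =
            9 / 10 * (step U γ δ t st fun i => coinSign (b i)).1 i := by
          simp only [step, Pi.add_apply, Pi.smul_apply, smul_eq_mul, Matrix.mulVec, dotProduct,
            ha, mul_add, mul_sum]
          congr 1
          exact sum_congr rfl fun j _ => by ring
        rw [h3]
        simp only [hF]
        split_ifs
        · exact le_rfl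
        · exact hcos_of _ (((tame_step hU hγ.le hδ t st b hst i).2.2).trans (by linarith))
      -- A frozen coordinate does not move, so it passes the freezing test again and its potential
      -- remains 0.
      · have hz : ∀ b : Fin n → Bool, F (step U γ δ t st fun i => coinSign (b i)) = 0 := by
          intro b
          have e : (step U γ δ t st fun i => coinSign (b i)).1 i = st.1 i := by
            simp [step, (hU t st.1 st.2).mulVec_eq_zero _ hi]
          have h4 : i ∉ (step U γ δ t st fun i => coinSign (b i)).2 := by
            intro h5
            have h6 := (mem_filter.1 h5).2
            have h7 : |(step U γ δ t st fun i => coinSign (b i)).1 i| < 1 - δ := h6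
            rw [e] at h7
            exact absurd ((hst i).2.1 hi) (not_le.2 h7)
          exact if_neg h4
        simp only [hz]
        have hF0 : F st = 0 := if_neg hi
        rw [hF0, mul_zero]
        simp [avg]) T
  have hF1 : F (χ₀, univ) ≤ 1 := by
    simp only [hF, mem_univ, if_true]
    exact Real.cos_le_one _
  calc _ ≤ avg (fun x : Fin T → Fin n → Bool =>
        (56 / 100)⁻¹ * F (walk U χ₀ γ δ (signs x) T)) := by
        refine avg_mono fun x => ?_
        rw [mul_comm, ← div_eq_mul_inv]
        exact hFle _ (tame_walk hU hγ.le hδ hχ x)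
    _ ≤ (56 / 100)⁻¹ * (Real.exp (-(729 / 2000) * γ ^ 2) ^ T * 1) := by
        rw [avg_mul]
        refine mul_le_mul_of_nonneg_left (h.trans ?_) (by norm_num)
        exact mul_le_mul_of_nonneg_left hF1 (by positivity)
    _ = _ := by
        rw [← Real.exp_nat_mul, mul_one, mul_comm, ← div_eq_mul_inv]
        congr 2
        ring

end KomlosWalk
end

/-! ### From the walk to its rounded output: success, deviation and restarts. -/

noncomputable section

namespace KomlosWalk

open Finset FairCoins

variable {n m T : ℕ}

/-- The end point of an attempt as a function of its coins. -/
def endOf (U : Guide n) (χ₀ : Fin n → ℝ) (γ δ : ℝ) (x : Fin T × Fin n → Bool) : Fin n → ℝ :=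
  (walk U χ₀ γ δ (signs (Function.curry x)) T).1

/-- The coins of successful attempts. -/
def good (U : Guide n) (χ₀ : Fin n → ℝ) (γ δ : ℝ) (T : ℕ) : Set (Fin T × Fin n → Bool) :=
  {x | ∀ i, 1 - δ ≤ |endOf U χ₀ γ δ x i|}

/-- The signs of the first successful attempt. -/
def signOut (U : Guide n) (χ₀ : Fin n → ℝ) (γ δ : ℝ) (ω : ℕ × (Fin T × Fin n) → Bool) :
    Fin n → ℝ :=
  fun i => if 0 ≤ endOf U χ₀ γ δ (attempt (first (good U χ₀ γ δ T) ω) ω) i then 1 else -1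

/-- The coins that the walk looks at, as coins of the walk. -/
def usedCoins (T n : ℕ) (x : ℕ × (Fin T × Fin n)) : ℕ × ℕ × Fin n := (x.1, x.2.1 + 1, x.2.2)

theorem usedCoins_injective : Function.Injective (usedCoins T n) := by
  rintro ⟨k, t, i⟩ ⟨k', t', i'⟩ h
  simp only [usedCoins, Prod.mk.injEq, Nat.add_right_cancel_iff] at h
  obtain ⟨rfl, ht, rfl⟩ := h
  rw [Fin.ext ht]

variable {v : Fin n → EuclideanSpace ℝ (Fin m)} {U : Guide n} {χ₀ : Fin n → ℝ} {γ δ : ℝ}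

/-- Steps of the walk are numbered from 1, blocks of coins from 0; the shift in `usedCoins` undoes
the one in `signs`. -/
theorem endPoint_eq (ω : Coins n) (k : ℕ) :
    endPoint U χ₀ γ δ T ω k = endOf U χ₀ γ δ (attempt k (ω ∘ usedCoins T n)) := by
  rw [endPoint, endOf]
  congr 1
  refine walk_congr U χ₀ γ δ fun t ht => ?_
  funext i
  simp [signs, ht, Function.curry, attempt, usedCoins]

theorem attempts_eq (ω : Coins n) :
    attempts U χ₀ γ δ T ω = count (good U χ₀ γ δ T) (ω ∘ usedCoins T n) := by
  simp only [attempts, count, Succeeds, good, endPoint_eq]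
  rfl

theorem output_eq (ω : Coins n) :
    output U χ₀ γ δ T ω = signOut U χ₀ γ δ (ω ∘ usedCoins T n) := by
  have : {k | Succeeds U χ₀ γ δ T ω k} =
      {k | attempt k (ω ∘ usedCoins T n) ∈ good U χ₀ γ δ T} := by
    simp only [Succeeds, good, endPoint_eq]
    rfl
  funext i
  simp only [output, signOut, first, this, endPoint_eq]
  rfl

theorem avg_curry (f : (Fin T → Fin n → Bool) → ℝ) :
    avg (fun x : Fin T × Fin n → Bool => f (Function.curry x)) = avg f :=
  avg_equiv (Equiv.curry (Fin T) (Fin n) Bool) f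

/-- Failure leaves some coordinate active, so a union bound gives at most (1/2)/(56/100) ≤ 9/10. -/
theorem measure_not_good_le (hU : U.Solves v) (hγ : 0 < γ) (hδ : 0 ≤ δ)
    (hγn : γ * Real.sqrt n ≤ 7 / 10) (hχ : ∀ i, χ₀ i ∈ Set.Icc (-1) 1)
    (hT : n * Real.exp (-(729 / 2000) * (γ ^ 2 * T)) ≤ 1 / 2) :
    fairCoins (Fin T × Fin n) (good U χ₀ γ δ T)ᶜ ≤ 9 / 10 := by
  have h1 : (fairCoins (Fin T × Fin n)).real (good U χ₀ γ δ T)ᶜ ≤ 9 / 10 := by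
    rw [measureReal_eq_avg]
    calc _ ≤ avg (fun x : Fin T × Fin n → Bool => ∑ i : Fin n,
          if i ∈ (walk U χ₀ γ δ (signs (Function.curry x)) T).2 then (1 : ℝ) else 0) := by
          refine avg_mono fun x => ?_
          have hnn : ∀ i ∈ (univ : Finset (Fin n)), (0 : ℝ) ≤
              if i ∈ (walk U χ₀ γ δ (signs (Function.curry x)) T).2 then (1 : ℝ) else 0 :=
            fun i _ => by split_ifs <;> norm_num
          split_ifs with hx
          · simp only [good, Set.mem_compl_iff, Set.mem_ofPred_eq, not_forall] at hx
            obtain ⟨i, hi⟩ := hx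
            have hmem : i ∈ (walk U χ₀ γ δ (signs (Function.curry x)) T).2 := by
              by_contra hn
              exact hi ((tame_walk hU hγ.le hδ hχ (Function.curry x) i).2.1 hn)
            refine le_trans (le_of_eq ?_) (single_le_sum hnn (mem_univ i))
            rw [if_pos hmem]
          · exact sum_nonneg hnn
      _ ≤ ∑ _i : Fin n, Real.exp (-(729 / 2000) * (γ ^ 2 * T)) / (56 / 100) := by
          rw [avg_sum]
          refine sum_le_sum fun i _ => ?_
          rw [avg_curry fun x => if i ∈ (walk U χ₀ γ δ (signs x) T).2 then (1 : ℝ) else 0]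
          exact avg_alive_le hU hγ hδ hγn hχ T i
      _ ≤ 9 / 10 := by
          rw [sum_const, card_univ, Fintype.card_fin, nsmul_eq_mul, ← mul_div_assoc,
            div_le_iff₀ (by norm_num)]
          linarith
  rw [Measure.real] at h1
  rw [← ENNReal.ofReal_toReal (measure_ne_top (fairCoins (Fin T × Fin n)) (good U χ₀ γ δ T)ᶜ)]
  refine (ENNReal.ofReal_le_ofReal h1).trans (le_of_eq ?_)
  rw [ENNReal.ofReal_div_of_pos (by norm_num)]
  norm_num

/-- Needed for n = 2, where γ√n = 1 is too large for the cosine potential, but δ ≥ 1 makes the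
success test void. -/
theorem measure_not_good_le_of_one_le (hδ : 1 ≤ δ) :
    fairCoins (Fin T × Fin n) (good U χ₀ γ δ T)ᶜ ≤ 9 / 10 := by
  have : (good U χ₀ γ δ T)ᶜ = ∅ := by
    rw [Set.compl_empty_iff, Set.eq_univ_iff_forall]
    intro x i
    exact (by linarith : 1 - δ ≤ 0).trans (abs_nonneg _)
  rw [this]
  simp

/-- The deviation of the end point of one attempt. -/
theorem measureReal_deviation_le (hU : U.Solves v) {θ : EuclideanSpace ℝ (Fin m)} (hθ : ‖θ‖ = 1)
    (hs : 0 < γ ^ 2 * T) (a : ℝ) (ha : 0 ≤ a) :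
    (fairCoins (Fin T × Fin n)).real
      {x | a ≤ |∑ i, (endOf U χ₀ γ δ x i - χ₀ i) * inner ℝ (v i) θ|} ≤
      2 * Real.exp (-(a ^ 2 / (2 * (γ ^ 2 * T)))) := by
  set s := γ ^ 2 * (T : ℝ) with hs'
  set X : (Fin T → Fin n → Bool) → ℝ := fun x =>
    ∑ i, ((walk U χ₀ γ δ (signs x) T).1 i - χ₀ i) * inner ℝ (v i) θ with hX
  rw [measureReal_eq_avg]
  have hl : 0 ≤ a / s := div_nonneg ha hs.le
  -- Chernoff's bound with the optimal l = ±a/s.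
  have hexp : ∀ l : ℝ, l ^ 2 = (a / s) ^ 2 →
      Real.exp (-(a / s * a)) * avg (fun x : Fin T → Fin n → Bool => Real.exp (l * X x)) ≤
        Real.exp (-(a ^ 2 / (2 * s))) := by
    intro l hl2
    have h1 := avg_exp_walk_le (χ₀ := χ₀) (γ := γ) (δ := δ) hU hθ l T
    refine (mul_le_mul_of_nonneg_left h1 (Real.exp_pos _).le).trans (le_of_eq ?_)
    rw [← Real.exp_add, hl2]
    congr 1
    field_simp
    ring
  calc _ ≤ avg (fun x : Fin T × Fin n → Bool => ∑ e : Bool,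
        Real.exp (-(a / s * a)) * Real.exp ((if e then a / s else -(a / s)) *
          X (Function.curry x))) := by
        refine avg_mono fun x => ?_
        rw [Fintype.sum_bool]
        simp only [if_true, Bool.false_eq_true, if_false]
        split_ifs with hx
        · rw [Set.mem_ofPred_eq] at hx
          rcases le_abs.1 hx with h | h
          · have h1 : 1 ≤ Real.exp (-(a / s * a)) * Real.exp (a / s * X (Function.curry x)) := by
              rw [← Real.exp_add, Real.one_le_exp_iff]
              have := mul_le_mul_of_nonneg_left h hl
              have e : X (Function.curry x) =
                ∑ i, (endOf U χ₀ γ δ x i - χ₀ i) * inner ℝ (v i) θ := rfl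
              rw [e]; linarith
            have h2 : 0 ≤ Real.exp (-(a / s * a)) * Real.exp (-(a / s) * X (Function.curry x)) :=
              by positivity
            linarith
          · have h1 : 1 ≤ Real.exp (-(a / s * a)) * Real.exp (-(a / s) * X (Function.curry x)) := by
              rw [← Real.exp_add, Real.one_le_exp_iff]
              have := mul_le_mul_of_nonneg_left h hl
              have e : X (Function.curry x) =
                ∑ i, (endOf U χ₀ γ δ x i - χ₀ i) * inner ℝ (v i) θ := rfl
              rw [e]; linarith
            have h2 : 0 ≤ Real.exp (-(a / s * a)) * Real.exp (a / s * X (Function.curry x)) := by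
              positivity
            linarith
        · positivity
    _ = ∑ e : Bool, Real.exp (-(a / s * a)) * avg (fun x : Fin T → Fin n → Bool =>
        Real.exp ((if e then a / s else -(a / s)) * X x)) := by
        rw [avg_sum]
        refine sum_congr rfl fun e _ => ?_
        rw [avg_mul, avg_curry fun x => Real.exp ((if e then a / s else -(a / s)) * X x)]
    _ ≤ 2 * Real.exp (-(a ^ 2 / (2 * s))) := by
        rw [Fintype.sum_bool]
        have h1 := hexp (a / s) rfl
        have h2 := hexp (-(a / s)) (neg_sq _)
        simp only [if_true, Bool.false_eq_true, if_false]
        linarith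

/-- Conditioning on success costs a factor 10, rounding costs nδ, and a starting point that misses y
costs ε; all three are absorbed by taking σ a constant factor larger than γ√T. The abstract map Φ
lets the result serve both the walk and the machine. -/
theorem isSubgaussian_of_eq_signOut {Ω : Type*} [MeasurableSpace Ω] {μ : Measure Ω}
    [IsProbabilityMeasure μ] {Y : Ω → Fin n → ℝ} {Φ : Ω → ℕ × (Fin T × Fin n) → Bool}
    (hΦ : MeasurePreserving Φ μ (fairCoins (ℕ × (Fin T × Fin n))))
    (hY : ∀ᵐ ω ∂μ, Y ω = signOut U χ₀ γ δ (Φ ω))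
    (hv : ∀ i, ‖v i‖ ≤ 1) (hU : U.Solves v) (hχ : ∀ i, χ₀ i ∈ Set.Icc (-1) 1)
    (hγ : 0 < γ) (hT : 0 < T) (hγδ : γ * Real.sqrt n ≤ δ)
    (hgood : fairCoins (Fin T × Fin n) (good U χ₀ γ δ T)ᶜ ≤ 9 / 10)
    {y : EuclideanSpace ℝ (Fin m)} {ε : ℝ} (hy : ‖∑ i, χ₀ i • v i - y‖ ≤ ε) {σ : ℝ} (hσ : 0 < σ)
    (h₁ : 49 * (γ ^ 2 * T) ≤ σ ^ 2) (h₂ : 2 * (n * δ + ε) ≤ σ) :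
    IsSubgaussian μ (fun ω => ∑ i, Y ω i • v i - y) σ := by
  have hδ : 0 ≤ δ := (mul_nonneg hγ.le (Real.sqrt_nonneg _)).trans hγδ
  have hs : 0 < γ ^ 2 * T := by positivity
  refine ⟨hσ, fun θ hθ => ⟨hσ, fun t ht => ?_⟩⟩
  -- For t ≤ σ the claimed bound is at least 2·exp(-1/2) ≥ 1.
  rcases le_or_gt t σ with htσ | htσ
  · refine measureReal_le_one.trans ?_
    have h3 : (t / σ) ^ 2 ≤ 1 := by
      rw [div_pow, div_le_one (by positivity)]
      exact pow_le_pow_left₀ ht htσ 2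
    have := Real.add_one_le_exp (-(1 / 2) * (t / σ) ^ 2)
    linarith
  · set D := n * δ + ε with hD
    set a := t - D with ha
    have hDn : 0 ≤ D := add_nonneg (by positivity) ((norm_nonneg _).trans hy)
    have ha2 : t / 2 ≤ a := by linarith
    have ha0 : 0 ≤ a := by linarith
    set G : Set (Fin T × Fin n → Bool) :=
      {x | a ≤ |∑ i, (endOf U χ₀ γ δ x i - χ₀ i) * inner ℝ (v i) θ|} with hG
    have hsub : {ω | t ≤ |inner ℝ (∑ i, Y ω i • v i - y) θ|} ≤ᵐ[μ]
        Φ ⁻¹' {η | attempt (first (good U χ₀ γ δ T) η) η ∈ G} := by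
      have hex := hΦ.quasiMeasurePreserving.ae (ae_exists_attempt hgood)
      filter_upwards [hY, hex] with ω hω hω' (hle : t ≤ |inner ℝ (∑ i, Y ω i • v i - y) θ|)
      have hsucc := attempt_first hω'
      change a ≤ |_|
      set x := attempt (first (good U χ₀ γ δ T) (Φ ω)) (Φ ω) with hx
      have htame := tame_walk hU hγ.le hδ hχ (Function.curry x)
      -- Success and tameness put the absolute value between 1 - δ and 1 + γ√n ≤ 1 + δ.
      have hround : ∀ i, |Y ω i - endOf U χ₀ γ δ x i| ≤ δ := by
        intro i
        have h3 := hsucc i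
        have h4 : |endOf U χ₀ γ δ x i| ≤ 1 + γ * Real.sqrt n := (htame i).2.2
        have h5 : Y ω i = if 0 ≤ endOf U χ₀ γ δ x i then 1 else -1 := by rw [hω]; rfl
        rw [h5]
        split_ifs with h6
        · rw [abs_of_nonneg h6] at h3 h4
          rw [abs_le]; constructor <;> linarith
        · rw [abs_of_neg (not_le.1 h6)] at h3 h4
          rw [abs_le]; constructor <;> linarith
      have hin : ∀ i, |inner ℝ (v i) θ| ≤ 1 := fun i =>
        (abs_real_inner_le_norm _ _).trans (by rw [hθ, mul_one]; exact hv i)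
      have e : inner ℝ (∑ i, Y ω i • v i - y) θ =
          ∑ i, (endOf U χ₀ γ δ x i - χ₀ i) * inner ℝ (v i) θ +
          ∑ i, (Y ω i - endOf U χ₀ γ δ x i) * inner ℝ (v i) θ +
          inner ℝ (∑ i, χ₀ i • v i - y) θ := by
        simp only [inner_sub_left, sum_inner, real_inner_smul_left, sub_mul, sum_sub_distrib]
        ring
      have h7 : |∑ i, (Y ω i - endOf U χ₀ γ δ x i) * inner ℝ (v i) θ| ≤ n * δ := by
        calc _ ≤ ∑ i, |(Y ω i - endOf U χ₀ γ δ x i) * inner ℝ (v i) θ| :=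
              abs_sum_le_sum_abs _ _
          _ ≤ ∑ _i : Fin n, δ := sum_le_sum fun i _ => by
              rw [abs_mul]
              exact (mul_le_mul (hround i) (hin i) (abs_nonneg _) hδ).trans_eq (mul_one _)
          _ = n * δ := by simp
      have h8 : |inner ℝ (∑ i, χ₀ i • v i - y) θ| ≤ ε :=
        (abs_real_inner_le_norm _ _).trans (by rw [hθ, mul_one]; exact hy)
      rw [e] at hle
      have h9 := abs_add_le (∑ i, (endOf U χ₀ γ δ x i - χ₀ i) * inner ℝ (v i) θ +
          ∑ i, (Y ω i - endOf U χ₀ γ δ x i) * inner ℝ (v i) θ) (inner ℝ (∑ i, χ₀ i • v i - y) θ)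
      have h10 := abs_add_le (∑ i, (endOf U χ₀ γ δ x i - χ₀ i) * inner ℝ (v i) θ)
          (∑ i, (Y ω i - endOf U χ₀ γ δ x i) * inner ℝ (v i) θ)
      linarith
    have h3 : μ.real {ω | t ≤ |inner ℝ (∑ i, Y ω i • v i - y) θ|} ≤
        10 * (fairCoins (Fin T × Fin n)).real G := by
      have h4 := (measure_mono_ae hsub).trans_eq
        (hΦ.measure_preimage (measurableSet_first _ G).nullMeasurableSet)
      have h5 := h4.trans (measure_first_le hgood G)
      have h6 := ENNReal.toReal_mono (ENNReal.mul_ne_top (by simp) (measure_ne_top _ _)) h5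
      rw [ENNReal.toReal_mul] at h6
      exact h6
    refine h3.trans ?_
    have h4 := measureReal_deviation_le (χ₀ := χ₀) (δ := δ) hU hθ hs a ha0
    have h5 : (10 : ℝ) ≤ Real.exp 3 := by
      have h := Real.exp_one_gt_d9
      have e : Real.exp 3 = Real.exp 1 ^ 3 := by rw [← Real.exp_nat_mul]; norm_num
      rw [e]
      calc (10 : ℝ) ≤ 2.7 ^ 3 := by norm_num
        _ ≤ _ := pow_le_pow_left₀ (by norm_num) (by linarith) 3
    -- With R = (t/σ)² ≥ 1, the bounds a ≥ t/2 and 49γ²T ≤ σ² make the exponent of the deviation at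
    -- least 49R/8, which exceeds 3 + R/2; here e³ has absorbed the factor 10.
    have h6 : 3 + -(a ^ 2 / (2 * (γ ^ 2 * T))) ≤ -(1 / 2) * (t / σ) ^ 2 := by
      have hR : 1 ≤ (t / σ) ^ 2 := by
        rw [div_pow, one_le_div (by positivity)]
        exact pow_le_pow_left₀ hσ.le htσ.le 2
      have h7 : 49 / 8 * (t / σ) ^ 2 ≤ a ^ 2 / (2 * (γ ^ 2 * T)) := by
        rw [le_div_iff₀ (by positivity)]
        have h8 : (t / σ) ^ 2 * σ ^ 2 = t ^ 2 := by
          rw [div_pow, div_mul_cancel₀ _ (by positivity)]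
        have h9 : (t / σ) ^ 2 * (49 * (γ ^ 2 * T)) ≤ t ^ 2 := by
          rw [← h8]
          exact mul_le_mul_of_nonneg_left h₁ (sq_nonneg _)
        have h10 : t ^ 2 / 4 ≤ a ^ 2 := by nlinarith
        linarith
      linarith
    calc _ ≤ 10 * (2 * Real.exp (-(a ^ 2 / (2 * (γ ^ 2 * T))))) :=
          mul_le_mul_of_nonneg_left h4 (by norm_num)
      _ ≤ Real.exp 3 * (2 * Real.exp (-(a ^ 2 / (2 * (γ ^ 2 * T))))) :=
          mul_le_mul_of_nonneg_right h5 (by positivity)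
      _ = 2 * Real.exp (3 + -(a ^ 2 / (2 * (γ ^ 2 * T)))) := by rw [Real.exp_add]; ring
      _ ≤ _ := mul_le_mul_of_nonneg_left (Real.exp_le_exp.2 h6) (by norm_num)

/-! ### The parameters of the walk -/

section Parameters

variable (n)

theorem two_le_logb (hn : 2 ≤ n) : 2 ≤ Real.logb 2 (2 * n) := by
  rw [Real.le_logb_iff_rpow_le (by norm_num) (by positivity)]
  have : (2 : ℝ) ≤ n := by exact_mod_cast hn
  norm_num
  linarith

theorem logb_le (hn : 2 ≤ n) : Real.logb 2 (2 * n) ≤ n := by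
  rw [Real.logb_le_iff_le_rpow (by norm_num) (by positivity), Real.rpow_natCast]
  have : 2 * n ≤ 2 ^ n := by
    induction n, hn using Nat.le_induction with
    | base => norm_num
    | succ k hk ih => rw [pow_succ]; omega
  exact_mod_cast this

theorem logb_eq : Real.logb 2 (2 * n) * Real.log 2 = Real.log (2 * n) := by
  rw [Real.logb, div_mul_cancel₀]
  exact (Real.log_pos (by norm_num)).ne'

theorem log_two_mul_le (hn : 2 ≤ n) : Real.log (2 * n) ≤ 2 * Real.log n := by
  have h2 : (2 : ℝ) ≤ n := by exact_mod_cast hn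
  rw [Real.log_mul (by norm_num) (by positivity)]
  have := Real.log_le_log (by norm_num) h2
  linarith

theorem stepSize_mul_sqrt (hn : 2 ≤ n) :
    stepSize n * Real.sqrt n = 2 * Real.logb 2 (2 * n) / n ^ 2 := by
  have h0 : (0 : ℝ) < n := by positivity
  have h : (n : ℝ) ^ (5 / 2 : ℝ) = n ^ 2 * Real.sqrt n := by
    rw [Real.sqrt_eq_rpow, ← Real.rpow_natCast, ← Real.rpow_add h0]
    norm_num
  have hs : Real.sqrt n ≠ 0 := (Real.sqrt_pos.2 h0).ne'
  rw [stepSize, h]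
  field_simp

theorem stepSize_pos (hn : 2 ≤ n) : 0 < stepSize n := by
  have := two_le_logb n hn
  have h0 : (0 : ℝ) < n := by positivity
  rw [stepSize]
  positivity

theorem stepSize_sq (hn : 2 ≤ n) :
    stepSize n ^ 2 * n ^ 5 = 4 * Real.logb 2 (2 * n) ^ 2 := by
  have h := congrArg (· ^ 2) (stepSize_mul_sqrt n hn)
  have h0 : (0 : ℝ) < n := by positivity
  simp only [mul_pow, div_pow] at h
  rw [Real.sq_sqrt h0.le] at h
  generalize Real.logb 2 (2 * n) = L at h ⊢
  field_simp at h
  linear_combination h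

/-- From log₂ 2n ≤ n the product is at most 2/n ≤ 2/3; this is where n = 2 drops out. -/
theorem stepSize_mul_sqrt_le (hn : 3 ≤ n) : stepSize n * Real.sqrt n ≤ 7 / 10 := by
  have h3 : (3 : ℝ) ≤ n := by exact_mod_cast hn
  rw [stepSize_mul_sqrt n (by omega), div_le_iff₀ (by positivity)]
  have := logb_le n (by omega)
  nlinarith

theorem stepSize_mul_sqrt_le_threshold (hn : 2 ≤ n) :
    stepSize n * Real.sqrt n ≤ threshold n := by
  have h2 : (2 : ℝ) ≤ n := by exact_mod_cast hn
  have hl := logb_le n hn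
  have hl2 := two_le_logb n hn
  rw [stepSize_mul_sqrt n hn, threshold, div_le_div_iff₀ (by positivity) (by positivity)]
  have h1 : Real.logb 2 (2 * n) ≤ Real.sqrt (2 * Real.log 2 * Real.logb 2 (2 * n)) * n := by
    generalize Real.logb 2 (2 * n) = L at *
    nth_rewrite 1 [← Real.sqrt_sq (by positivity : (0 : ℝ) ≤ n)]
    rw [← Real.sqrt_mul' _ (by positivity)]
    refine Real.le_sqrt_of_sq_le ?_
    have hlog := Real.log_two_gt_d9
    have h4 : L ≤ 2 * Real.log 2 * n ^ 2 := by nlinarith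
    nlinarith
  nlinarith

theorem one_le_threshold_two : 1 ≤ threshold 2 := by
  have h : Real.logb 2 (2 * (2 : ℕ)) = 2 := by
    rw [Real.logb_eq_iff_rpow_eq] <;> norm_num
  rw [threshold, h]
  have : 1 ≤ Real.sqrt (2 * Real.log 2 * 2) := by
    rw [Real.one_le_sqrt]
    linarith [Real.log_two_gt_d9]
  norm_num at this ⊢
  linarith

theorem mul_threshold (hn : 2 ≤ n) : n * threshold n = 2 * Real.sqrt (2 * Real.log (2 * n)) := by
  have h0 : (n : ℝ) ≠ 0 := by positivity
  rw [threshold, mul_div_cancel₀ _ h0, ← logb_eq]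
  congr 2
  ring

theorem mul_threshold_le (hn : 2 ≤ n) : n * threshold n ≤ 4 * Real.sqrt (Real.log n) := by
  have h1 : Real.sqrt (2 * Real.log (2 * n)) ≤ 2 * Real.sqrt (Real.log n) := by
    rw [show (2 : ℝ) * Real.sqrt (Real.log n) = Real.sqrt (2 ^ 2) * Real.sqrt (Real.log n) by
      rw [Real.sqrt_sq (by norm_num)], ← Real.sqrt_mul (by norm_num)]
    refine Real.sqrt_le_sqrt ?_
    linarith [log_two_mul_le n hn]
  rw [mul_threshold n hn]
  linarith

theorem le_stepSize_sq_mul_numSteps (hn : 2 ≤ n) :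
    2 * Real.logb 2 (2 * n) ≤ stepSize n ^ 2 * numSteps n := by
  have hγ := stepSize_pos n hn
  have hl2 := two_le_logb n hn
  rw [numSteps, Nat.cast_mul, ← mul_assoc]
  have h1 : 2 ≤ stepSize n ^ 2 * ⌈2 / stepSize n ^ 2⌉₊ := by
    rw [← div_le_iff₀' (by positivity)]
    exact Nat.le_ceil _
  exact mul_le_mul h1 (Nat.le_ceil _) (by positivity) (by positivity)

/-- Each ceiling costs at most a factor 3/2: γ²⌈2/γ²⌉ ≤ 2 + γ² ≤ 3, and ⌈log₂ 2n⌉ ≤ (3/2)·log₂ 2n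
because log₂ 2n ≥ 2. -/
theorem stepSize_sq_mul_numSteps_le (hn : 2 ≤ n) :
    stepSize n ^ 2 * numSteps n ≤ 18 * Real.log n := by
  have hγ := stepSize_pos n hn
  have hl2 := two_le_logb n hn
  have hl := logb_le n hn
  have h2 : (2 : ℝ) ≤ n := by exact_mod_cast hn
  have hγ1 : stepSize n ^ 2 ≤ 1 := by
    have := stepSize_sq n hn
    have h5 : (0 : ℝ) < n ^ 5 := by positivity
    refine le_of_mul_le_mul_right (a := (n : ℝ) ^ 5) ?_ h5
    rw [this, one_mul]
    have h3 : (n : ℝ) ^ 5 = n ^ 2 * n ^ 3 := by ring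
    have h4 : (8 : ℝ) ≤ n ^ 3 := by
      calc (8 : ℝ) = 2 ^ 3 := by norm_num
        _ ≤ _ := pow_le_pow_left₀ (by norm_num) h2 3
    have h6 : Real.logb 2 (2 * n) ^ 2 ≤ (n : ℝ) ^ 2 := pow_le_pow_left₀ (by linarith) hl 2
    rw [h3]
    nlinarith [sq_nonneg (n : ℝ)]
  have h1 : stepSize n ^ 2 * ⌈2 / stepSize n ^ 2⌉₊ ≤ 3 := by
    have := (Nat.ceil_lt_add_one (a := 2 / stepSize n ^ 2) (by positivity)).le
    calc _ ≤ stepSize n ^ 2 * (2 / stepSize n ^ 2 + 1) :=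
          mul_le_mul_of_nonneg_left this (by positivity)
      _ = 2 + stepSize n ^ 2 := by field_simp
      _ ≤ 3 := by linarith
  have h3 : (⌈Real.logb 2 (2 * n)⌉₊ : ℝ) ≤ 3 / 2 * Real.logb 2 (2 * n) := by
    have := (Nat.ceil_lt_add_one (a := Real.logb 2 (2 * n)) (by linarith)).le
    linarith
  have h4 : stepSize n ^ 2 * numSteps n ≤ 9 / 2 * Real.logb 2 (2 * n) := by
    rw [numSteps, Nat.cast_mul, ← mul_assoc]
    calc _ ≤ 3 * (3 / 2 * Real.logb 2 (2 * n)) :=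
          mul_le_mul h1 h3 (by positivity) (by norm_num)
      _ = _ := by ring
  have h5 := logb_eq n
  have h6 := log_two_mul_le n hn
  have h7 := Real.log_two_gt_d9
  nlinarith

theorem numSteps_pos (hn : 2 ≤ n) : 0 < numSteps n := by
  have h := le_stepSize_sq_mul_numSteps n hn
  have h1 := two_le_logb n hn
  rcases Nat.eq_zero_or_pos (numSteps n) with h0 | h0
  · rw [h0] at h
    simp only [Nat.cast_zero, mul_zero] at h
    linarith
  · exact h0

theorem numSteps_le (hn : 2 ≤ n) : numSteps n ≤ n ^ 7 := by
  have h2 : (2 : ℝ) ≤ n := by exact_mod_cast hn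
  have hl2 := two_le_logb n hn
  have h1 : ⌈2 / stepSize n ^ 2⌉₊ ≤ n ^ 5 := by
    rw [Nat.ceil_le, div_le_iff₀ (by have := stepSize_pos n hn; positivity)]
    push_cast
    have := stepSize_sq n hn
    nlinarith
  have h3 : ⌈Real.logb 2 (2 * n)⌉₊ ≤ n := by
    rw [Nat.ceil_le]
    exact logb_le n hn
  calc numSteps n ≤ n ^ 5 * n := Nat.mul_le_mul h1 h3
    _ = n ^ 6 := by ring
    _ ≤ n ^ 7 := Nat.pow_le_pow_right (by omega) (by norm_num)

/-- The decay rate suffices because 729/1000 > ln 2, so that (729/2000)·2·log₂ 2n ≥ ln 2n. -/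
theorem mul_exp_le_half (hn : 2 ≤ n) :
    n * Real.exp (-(729 / 2000) * (stepSize n ^ 2 * numSteps n)) ≤ 1 / 2 := by
  have h := le_stepSize_sq_mul_numSteps n hn
  have h1 := logb_eq n
  have h2 := two_le_logb n hn
  have h3 := Real.log_two_lt_d9
  have h0 : (0 : ℝ) < n := by positivity
  have h4 : -(729 / 2000) * (stepSize n ^ 2 * numSteps n) ≤ -Real.log (2 * n) := by nlinarith
  calc _ ≤ n * Real.exp (-Real.log (2 * n)) :=
        mul_le_mul_of_nonneg_left (Real.exp_le_exp.2 h4) h0.le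
    _ = 1 / 2 := by
        rw [Real.exp_neg, Real.exp_log (by positivity)]
        field_simp

end Parameters

theorem measure_not_good_stepSize_le (hn : 2 ≤ n) (hU : U.Solves v)
    (hχ : ∀ i, χ₀ i ∈ Set.Icc (-1) 1) :
    fairCoins (Fin (numSteps n) × Fin n)
      (good U χ₀ (stepSize n) (threshold n) (numSteps n))ᶜ ≤ 9 / 10 := by
  rcases hn.eq_or_lt with rfl | h
  · exact measure_not_good_le_of_one_le one_le_threshold_two
  · have hγ := stepSize_pos n hn
    exact measure_not_good_le hU hγ
      ((mul_nonneg hγ.le (Real.sqrt_nonneg _)).trans (stepSize_mul_sqrt_le_threshold n hn))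
      (stepSize_mul_sqrt_le n h) hχ (mul_exp_le_half n hn)

end KomlosWalk
end

noncomputable section

namespace RealRAM

open Finset KomlosSolver

local infixr:60 " ;; " => Prog.seq

/-! ## Loops that fill arrays -/

variable {B : ℕ} {ω : ℕ → Bool} {p q : Prog} {s : State} {a : ℕ}

/-- `s'` arises from `s` by writing the values of `g` into the cells of array `a` in `P`. -/
def Fills (a : ℕ) (P : ℕ → ℕ → Prop) (g : ℕ → ℕ → ℝ) (s s' : State) : Prop :=
  ∀ i j, (P i j → s'.real a i j = g i j) ∧ (¬ P i j → s'.real a i j = s.real a i j)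

theorem Runs.setReal_fills {i j : NExpr} {e : RExpr} :
    Runs B ω (.setReal a i j e) s
      (Fills a (fun i' j' => i' = i.eval s ∧ j' = j.eval s) (fun _ _ => e.eval s) s) := by
  refine Runs.setReal fun i' j' => ⟨fun h => ?_, fun h => ?_⟩
  · simp [State.tick, State.writeReal, h]
  · simp [State.tick, State.writeReal, h]

/-- `R k` is the set of cells written in round k. These sets may overlap, as all rounds write values
of the same `g`; the body may also read cells filled by earlier rounds. -/
theorem Runs.fillLoop {x y N : ℕ} (R : ℕ → ℕ → ℕ → Prop) (g : ℕ → ℕ → ℝ)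
    (hx : p.modNat x = false) (hy : (Prog.forTo x y p).modNat y = false) (hN : s.nat y = N)
    (hB : N ≤ B)
    (hbody : ∀ k < N, ∀ s', Frame (Prog.forTo x y p) s s' → s'.nat x = k →
      Fills a (fun i j => ∃ k' < k, R k' i j) g s s' → Runs B ω p s' (Fills a (R k) g s')) :
    Runs B ω (Prog.forTo x y p) s (Fills a (fun i j => ∃ k < N, R k i j) g s) := by
  refine Runs.forTo N (fun k => Fills a (fun i j => ∃ k' < k, R k' i j) g s) hx hy hN hB
    (fun _ _ _ _ h => h) (fun i j => ⟨?_, fun _ => rfl⟩) fun k hk s' hf hkx hI =>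
      (hbody k hk s' hf hkx hI).mono fun s'' _ h i j => ⟨?_, fun hno => ?_⟩
  · rintro ⟨k, hk, -⟩
    exact absurd hk (Nat.not_lt_zero k)
  · rintro ⟨k', hk', hR⟩
    by_cases hRk : R k i j
    · exact (h i j).1 hRk
    · rw [(h i j).2 hRk]
      rcases Nat.lt_succ_iff_lt_or_eq.1 hk' with hlt | rfl
      · exact (hI i j).1 ⟨k', hlt, hR⟩
      · exact absurd hR hRk
  · rw [(h i j).2 fun hR => hno ⟨k, Nat.lt_succ_self k, hR⟩]
    exact (hI i j).2 fun ⟨k', hk', hR⟩ => hno ⟨k', hk'.trans (Nat.lt_succ_self k), hR⟩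

theorem Runs.accLoop {x y N i₀ j₀ : ℕ} (f : ℕ → ℝ)
    (hx : p.modNat x = false) (hy : (Prog.forTo x y p).modNat y = false) (hN : s.nat y = N)
    (hB : N ≤ B)
    (hbody : ∀ k < N, ∀ s', Frame (Prog.forTo x y p) s s' → s'.nat x = k →
      Fills a (fun i j => i = i₀ ∧ j = j₀) (fun _ _ => s.real a i₀ j₀ + ∑ l ∈ range k, f l) s s' →
      Runs B ω p s'
        (Fills a (fun i j => i = i₀ ∧ j = j₀) (fun _ _ => s'.real a i₀ j₀ + f k) s')) :
    Runs B ω (Prog.forTo x y p) s (Fills a (fun i j => i = i₀ ∧ j = j₀)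
      (fun _ _ => s.real a i₀ j₀ + ∑ l ∈ range N, f l) s) := by
  refine Runs.forTo N (fun k => Fills a (fun i j => i = i₀ ∧ j = j₀)
    (fun _ _ => s.real a i₀ j₀ + ∑ l ∈ range k, f l) s) hx hy hN hB
    (fun _ _ _ _ h => h) (fun i j => ⟨?_, fun _ => rfl⟩) fun k hk s' hf hkx hI =>
      (hbody k hk s' hf hkx hI).mono fun s'' _ h i j => ⟨fun hij => ?_, fun hno => ?_⟩
  · rintro ⟨rfl, rfl⟩
    simp
  · rw [(h i j).1 hij, (hI i₀ j₀).1 ⟨rfl, rfl⟩, sum_range_succ, add_assoc]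
  · rw [(h i j).2 hno, (hI i j).2 hno]

/-! ## The solver as a program -/

/-- Computes the Gram matrix of the input vectors. -/
def gramProg : Prog :=
  .forTo 3 0 (.forTo 4 0 (.setReal 5 (.var 3) (.var 4) (.cast (.const 0)) ;;
    .forTo 5 1 (.setReal 5 (.var 3) (.var 4) (.add (.get 5 (.var 3) (.var 4))
      (.mul (.get 0 (.var 3) (.var 5)) (.get 0 (.var 4) (.var 5)))))))

variable {n m : ℕ}

theorem gramProg_runs {V : ℕ → ℕ → ℝ} (hn : s.nat 0 = n) (hm : s.nat 1 = m) (hnB : n ≤ B)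
    (hmB : m ≤ B) (hV : ∀ i < n, ∀ j < m, s.real 0 i j = V i j) :
    Runs B ω gramProg s fun s' =>
      ∀ i < n, ∀ j < n, s'.real 5 i j = ∑ l ∈ range m, V i l * V j l := by
  set g : ℕ → ℕ → ℝ := fun i j => ∑ l ∈ range m, V i l * V j l with hg
  refine (Runs.fillLoop (a := 5) (fun k i j => i = k ∧ j < n) g rfl rfl hn hnB
    fun i hi s₁ f₁ e₁ _ => ?_).mono fun s' _ h i hi j hj => (h i j).1 ⟨i, hi, rfl, hj⟩
  refine (Runs.fillLoop (a := 5) (fun k i' j => i' = i ∧ j = k) g rfl rfl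
    ((f₁.nat 0 rfl).trans hn) hnB fun j hj s₂ f₂ e₂ _ => ?_).mono fun s' _ h i' j' =>
      ⟨fun ⟨h1, h2⟩ => (h i' j').1 ⟨j', h2, h1, rfl⟩,
        fun hno => (h i' j').2 fun ⟨k, hk, h1, h2⟩ => hno ⟨h1, h2 ▸ hk⟩⟩
  have e₃ : s₂.nat 3 = i := (f₂.nat 3 rfl).trans e₁
  refine Runs.seq Runs.setReal_fills fun s₃ f₃ h₃ => ?_
  simp only [NExpr.eval, RExpr.eval, e₂, e₃] at h₃
  refine (Runs.accLoop (a := 5) (i₀ := i) (j₀ := j) (fun l => V i l * V j l) rfl rfl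
    (N := m) ?_ hmB fun l hl s₄ f₄ e₄ h₄ => ?_).mono fun s' _ h i' j' =>
      ⟨fun hij => ?_, fun hno => ?_⟩
  · rw [f₃.nat 1 rfl, f₂.nat 1 rfl, f₁.nat 1 rfl, hm]
  · refine Runs.setReal_fills.mono fun s' _ h => ?_
    have r3 : s₄.nat 3 = i := by rw [f₄.nat 3 rfl, f₃.nat 3 rfl, e₃]
    have r4 : s₄.nat 4 = j := by rw [f₄.nat 4 rfl, f₃.nat 4 rfl, e₂]
    have r0 : s₄.real 0 = s.real 0 := by
      rw [f₄.real 0 rfl, f₃.real 0 rfl, f₂.real 0 rfl, f₁.real 0 rfl]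
    simpa only [NExpr.eval, RExpr.eval, r3, r4, e₄, r0, hV i hi l hl, hV j hj l hl] using h
  · rw [(h i' j').1 hij, (h₃ i j).1 ⟨rfl, rfl⟩, hij.1, hij.2]
    simp [hg]
  · rw [(h i' j').2 hno, (h₃ i' j').2 hno]

/-- Writes the inner product of row `r` of array `5` and row `j` of array `9` to array `a`, where
`r` and `j` are registers. -/
def dotProg (a r j : ℕ) : Prog :=
  .setReal a (.const 0) (.const 0) (.cast (.const 0)) ;;
    .forTo 5 0 (.setReal a (.const 0) (.const 0) (.add (.get a (.const 0) (.const 0))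
      (.mul (.get 5 (.var r) (.var 5)) (.get 9 (.var j) (.var 5)))))

theorem dotProg_runs {M : ℕ → ℕ → ℝ} {u : ℕ → ℝ} {a r j : ℕ} (ha : a ≠ 5 ∧ a ≠ 9)
    (hr : r ≠ 5) (hj : j ≠ 5) (hn : s.nat 0 = n) (hnB : n ≤ B)
    (hM : ∀ l < n, s.real 5 (s.nat r) l = M (s.nat r) l)
    (hu : ∀ l < n, s.real 9 (s.nat j) l = u l) :
    Runs B ω (dotProg a r j) s fun s' => s'.real a 0 0 = dotRow M n u (s.nat r) := by
  refine Runs.seq Runs.setReal_fills fun s₁ f₁ h₁ => ?_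
  refine (Runs.accLoop (a := a) (i₀ := 0) (j₀ := 0) (fun l => M (s.nat r) l * u l) rfl rfl
    (N := n) ((f₁.nat 0 rfl).trans hn) hnB fun l hl s₂ f₂ e₂ h₂ => ?_).mono fun s' _ h => ?_
  · refine Runs.setReal_fills.mono fun s' _ h => ?_
    have r1 : s₂.nat r = s.nat r := by
      rw [f₂.nat r (by simp [Prog.forTo, Prog.modNat, hr.symm]), f₁.nat r rfl]
    have r2 : s₂.nat j = s.nat j := by
      rw [f₂.nat j (by simp [Prog.forTo, Prog.modNat, hj.symm]), f₁.nat j rfl]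
    have r5 : s₂.real 5 = s.real 5 := by
      rw [f₂.real 5 (by simp [Prog.forTo, Prog.modReal, ha.1]),
        f₁.real 5 (by simp [Prog.modReal, ha.1])]
    have r9 : s₂.real 9 = s.real 9 := by
      rw [f₂.real 9 (by simp [Prog.forTo, Prog.modReal, ha.2]),
        f₁.real 9 (by simp [Prog.modReal, ha.2])]
    simpa only [NExpr.eval, RExpr.eval, r1, r2, r5, r9, e₂, hM l hl, hu l hl] using h
  · rw [(h 0 0).1 ⟨rfl, rfl⟩, (h₁ 0 0).1 ⟨rfl, rfl⟩]
    simp [RExpr.eval, NExpr.eval, dotRow]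

/-- Subtracts from row `i` of array `9` its Gram-Schmidt projections to the earlier rows, where
`i` is register `3`. -/
def projProg : Prog :=
  .forTo 4 3 (dotProg 10 3 4 ;; dotProg 11 4 4 ;;
    .forTo 5 0 (.setReal 9 (.var 3) (.var 5) (.sub (.get 9 (.var 3) (.var 5))
      (.mul (.div (.get 10 (.const 0) (.const 0)) (.get 11 (.const 0) (.const 0)))
        (.get 9 (.var 4) (.var 5))))))

/-- Computes the Gram-Schmidt coefficients. -/
def gsProg : Prog :=
  .forTo 3 0 (.forTo 5 0 (.setReal 9 (.var 3) (.var 5) (.cast (.const 0))) ;;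
    .ite (.realLt (.cast (.const 0)) (.get 8 (.var 3) (.const 0)))
      (.setReal 9 (.var 3) (.var 3) (.cast (.const 1)) ;; projProg) .skip)

variable {M : ℕ → ℕ → ℝ} {b : ℕ → ℝ}

/-- Each projection coefficient is computed from M and a finished row, never from row i itself, so
row i can be overwritten in place. -/
theorem projProg_runs {i : ℕ} (hi : i < n) (hn : s.nat 0 = n) (hi3 : s.nat 3 = i) (hnB : n ≤ B)
    (hM : ∀ i < n, ∀ l < n, s.real 5 i l = M i l)
    (hrows : ∀ j < i, ∀ l < n, s.real 9 j l = gsRow M n b j l)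
    (hrow : ∀ l < n, s.real 9 i l = (Pi.single i 1 : ℕ → ℝ) l) :
    Runs B ω projProg s (Fills 9 (fun i' l => i' = i ∧ l < n)
      (fun _ l => gsPartial M n b i i l) s) := by
  refine Runs.forTo i (fun k => Fills 9 (fun i' l => i' = i ∧ l < n)
      (fun _ l => gsPartial M n b i k l) s) rfl rfl hi3 (hi.le.trans hnB) (fun _ _ _ _ h => h)
      (fun i' l => ⟨?_, fun _ => rfl⟩) fun k hk s₁ f₁ e₁ h₁ => ?_
  · rintro ⟨rfl, hl⟩
    rw [hrow l hl]
    simp [gsPartial]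
  have r3 : s₁.nat 3 = i := by rw [f₁.nat 3 rfl, hi3]
  have r0 : s₁.nat 0 = n := by rw [f₁.nat 0 rfl, hn]
  have rM : ∀ i < n, ∀ l < n, s₁.real 5 i l = M i l := by rw [f₁.real 5 rfl]; exact hM
  have rk : ∀ l < n, s₁.real 9 k l = gsRow M n b k l := fun l hl => by
    rw [(h₁ k l).2 fun h => by omega]
    exact hrows k hk l hl
  refine Runs.seq (dotProg_runs (M := M) (u := gsRow M n b k) (by decide) (by decide) (by decide)
    r0 hnB (by rw [r3]; exact rM i hi) (by rw [e₁]; exact rk)) fun s₂ f₂ h₂ => ?_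
  refine Runs.seq (dotProg_runs (M := M) (u := gsRow M n b k) (by decide) (by decide) (by decide)
    ((f₂.nat 0 rfl).trans r0) hnB (by rw [f₂.nat 4 rfl, f₂.real 5 rfl, e₁]; exact rM k (hk.trans hi))
    (by rw [f₂.nat 4 rfl, f₂.real 9 rfl, e₁]; exact rk)) fun s₃ f₃ h₃ => ?_
  have q3 : s₃.nat 3 = i := by rw [f₃.nat 3 rfl, f₂.nat 3 rfl, r3]
  have q4 : s₃.nat 4 = k := by rw [f₃.nat 4 rfl, f₂.nat 4 rfl, e₁]
  have q9 : s₃.real 9 = s₁.real 9 := by rw [f₃.real 9 rfl, f₂.real 9 rfl]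
  have q10 : s₃.real 10 0 0 = dotRow M n (gsRow M n b k) i := by rw [f₃.real 10 rfl, h₂, r3]
  have q11 : s₃.real 11 0 0 = dotRow M n (gsRow M n b k) k := by
    rw [h₃, f₂.nat 4 rfl, e₁]
  refine (Runs.fillLoop (a := 9) (N := n) (fun l i' l' => i' = i ∧ l' = l)
    (fun _ l => gsPartial M n b i (k + 1) l) rfl rfl ?_ hnB fun l hl s₄ f₄ e₄ h₄ => ?_).mono
      fun s' _ h i' l' => ⟨fun ⟨h5, h6⟩ => (h i' l').1 ⟨l', h6, h5, rfl⟩, fun hno => ?_⟩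
  · rw [f₃.nat 0 rfl, f₂.nat 0 rfl, r0]
  · refine Runs.setReal_fills.mono fun s' _ h => ?_
    have t3 : s₄.nat 3 = i := by rw [f₄.nat 3 rfl, q3]
    have t4 : s₄.nat 4 = k := by rw [f₄.nat 4 rfl, q4]
    have t9 : s₄.real 9 i l = gsPartial M n b i k l := by
      rw [(h₄ i l).2 (by rintro ⟨k', h5, -, h6⟩; omega), q9, (h₁ i l).1 ⟨rfl, hl⟩]
    have t9' : s₄.real 9 k l = gsRow M n b k l := by
      rw [(h₄ k l).2 (by rintro ⟨k', -, h6, -⟩; omega), q9, rk l hl]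
    simp only [NExpr.eval, RExpr.eval, t3, t4, e₄, t9, t9', f₄.real 10 rfl, f₄.real 11 rfl, q10,
      q11] at h
    intro i' l'
    refine ⟨fun hh => ?_, (h i' l').2⟩
    rw [(h i' l').1 hh, hh.2, gsPartial_succ]
    simp
  · rw [(h i' l').2 fun ⟨l, h5, h6, h7⟩ => hno ⟨h6, h7 ▸ h5⟩, q9, (h₁ i' l').2 hno]

theorem gsProg_runs (hn : s.nat 0 = n) (hnB : n ≤ B)
    (hM : ∀ i < n, ∀ l < n, s.real 5 i l = M i l) (hb : ∀ i < n, s.real 8 i 0 = b i) :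
    Runs B ω gsProg s fun s' => ∀ i < n, ∀ l < n, s'.real 9 i l = gsRow M n b i l := by
  refine (Runs.fillLoop (a := 9) (fun k i l => i = k ∧ l < n) (gsRow M n b) rfl rfl hn hnB
    fun i hi s₁ f₁ e₁ h₁ => ?_).mono fun s' _ h i hi j hj => (h i j).1 ⟨i, hi, rfl, hj⟩
  refine Runs.seq (Runs.fillLoop (a := 9) (N := n) (fun k i' l => i' = i ∧ l = k) (fun _ _ => 0)
    rfl rfl ((f₁.nat 0 rfl).trans hn) hnB fun l hl s₂ f₂ e₂ _ => ?_) fun s₂ f₂ h₂ => ?_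
  · have q3 : s₂.nat 3 = i := (f₂.nat 3 rfl).trans e₁
    refine Runs.setReal_fills.mono fun s' _ h => ?_
    simpa only [NExpr.eval, RExpr.eval, q3, e₂, Nat.cast_zero] using h
  have q3 : s₂.nat 3 = i := (f₂.nat 3 rfl).trans e₁
  have q8 : s₂.real 8 = s.real 8 := by rw [f₂.real 8 rfl, f₁.real 8 rfl]
  refine Runs.ite (fun hlt => ?_) fun hlt => Runs.skip fun i' l => ⟨?_, fun hno => ?_⟩
  · simp only [Test.Holds, RExpr.eval, NExpr.eval, q3, q8, hb i hi, Nat.cast_zero] at hlt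
    refine Runs.seq Runs.setReal_fills fun s₃ f₃ h₃ => ?_
    have hv3 : (s₂.tick (Test.realLt (.cast (.const 0)) (.get 8 (.var 3) (.const 0))).cost).nat 3 =
      i := q3
    simp only [NExpr.eval, RExpr.eval, hv3, Nat.cast_one] at h₃
    have hother : ∀ i' l, ¬ (i' = i ∧ l < n) → s₃.real 9 i' l = s₁.real 9 i' l := by
      intro i' l hno
      rw [(h₃ i' l).2 (by rintro ⟨rfl, rfl⟩; exact hno ⟨rfl, hi⟩)]
      exact (h₂ i' l).2 fun ⟨k, h5, h6, h7⟩ => hno ⟨h6, h7 ▸ h5⟩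
    refine (projProg_runs (b := b) hi ?_ ?_ hnB (M := M) ?_ ?_ ?_).mono
      fun s' _ h i' l => ⟨fun hh => ?_, fun hno => ?_⟩
    · exact (f₃.nat 0 rfl).trans ((f₂.nat 0 rfl).trans ((f₁.nat 0 rfl).trans hn))
    · exact (f₃.nat 3 rfl).trans q3
    · rw [f₃.real 5 rfl]
      change ∀ i < n, ∀ l < n, s₂.real 5 i l = M i l
      rw [f₂.real 5 rfl, f₁.real 5 rfl]
      exact hM
    · intro j hj l hl
      rw [hother j l (by omega)]
      exact (h₁ j l).1 ⟨j, hj, rfl, hl⟩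
    · intro l hl
      by_cases hli : l = i
      · rw [(h₃ i l).1 ⟨rfl, hli⟩, hli]; simp
      · rw [(h₃ i l).2 fun h => hli h.2]
        refine ((h₂ i l).1 ⟨l, hl, rfl, rfl⟩).trans ?_
        simp [hli]
    · rw [(h i' l).1 hh, hh.1, gsRow_eq, if_pos hlt]
    · rw [(h i' l).2 hno, hother i' l hno]
  · simp only [Test.Holds, RExpr.eval, NExpr.eval, q3, q8, hb i hi, Nat.cast_zero] at hlt
    rintro ⟨rfl, hl⟩
    rw [gsRow_eq, if_neg hlt]
    exact (h₂ i' l).1 ⟨l, hl, rfl, rfl⟩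
  · exact (h₂ i' l).2 fun ⟨k, h5, h6, h7⟩ => hno ⟨h6, h7 ▸ h5⟩

/-- Copies the row of the pivot to array `12`. -/
def pivotProg : Prog :=
  .forTo 3 0 (.setReal 12 (.var 3) (.const 0) (.cast (.const 0))) ;;
    .forTo 3 0 (.ite (.realLt (.cast (.const 0)) (.get 8 (.var 3) (.const 0)))
      (.forTo 5 0 (.setReal 12 (.var 5) (.const 0) (.get 9 (.var 3) (.var 5)))) .skip)

theorem pivotProg_runs (hn : s.nat 0 = n) (hnB : n ≤ B)
    (hG : ∀ i < n, ∀ l < n, s.real 9 i l = gsRow M n b i l) (hb : ∀ i < n, s.real 8 i 0 = b i) :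
    Runs B ω pivotProg s fun s' => ∀ l < n, s'.real 12 l 0 = pivotRow M n b n l := by
  refine Runs.seq (Runs.fillLoop (a := 12) (fun k i l => i = k ∧ l = 0) (fun _ _ => 0) rfl rfl hn
    hnB fun i hi s₁ f₁ e₁ _ => ?_) fun s₁ f₁ h₁ => ?_
  · refine Runs.setReal_fills.mono fun s' _ h => ?_
    simpa only [NExpr.eval, RExpr.eval, e₁, Nat.cast_zero] using h
  refine Runs.forTo n (fun k s' => ∀ l < n, s'.real 12 l 0 = pivotRow M n b k l) rfl rfl
    ((f₁.nat 0 rfl).trans hn) hnB (fun _ _ _ _ h => h)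
    (fun l hl => (h₁ l 0).1 ⟨l, hl, rfl, rfl⟩) fun k hk s₂ f₂ e₂ h₂ => ?_
  have q8 : s₂.real 8 = s.real 8 := by rw [f₂.real 8 rfl, f₁.real 8 rfl]
  have q9 : s₂.real 9 = s.real 9 := by rw [f₂.real 9 rfl, f₁.real 9 rfl]
  refine Runs.ite (fun hlt => ?_) fun hlt => Runs.skip fun l hl => ?_
  all_goals simp only [Test.Holds, RExpr.eval, NExpr.eval, e₂, q8, hb k hk, Nat.cast_zero] at hlt
  · refine (Runs.fillLoop (a := 12) (fun l i j => i = l ∧ j = 0)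
      (fun l _ => gsRow M n b k l) rfl rfl (N := n) ?_ hnB fun l hl s₃ f₃ e₃ _ => ?_).mono
      fun s' _ h l hl => ?_
    · exact (f₂.nat 0 rfl).trans ((f₁.nat 0 rfl).trans hn)
    · refine Runs.setReal_fills.mono fun s' _ h => ?_
      have q3 : s₃.nat 3 = k := (f₃.nat 3 rfl).trans e₂
      have q9' : s₃.real 9 = s.real 9 := (f₃.real 9 rfl).trans q9
      simp only [NExpr.eval, RExpr.eval, q3, e₃, q9', hG k hk l hl] at h
      intro i j
      exact ⟨fun hh => by rw [(h i j).1 hh, hh.1], (h i j).2⟩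
    · rw [(h l 0).1 ⟨l, hl, rfl, rfl⟩]
      simp [pivotRow, hlt]
  · simp only [pivotRow, if_neg hlt]
    exact h₂ l hl

/-- Computes the step length and stores it in array `13`. -/
def lenProg : Prog :=
  .setReal 13 (.const 0) (.const 0) (.cast (.const 1)) ;;
    .forTo 3 0 (.ite (.realLt (.get 8 (.var 3) (.const 0)) (.mul (.get 13 (.const 0) (.const 0))
        (.mul (.get 12 (.var 3) (.const 0)) (.get 12 (.var 3) (.const 0)))))
      (.setReal 13 (.const 0) (.const 0) (.div (.get 8 (.var 3) (.const 0))
        (.mul (.get 12 (.var 3) (.const 0)) (.get 12 (.var 3) (.const 0))))) .skip)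

theorem lenProg_runs {z : ℕ → ℝ} (hn : s.nat 0 = n) (hnB : n ≤ B)
    (hz : ∀ i < n, s.real 12 i 0 = z i) (hb : ∀ i < n, s.real 8 i 0 = b i) :
    Runs B ω lenProg s fun s' => s'.real 13 0 0 = stepLen b z n := by
  refine Runs.seq Runs.setReal_fills fun s₁ f₁ h₁ => ?_
  refine Runs.forTo n (fun k s' => s'.real 13 0 0 = stepLen b z k) rfl rfl
    ((f₁.nat 0 rfl).trans hn) hnB (fun _ _ _ _ h => h) ?_ fun k hk s₂ f₂ e₂ h₂ => ?_
  · rw [(h₁ 0 0).1 ⟨rfl, rfl⟩]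
    simp [RExpr.eval, NExpr.eval, stepLen]
  have q8 : s₂.real 8 = s.real 8 := by rw [f₂.real 8 rfl, f₁.real 8 rfl]
  have q12 : s₂.real 12 = s.real 12 := by rw [f₂.real 12 rfl, f₁.real 12 rfl]
  refine Runs.ite (fun hlt => ?_) fun hlt => Runs.skip ?_
  all_goals
    simp only [Test.Holds, RExpr.eval, NExpr.eval, e₂, q8, q12, h₂, hb k hk, hz k hk] at hlt
  · refine Runs.setReal_fills.mono fun s' _ h => ?_
    rw [(h 0 0).1 ⟨rfl, rfl⟩]
    simp only [stepLen, if_pos hlt, RExpr.eval, NExpr.eval]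
    change s₂.real 8 (s₂.nat 3) 0 / (s₂.real 12 (s₂.nat 3) 0 * s₂.real 12 (s₂.nat 3) 0) = _
    rw [e₂, q8, q12, hb k hk, hz k hk]
  · simp only [stepLen, if_neg hlt]
    exact h₂

/-- Writes column `s` of the matrix `U` to array `14` and updates the budgets, where `s` is
register `6`. -/
def colProg : Prog :=
  .forTo 3 0 (.setReal 14 (.var 3) (.var 6)
      (.mul (.sqrt (.get 13 (.const 0) (.const 0))) (.get 12 (.var 3) (.const 0)))) ;;
    .forTo 3 0 (.setReal 8 (.var 3) (.const 0) (.sub (.get 8 (.var 3) (.const 0))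
      (.mul (.get 13 (.const 0) (.const 0))
        (.mul (.get 12 (.var 3) (.const 0)) (.get 12 (.var 3) (.const 0))))))

theorem colProg_runs {z : ℕ → ℝ} {c : ℝ} {k : ℕ} (hn : s.nat 0 = n) (hk : s.nat 6 = k)
    (hnB : n ≤ B) (hc : s.real 13 0 0 = c) (hz : ∀ i < n, s.real 12 i 0 = z i)
    (hb : ∀ i < n, s.real 8 i 0 = b i) :
    Runs B ω colProg s fun s' =>
      Fills 14 (fun i j => i < n ∧ j = k) (fun i _ => Real.sqrt c * z i) s s' ∧
      ∀ i < n, s'.real 8 i 0 = b i - c * (z i * z i) := by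
  refine Runs.seq (Runs.fillLoop (a := 14) (fun l i j => i = l ∧ j = k)
    (fun i _ => Real.sqrt c * z i) rfl rfl hn hnB fun i hi s₁ f₁ e₁ _ => ?_) fun s₁ f₁ h₁ => ?_
  · refine Runs.setReal_fills.mono fun s' _ h => ?_
    simp only [NExpr.eval, RExpr.eval, e₁, (f₁.nat 6 rfl).trans hk, f₁.real 13 rfl, hc,
      f₁.real 12 rfl, hz i hi] at h
    intro i' j
    exact ⟨fun hh => by rw [(h i' j).1 hh, hh.1], (h i' j).2⟩
  refine (Runs.fillLoop (a := 8) (fun l i j => i = l ∧ j = 0)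
    (fun i _ => b i - c * (z i * z i)) rfl rfl ((f₁.nat 0 rfl).trans hn) hnB
    fun i hi s₂ f₂ e₂ h₂ => ?_).mono fun s' f' h => ⟨fun i j => ?_, fun i hi => ?_⟩
  · refine Runs.setReal_fills.mono fun s' _ h => ?_
    have q8 : s₂.real 8 i 0 = b i := by
      rw [(h₂ i 0).2 (by rintro ⟨k', h5, h6, -⟩; omega), f₁.real 8 rfl, hb i hi]
    simp only [NExpr.eval, RExpr.eval, e₂, f₂.real 13 rfl, f₁.real 13 rfl, hc, f₂.real 12 rfl,
      f₁.real 12 rfl, hz i hi, q8] at h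
    intro i' j
    exact ⟨fun hh => by rw [(h i' j).1 hh, hh.1], (h i' j).2⟩
  · rw [f'.real 14 rfl]
    exact ⟨fun hh => (h₁ i j).1 ⟨i, hh.1, rfl, hh.2⟩,
      fun hno => (h₁ i j).2 fun ⟨l, h5, h6, h7⟩ => hno ⟨h6 ▸ h5, h7⟩⟩
  · exact (h i 0).1 ⟨i, hi, rfl, rfl⟩

/-- Solves the vector Komlós program. Array `7` holds the indicator function of the active set,
array `5` the Gram matrix. The output is the matrix `U` in array `14`. -/
def solverProg : Prog :=
  .forTo 3 0 (.setReal 8 (.var 3) (.const 0) (.get 7 (.var 3) (.const 0))) ;;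
    .forTo 6 0 (gsProg ;; pivotProg ;; lenProg ;; colProg)

/-- The loop invariant after k rounds: the first k columns of U are in place and array 8 holds the
budgets of round k. -/
theorem solverProg_runs (hn : s.nat 0 = n) (hnB : n ≤ B)
    (hM : ∀ i < n, ∀ l < n, s.real 5 i l = M i l) (hb : ∀ i < n, s.real 7 i 0 = b i) :
    Runs B ω solverProg s fun s' => ∀ i < n, ∀ l < n, s'.real 14 i l = entry M n b i l := by
  refine Runs.seq (Runs.fillLoop (a := 8) (fun l i j => i = l ∧ j = 0) (fun i _ => b i) rfl rfl
    hn hnB fun i hi s₁ f₁ e₁ _ => ?_) fun s₁ f₁ h₁ => ?_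
  · refine Runs.setReal_fills.mono fun s' _ h => ?_
    simp only [NExpr.eval, RExpr.eval, e₁, f₁.real 7 rfl, hb i hi] at h
    intro i' j
    exact ⟨fun hh => by rw [(h i' j).1 hh, hh.1], (h i' j).2⟩
  refine (Runs.forTo n (fun k s' => (∀ i < n, ∀ l < k, s'.real 14 i l = entry M n b i l) ∧
    ∀ i < n, s'.real 8 i 0 = budget M n b k i) rfl rfl ((f₁.nat 0 rfl).trans hn) hnB
    (fun _ _ _ _ h => h) ⟨fun i _ l hl => absurd hl (Nat.not_lt_zero l),
      fun i hi => (h₁ i 0).1 ⟨i, hi, rfl, rfl⟩⟩ fun k hk s₂ f₂ e₂ h₂ => ?_).mono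
      fun s' _ h => h.1
  have q0 : s₂.nat 0 = n := by rw [f₂.nat 0 rfl, f₁.nat 0 rfl, hn]
  refine Runs.seq (gsProg_runs (M := M) q0 hnB (by rw [f₂.real 5 rfl, f₁.real 5 rfl]; exact hM)
    h₂.2) fun s₃ f₃ h₃ => ?_
  refine Runs.seq (pivotProg_runs ((f₃.nat 0 rfl).trans q0) hnB h₃
    (by rw [f₃.real 8 rfl]; exact h₂.2)) fun s₄ f₄ h₄ => ?_
  refine Runs.seq (lenProg_runs (b := budget M n b k) ((f₄.nat 0 rfl).trans
    ((f₃.nat 0 rfl).trans q0)) hnB h₄ (by rw [f₄.real 8 rfl, f₃.real 8 rfl]; exact h₂.2))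
    fun s₅ f₅ h₅ => ?_
  refine (colProg_runs (b := budget M n b k) (k := k) (z := pivotRow M n (budget M n b k) n)
    ?_ ?_ hnB h₅ ?_ ?_).mono fun s' _ h => ⟨fun i hi l hl => ?_, h.2⟩
  · rw [f₅.nat 0 rfl, f₄.nat 0 rfl, f₃.nat 0 rfl, q0]
  · rw [f₅.nat 6 rfl, f₄.nat 6 rfl, f₃.nat 6 rfl, e₂]
  · rw [f₅.real 12 rfl]; exact h₄
  · rw [f₅.real 8 rfl, f₄.real 8 rfl, f₃.real 8 rfl]; exact h₂.2
  · by_cases hlk : l = k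
    · rw [(h.1 i l).1 ⟨hi, hlk⟩, hlk]; rfl
    · rw [(h.1 i l).2 fun hh => hlk hh.2, f₅.real 14 rfl, f₄.real 14 rfl, f₃.real 14 rfl]
      exact h₂.1 i hi l (by omega)

end RealRAM
end

noncomputable section

namespace RealRAM

open Finset KomlosSolver KomlosWalk FairCoins

local infixr:60 " ;; " => Prog.seq

/-! ## The walk as a program -/

/-- Tosses the coins of a step; array `15` receives the signs. -/
def coinProg : Prog :=
  .forTo 3 0 (.flip 7 ;; .setReal 15 (.var 3) (.const 0)
    (.sub (.add (.cast (.var 7)) (.cast (.var 7))) (.cast (.const 1))))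

/-- Adds `γ U r` to the current point, which is held in array `6`. -/
def moveProg : Prog :=
  .forTo 3 0 (.forTo 5 0 (.setReal 6 (.var 3) (.const 0) (.add (.get 6 (.var 3) (.const 0))
    (.mul (.get 3 (.const 0) (.const 0))
      (.mul (.get 14 (.var 3) (.var 5)) (.get 15 (.var 5) (.const 0)))))))

/-- Computes the indicator function of the active set in array `7`. -/
def activeProg : Prog :=
  .forTo 3 0 (.ite (.realLt
      (.sqrt (.mul (.get 6 (.var 3) (.const 0)) (.get 6 (.var 3) (.const 0))))
      (.sub (.cast (.const 1)) (.get 4 (.const 0) (.const 0))))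
    (.setReal 7 (.var 3) (.const 0) (.cast (.const 1)))
    (.setReal 7 (.var 3) (.const 0) (.cast (.const 0))))

/-- One step of the walk. -/
def stepProg : Prog := solverProg ;; coinProg ;; moveProg ;; activeProg

/-- One attempt. Entry `(0, 0)` of array `16` tells whether it failed. -/
def attemptProg : Prog :=
  .forTo 3 0 (.setReal 6 (.var 3) (.const 0) (.get 1 (.var 3) (.const 0)) ;;
      .setReal 7 (.var 3) (.const 0) (.cast (.const 1))) ;;
    .forTo 8 2 stepProg ;;
    .setReal 16 (.const 0) (.const 0) (.cast (.const 0)) ;;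
    .forTo 3 0 (.ite (.realLt (.cast (.const 0)) (.get 7 (.var 3) (.const 0)))
      (.setReal 16 (.const 0) (.const 0) (.cast (.const 1))) .skip)

/-- The test whether the last attempt failed. -/
def failTest : Test := .realLt (.cast (.const 0)) (.get 16 (.const 0) (.const 0))

/-- Writes the signs of the current point to array `2`. -/
def outProg : Prog :=
  .forTo 3 0 (.ite (.realLt (.get 6 (.var 3) (.const 0)) (.cast (.const 0)))
    (.setReal 2 (.var 3) (.const 0) (.sub (.cast (.const 0)) (.cast (.const 1))))
    (.setReal 2 (.var 3) (.const 0) (.cast (.const 1))))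

/-- The guided random walk. -/
def walkProg : Prog :=
  gramProg ;; .setReal 16 (.const 0) (.const 0) (.cast (.const 1)) ;;
    .loop failTest attemptProg ;; outProg

variable {B : ℕ} {ω : ℕ → Bool} {s : State} {n m T : ℕ}
  {v : Fin n → EuclideanSpace ℝ (Fin m)} {χ₀ : Fin n → ℝ} {γ δ : ℝ}

theorem coinProg_runs (hn : s.nat 0 = n) (hnB : n ≤ B) :
    Runs B ω coinProg s fun s' => s'.coins = s.coins + n ∧
      ∀ i < n, s'.real 15 i 0 = coinSign (ω (s.coins + i)) := by
  refine Runs.forTo n (fun k s' => s'.coins = s.coins + k ∧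
    ∀ i < k, s'.real 15 i 0 = coinSign (ω (s.coins + i))) rfl rfl hn hnB
    (fun _ _ _ _ h => h) ⟨rfl, fun i hi => absurd hi (Nat.not_lt_zero i)⟩
    fun k hk s₁ f₁ e₁ h₁ => ?_
  refine Runs.seq (R := fun s' => s' = (s₁.toss ω 7).tick 1) (Runs.flip rfl) fun s₂ f₂ h₂ => ?_
  refine Runs.setReal_fills.mono fun s' f' h => ⟨?_, fun i hi => ?_⟩
  · rw [f'.coins rfl, h₂]
    simp only [State.tick, State.toss, h₁.1]
    omega
  · have q3 : s₂.nat 3 = k := (f₂.nat 3 rfl).trans e₁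
    have q7 : s₂.nat 7 = if ω (s.coins + k) then 1 else 0 := by
      rw [h₂, ← h₁.1]; rfl
    simp only [NExpr.eval, RExpr.eval, q3, q7] at h
    rcases Nat.lt_succ_iff_lt_or_eq.1 hi with hlt | rfl
    · rw [(h i 0).2 (by omega), f₂.real 15 rfl]
      exact h₁.2 i hlt
    · rw [(h i 0).1 ⟨rfl, rfl⟩, coinSign]
      split_ifs <;> norm_num

theorem moveProg_runs {U : ℕ → ℕ → ℝ} {x r : ℕ → ℝ} (hn : s.nat 0 = n) (hnB : n ≤ B)
    (hγ : s.real 3 0 0 = γ) (hU : ∀ i < n, ∀ l < n, s.real 14 i l = U i l)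
    (hr : ∀ i < n, s.real 15 i 0 = r i) (hx : ∀ i < n, s.real 6 i 0 = x i) :
    Runs B ω moveProg s fun s' =>
      ∀ i < n, s'.real 6 i 0 = x i + ∑ l ∈ range n, γ * (U i l * r l) := by
  refine (Runs.fillLoop (a := 6) (fun k i j => i = k ∧ j = 0)
    (fun i _ => x i + ∑ l ∈ range n, γ * (U i l * r l)) rfl rfl hn hnB
    fun i hi s₁ f₁ e₁ h₁ => ?_).mono fun s' _ h i hi => (h i 0).1 ⟨i, hi, rfl, rfl⟩
  have hxi : s₁.real 6 i 0 = x i := by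
    rw [(h₁ i 0).2 (by rintro ⟨k', h5, h6, -⟩; omega), hx i hi]
  refine (Runs.accLoop (a := 6) (i₀ := i) (j₀ := 0) (fun l => γ * (U i l * r l)) rfl rfl
    ((f₁.nat 0 rfl).trans hn) hnB fun l hl s₂ f₂ e₂ _ => ?_).mono fun s' _ h i' j =>
      ⟨fun hh => ?_, (h i' j).2⟩
  · refine Runs.setReal_fills.mono fun s' _ h => ?_
    simpa only [NExpr.eval, RExpr.eval, (f₂.nat 3 rfl).trans e₁, e₂, f₂.real 3 rfl,
      f₁.real 3 rfl, hγ, f₂.real 14 rfl, f₁.real 14 rfl, hU i hi l hl, f₂.real 15 rfl,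
      f₁.real 15 rfl, hr l hl] using h
  · rw [(h i' j).1 hh, hxi, hh.1]

theorem activeProg_runs {χ : Fin n → ℝ} (hn : s.nat 0 = n) (hnB : n ≤ B)
    (hδ : s.real 4 0 0 = δ) (hχ : ∀ i : Fin n, s.real 6 i 0 = χ i) :
    Runs B ω activeProg s fun s' =>
      ∀ i < n, s'.real 7 i 0 = indicator (univ.filter fun i => |χ i| < 1 - δ) i := by
  refine (Runs.fillLoop (a := 7) (fun k i j => i = k ∧ j = 0)
    (fun i _ => indicator (univ.filter fun i => |χ i| < 1 - δ) i) rfl rfl hn hnB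
    fun i hi s₁ f₁ e₁ h₁ => ?_).mono fun s' _ h i hi => (h i 0).1 ⟨i, hi, rfl, rfl⟩
  have hi' : s.real 6 i 0 = χ ⟨i, hi⟩ := hχ ⟨i, hi⟩
  have hind := indicator_val (univ.filter fun i => |χ i| < 1 - δ) ⟨i, hi⟩
  simp only [mem_filter, mem_univ, true_and] at hind
  -- The machine has no absolute value; the test compares √(x·x).
  refine Runs.ite (fun hlt => ?_) fun hlt => ?_
  all_goals
    simp only [Test.Holds, RExpr.eval, NExpr.eval, e₁, f₁.real 6 rfl, f₁.real 4 rfl, hi', hδ,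
      Real.sqrt_mul_self_eq_abs, Nat.cast_one] at hlt
    refine Runs.setReal_fills.mono fun s' _ h => ?_
    intro i' j
    refine ⟨fun hh => ?_, fun hno => ?_⟩
    · rw [(h i' j).1 ⟨hh.1.trans e₁.symm, hh.2⟩, hh.1]
      refine Eq.trans ?_ hind.symm
      simp [RExpr.eval, NExpr.eval, hlt]
    · exact (h i' j).2 fun hh => hno ⟨hh.1.trans e₁, hh.2⟩

/-- The memory holds the input of the walk and the Gram matrix of the vectors. -/
structure Prepared (v : Fin n → EuclideanSpace ℝ (Fin m)) (χ₀ : Fin n → ℝ) (γ δ : ℝ) (T : ℕ)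
    (s : State) : Prop where
  nat_zero : s.nat 0 = n
  nat_two : s.nat 2 = T
  start : ∀ i : Fin n, s.real 1 i 0 = χ₀ i
  stepSize : s.real 3 0 0 = γ
  threshold : s.real 4 0 0 = δ
  gram : ∀ i < n, ∀ l < n, s.real 5 i l = gram v i l

theorem Prepared.of_frame {p : Prog} {s' : State} (h : Prepared v χ₀ γ δ T s)
    (f : Frame p s s')
    (h₁ : ∀ x ∈ [0, 2], p.modNat x = false) (h₂ : ∀ a ∈ [1, 3, 4, 5], p.modReal a = false) :
    Prepared v χ₀ γ δ T s' where
  nat_zero := (f.nat 0 (h₁ 0 (by simp))).trans h.nat_zero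
  nat_two := (f.nat 2 (h₁ 2 (by simp))).trans h.nat_two
  start := by rw [f.real 1 (h₂ 1 (by simp))]; exact h.start
  stepSize := by rw [f.real 3 (h₂ 3 (by simp))]; exact h.stepSize
  threshold := by rw [f.real 4 (h₂ 4 (by simp))]; exact h.threshold
  gram := by rw [f.real 5 (h₂ 5 (by simp))]; exact h.gram

/-- The memory holds a state of the walk. -/
def Holds (st : (Fin n → ℝ) × Finset (Fin n)) (s : State) : Prop :=
  (∀ i : Fin n, s.real 6 i 0 = st.1 i) ∧ ∀ i < n, s.real 7 i 0 = indicator st.2 i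

/-- The rule for the choice of the matrices that the program follows. -/
def solverGuide (v : Fin n → EuclideanSpace ℝ (Fin m)) : Guide n := fun _ _ A => solver v A

theorem stepProg_runs {st : (Fin n → ℝ) × Finset (Fin n)} (t : ℕ)
    (hs : Prepared v χ₀ γ δ T s) (hst : Holds st s) (hnB : n ≤ B) :
    Runs B ω stepProg s fun s' => s'.coins = s.coins + n ∧
      Holds (step (solverGuide v) γ δ t st fun i => coinSign (ω (s.coins + i))) s' := by
  refine Runs.seq (solverProg_runs hs.nat_zero hnB hs.gram hst.2) fun s₁ f₁ h₁ => ?_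
  have p₁ := hs.of_frame f₁ (by decide) (by decide)
  have hx₁ : ∀ i : Fin n, s₁.real 6 i 0 = st.1 i := by rw [f₁.real 6 rfl]; exact hst.1
  refine Runs.seq (coinProg_runs p₁.nat_zero hnB) fun s₂ f₂ h₂ => ?_
  have p₂ := p₁.of_frame f₂ (by decide) (by decide)
  rw [f₁.coins rfl] at h₂
  refine Runs.seq (moveProg_runs (x := fun i => s₁.real 6 i 0)
    (r := fun i => coinSign (ω (s.coins + i))) p₂.nat_zero hnB p₂.stepSize
    (by rw [f₂.real 14 rfl]; exact h₁) h₂.2 (fun i _ => by rw [f₂.real 6 rfl]))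
    fun s₃ f₃ h₃ => ?_
  have p₃ := p₂.of_frame f₃ (by decide) (by decide)
  set ρ : Fin n → ℝ := fun i => coinSign (ω (s.coins + i)) with hρ
  have h₃' : ∀ i : Fin n, s₃.real 6 i 0 = (step (solverGuide v) γ δ t st ρ).1 i := by
    intro i
    rw [h₃ i i.2, hx₁ i]
    simp only [step, Pi.add_apply, Pi.smul_apply, smul_eq_mul, Matrix.mulVec, dotProduct,
      solverGuide, solver, Matrix.of_apply, hρ]
    rw [mul_sum, ← Fin.sum_univ_eq_sum_range (fun l => γ *
      (entry (KomlosSolver.gram v) n (indicator st.2) i l * coinSign (ω (s.coins + l))))]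
  refine (activeProg_runs p₃.nat_zero hnB p₃.threshold h₃').mono fun s₄ f₄ h₄ =>
    ⟨?_, ?_, h₄⟩
  · rw [f₄.coins rfl, f₃.coins rfl, h₂.1]
  · rw [f₄.real 6 rfl]; exact h₃'

/-- The coins of an attempt that starts with coin `c`. -/
def coinBlock (T n : ℕ) (ω : ℕ → Bool) (c : ℕ) (x : Fin T × Fin n) : Bool :=
  ω (c + (x.1 * n + x.2))

open Classical in
theorem attemptProg_runs (hs : Prepared v χ₀ γ δ T s) (hnB : n ≤ B) (hTB : T ≤ B) (hT : 0 < T) :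
    Runs B ω attemptProg s fun s' => s'.coins = s.coins + T * n ∧
      (∀ i : Fin n, s'.real 6 i 0 =
        endOf (solverGuide v) χ₀ γ δ (coinBlock T n ω s.coins) i) ∧
      s'.real 16 0 0 =
        if coinBlock T n ω s.coins ∈ good (solverGuide v) χ₀ γ δ T then 0 else 1 := by
  set r : ℕ → Fin n → ℝ := signs (Function.curry (coinBlock T n ω s.coins)) with hr
  refine Runs.seq (Runs.forTo n (fun k s' => ∀ i : Fin n, (i : ℕ) < k →
    s'.real 6 i 0 = χ₀ i ∧ s'.real 7 i 0 = 1) rfl rfl hs.nat_zero hnB (fun _ _ _ _ h => h)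
    (fun i hi => absurd hi (Nat.not_lt_zero i)) fun k hk s₁ f₁ e₁ h₁ => ?_) fun s₁ f₁ h₁ => ?_
  · refine Runs.seq Runs.setReal_fills fun s₂ f₂ h₂ => Runs.setReal_fills.mono fun s₃ f₃ h₃ => ?_
    intro i hi
    simp only [NExpr.eval, RExpr.eval, e₁, (f₂.nat 3 rfl).trans e₁, f₁.real 1 rfl,
      Nat.cast_one] at h₂ h₃
    rw [f₃.real 6 rfl]
    rcases Nat.lt_succ_iff_lt_or_eq.1 hi with hlt | heq
    · rw [(h₂ i 0).2 (by omega), (h₃ i 0).2 (by omega), f₂.real 7 rfl]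
      exact h₁ i hlt
    · rw [(h₂ i 0).1 ⟨heq, rfl⟩, (h₃ i 0).1 ⟨heq, rfl⟩, ← heq]
      exact ⟨hs.start i, rfl⟩
  have p₁ := hs.of_frame f₁ (by decide) (by decide)
  refine Runs.seq (Runs.forTo T (fun t s' => s'.coins = s.coins + t * n ∧
      Holds (walk (solverGuide v) χ₀ γ δ r t) s')
    rfl rfl p₁.nat_two hTB (fun _ _ _ _ h => h) ?_ fun t ht s₂ f₂ e₂ h₂ => ?_) fun s₂ f₂ h₂ => ?_
  · refine ⟨by rw [f₁.coins rfl]; simp, fun i => (h₁ i i.2).1, fun i hi => ?_⟩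
    have h3 := (h₁ ⟨i, hi⟩ hi).2
    have h4 := indicator_val (univ : Finset (Fin n)) ⟨i, hi⟩
    simp only [mem_univ, if_true] at h4
    exact h3.trans h4.symm
  · have p₂ := p₁.of_frame f₂ (by decide) (by decide)
    refine (stepProg_runs (t + 1) p₂ h₂.2 hnB).mono fun s₃ _ h₃ => ⟨?_, ?_⟩
    · rw [h₃.1, h₂.1]; ring
    · rw [walk_succ]
      have : r (t + 1) = fun i : Fin n => coinSign (ω (s₂.coins + i)) := by
        funext i
        simp [hr, signs, ht, Function.curry, coinBlock, h₂.1, add_assoc]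
      rw [this]
      exact h₃.2
  have p₂ := p₁.of_frame f₂ (by decide) (by decide)
  refine Runs.seq Runs.setReal_fills fun s₃ f₃ h₃ => ?_
  have hmem : ∀ i : Fin n, i ∈ (walk (solverGuide v) χ₀ γ δ r T).2 ↔
      |endOf (solverGuide v) χ₀ γ δ (coinBlock T n ω s.coins) i| < 1 - δ := by
    intro i
    -- At least one step is needed: initially all coordinates are active, and only after a step does
    -- the active set record the comparison with 1 - δ.
    obtain ⟨T', rfl⟩ : ∃ T', T = T' + 1 := ⟨T - 1, by omega⟩
    rw [endOf, ← hr, walk_succ]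
    simp [step]
  have q7 : ∀ i : Fin n, s₃.real 7 i 0 =
      if i ∈ (walk (solverGuide v) χ₀ γ δ r T).2 then 1 else 0 := fun i => by
    rw [f₃.real 7 rfl, h₂.2.2 i i.2, indicator_val]
  refine (Runs.forTo n (fun k s' => s'.real 16 0 0 =
    if ∃ i : Fin n, (i : ℕ) < k ∧ i ∈ (walk (solverGuide v) χ₀ γ δ r T).2 then 1 else 0) rfl rfl
    ((f₃.nat 0 rfl).trans p₂.nat_zero) hnB (fun _ _ _ _ h => h) ?_
    fun k hk s₄ f₄ e₄ h₄ => ?_).mono fun s' f' h => ⟨?_, ?_, ?_⟩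
  · rw [(h₃ 0 0).1 ⟨rfl, rfl⟩]
    simp [RExpr.eval, NExpr.eval]
  · refine Runs.ite (fun hlt => ?_) fun hlt => Runs.skip ?_
    all_goals
      simp only [Test.Holds, RExpr.eval, NExpr.eval, e₄, f₄.real 7 rfl, q7 ⟨k, hk⟩,
        Nat.cast_zero] at hlt
    · have hk' : (⟨k, hk⟩ : Fin n) ∈ (walk (solverGuide v) χ₀ γ δ r T).2 := by
        by_contra hn
        simp [hn] at hlt
      refine Runs.setReal_fills.mono fun s' _ h => ?_
      rw [(h 0 0).1 ⟨rfl, rfl⟩, if_pos ⟨⟨k, hk⟩, Nat.lt_succ_self k, hk'⟩]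
      simp [RExpr.eval, NExpr.eval]
    · have hk' : (⟨k, hk⟩ : Fin n) ∉ (walk (solverGuide v) χ₀ γ δ r T).2 := by
        intro hn
        simp [hn] at hlt
      refine h₄.trans (if_congr ⟨?_, ?_⟩ rfl rfl)
      · rintro ⟨i, hi, hA⟩
        exact ⟨i, hi.trans (Nat.lt_succ_self k), hA⟩
      · rintro ⟨i, hi, hA⟩
        refine ⟨i, lt_of_le_of_ne (Nat.lt_succ_iff.1 hi) ?_, hA⟩
        rintro rfl
        exact hk' hA
  · rw [f'.coins rfl, f₃.coins rfl, h₂.1]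
  · intro i
    rw [f'.real 6 rfl, f₃.real 6 rfl]
    exact h₂.2.1 i
  · rw [h]
    by_cases hg : coinBlock T n ω s.coins ∈ good (solverGuide v) χ₀ γ δ T
    · rw [if_pos hg, if_neg]
      rintro ⟨i, -, hi⟩
      exact absurd (hg i) (not_le.2 ((hmem i).1 hi))
    · rw [if_neg hg, if_pos]
      simp only [good, Set.mem_ofPred_eq, not_forall, not_le] at hg
      obtain ⟨i, hi⟩ := hg
      exact ⟨i, i.2, (hmem i).2 hi⟩

/-- The restart loop is the one loop whose length B does not bound. The induction is on the number j
of failures ahead, with k attempts already made and k·T·n coins used. -/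
theorem attemptLoop_exec (hnB : n ≤ B) (hTB : T ≤ B) (hT : 0 < T) (j : ℕ) {k : ℕ} {s : State}
    (hs : Prepared v χ₀ γ δ T s) (hc : s.coins = k * (T * n)) (hflag : s.real 16 0 0 = 1)
    (hfail : ∀ k' < j, coinBlock T n ω ((k + k') * (T * n)) ∉ good (solverGuide v) χ₀ γ δ T)
    (hsucc : coinBlock T n ω ((k + j) * (T * n)) ∈ good (solverGuide v) χ₀ γ δ T) :
    ∃ s', Exec ω (.loop failTest attemptProg) s s' ∧
      s'.clock ≤ s.clock +
        ((j + 1) * (failTest.cost + attemptProg.timeBound B) + failTest.cost) ∧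
      ∀ i : Fin n, s'.real 6 i 0 =
        endOf (solverGuide v) χ₀ γ δ (coinBlock T n ω ((k + j) * (T * n))) i := by
  classical
  induction j generalizing k s with
  | zero =>
    have hs' : Prepared v χ₀ γ δ T (s.tick failTest.cost) :=
      ⟨hs.nat_zero, hs.nat_two, hs.start, hs.stepSize, hs.threshold, hs.gram⟩
    obtain ⟨s₁, e₁, c₁, h₁, h₂, h₃⟩ := attemptProg_runs (ω := ω) hs' hnB hTB hT
    have hc' : (s.tick failTest.cost).coins = k * (T * n) := hc
    rw [hc'] at h₂ h₃
    rw [add_zero] at hsucc ⊢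
    rw [if_pos hsucc] at h₃
    refine ⟨s₁.tick failTest.cost, .loop_true ?_ e₁ (.loop_false ?_), ?_, h₂⟩
    · simp [failTest, Test.Holds, RExpr.eval, NExpr.eval, hflag]
    · simp [failTest, Test.Holds, RExpr.eval, NExpr.eval, h₃]
    · have h4 : (s.tick failTest.cost).clock = s.clock + failTest.cost := rfl
      have h5 : (s₁.tick failTest.cost).clock = s₁.clock + failTest.cost := rfl
      rw [h5]
      rw [h4] at c₁
      omega
  | succ j ih =>
    have hs' : Prepared v χ₀ γ δ T (s.tick failTest.cost) :=
      ⟨hs.nat_zero, hs.nat_two, hs.start, hs.stepSize, hs.threshold, hs.gram⟩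
    obtain ⟨s₁, e₁, c₁, h₁, h₂, h₃⟩ := attemptProg_runs (ω := ω) hs' hnB hTB hT
    have hc' : (s.tick failTest.cost).coins = k * (T * n) := hc
    have hf := hfail 0 (Nat.succ_pos j)
    rw [add_zero] at hf
    rw [hc', if_neg hf] at h₃
    obtain ⟨s₂, e₂, c₂, h₄⟩ := ih (k := k + 1) (hs'.of_frame e₁.frame (by decide) (by decide))
      (by rw [h₁, hc']; ring) h₃
      (fun k' hk' => by
        have := hfail (k' + 1) (by omega)
        rwa [show k + (k' + 1) = k + 1 + k' by omega] at this)
      (by rwa [show k + 1 + j = k + (j + 1) by omega])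
    refine ⟨s₂, .loop_true ?_ e₁ e₂, ?_, ?_⟩
    · simp [failTest, Test.Holds, RExpr.eval, NExpr.eval, hflag]
    · have h4 : (s.tick failTest.cost).clock = s.clock + failTest.cost := rfl
      rw [h4] at c₁
      rw [add_mul (j + 1)]
      omega
    · rwa [show k + (j + 1) = k + 1 + j by omega]

theorem outProg_runs {x : Fin n → ℝ} (hn : s.nat 0 = n) (hnB : n ≤ B)
    (hx : ∀ i : Fin n, s.real 6 i 0 = x i) :
    Runs B ω outProg s fun s' => ∀ i : Fin n, s'.real 2 i 0 = if 0 ≤ x i then 1 else -1 := by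
  refine Runs.forTo n (fun k s' => ∀ i : Fin n, (i : ℕ) < k →
    s'.real 2 i 0 = if 0 ≤ x i then 1 else -1) rfl rfl hn hnB (fun _ _ _ _ h => h)
    (fun i hi => absurd hi (Nat.not_lt_zero i)) (fun k hk s₁ f₁ e₁ h₁ => ?_) |>.mono
    fun s' _ h i => h i i.2
  have q6 : s₁.real 6 k 0 = x ⟨k, hk⟩ := by rw [f₁.real 6 rfl]; exact hx ⟨k, hk⟩
  refine Runs.ite (fun hlt => ?_) fun hlt => ?_
  all_goals
    simp only [Test.Holds, RExpr.eval, NExpr.eval, e₁, q6, Nat.cast_zero] at hlt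
    refine Runs.setReal_fills.mono fun s' _ h => ?_
    intro i hi
    rcases Nat.lt_succ_iff_lt_or_eq.1 hi with hlt' | heq
    · rw [(h i 0).2 ?_]
      · exact h₁ i hlt'
      · rintro ⟨h5, -⟩
        exact absurd (h5.trans e₁) hlt'.ne
    · rw [(h i 0).1 ⟨heq.trans e₁.symm, rfl⟩]
      obtain rfl : i = ⟨k, hk⟩ := Fin.ext heq
      simp [RExpr.eval, NExpr.eval, hlt, not_lt.1, not_le.2]

/-- The memory holds the input of the walk. -/
structure WalkReady (v : Fin n → EuclideanSpace ℝ (Fin m)) (χ₀ : Fin n → ℝ) (γ δ : ℝ) (T : ℕ)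
    (s : State) : Prop where
  nat_zero : s.nat 0 = n
  nat_one : s.nat 1 = m
  nat_two : s.nat 2 = T
  vectors : ∀ (i : Fin n) (j : Fin m), s.real 0 i j = v i j
  start : ∀ i : Fin n, s.real 1 i 0 = χ₀ i
  stepSize : s.real 3 0 0 = γ
  threshold : s.real 4 0 0 = δ

/-- The coins that the program looks at. -/
def streamCoins (T n : ℕ) (x : ℕ × (Fin T × Fin n)) : ℕ :=
  x.1 * (T * n) + (x.2.1 * n + x.2.2)

/-- Mixed-radix digits: division by T·n recovers the attempt, division of the rest by n the step. -/
theorem streamCoins_injective : Function.Injective (streamCoins T n) := by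
  rintro ⟨k, t, i⟩ ⟨k', t', i'⟩ h
  simp only [streamCoins] at h
  have hlt : ∀ (t : Fin T) (i : Fin n), (t : ℕ) * n + i < T * n := fun t i =>
    calc (t : ℕ) * n + i < t * n + n := by omega
      _ = (t + 1) * n := by ring
      _ ≤ T * n := Nat.mul_le_mul_right n t.2
  have hpos : 0 < T * n := (Nat.zero_le _).trans_lt (hlt t i)
  have hk : k = k' := by
    have h1 := congrArg (· / (T * n)) h
    simpa [Nat.mul_comm _ (T * n), Nat.mul_add_div hpos, Nat.div_eq_of_lt (hlt _ _)] using h1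
  subst hk
  have h2 : (t : ℕ) * n + i = t' * n + i' := by omega
  have hn : 0 < n := i.pos
  have ht : (t : ℕ) = t' := by
    have h3 := congrArg (· / n) h2
    simpa [Nat.mul_comm _ n, Nat.mul_add_div hn, Nat.div_eq_of_lt i.2, Nat.div_eq_of_lt i'.2]
      using h3
  rw [ht] at h2
  have hi : (i : ℕ) = i' := by omega
  rw [Fin.ext ht, Fin.ext hi]

theorem walkProg_exec (hs : WalkReady v χ₀ γ δ T s) (hc : s.coins = 0) (hnB : n ≤ B)
    (hmB : m ≤ B) (hTB : T ≤ B) (hT : 0 < T)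
    (hex : ∃ k, attempt k (ω ∘ streamCoins T n) ∈ good (solverGuide v) χ₀ γ δ T) :
    ∃ s', Exec ω walkProg s s' ∧
      s'.clock ≤ s.clock + (first (good (solverGuide v) χ₀ γ δ T) (ω ∘ streamCoins T n) + 1) *
        walkProg.timeBound B ∧
      ∀ i : Fin n, s'.real 2 i 0 = signOut (solverGuide v) χ₀ γ δ (ω ∘ streamCoins T n) i := by
  set k := first (good (solverGuide v) χ₀ γ δ T) (ω ∘ streamCoins T n) with hk
  have hblock : ∀ k, attempt k (ω ∘ streamCoins T n) = coinBlock T n ω (k * (T * n)) :=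
    fun _ => rfl
  obtain ⟨s₁, e₁, c₁, h₁⟩ := gramProg_runs (ω := ω)
    (V := fun i l => if h : i < n ∧ l < m then v ⟨i, h.1⟩ ⟨l, h.2⟩ else 0) hs.nat_zero hs.nat_one
    hnB hmB (fun i hi j hj => by simpa [hi, hj] using hs.vectors ⟨i, hi⟩ ⟨j, hj⟩)
  have f₁ := e₁.frame
  obtain ⟨s₂, e₂, c₂, h₂⟩ := Runs.setReal_fills (B := B) (ω := ω) (s := s₁) (a := 16)
    (i := .const 0) (j := .const 0) (e := .cast (.const 1))
  have f₂ := e₂.frame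
  have p₂ : Prepared v χ₀ γ δ T s₂ := by
    refine ⟨?_, ?_, ?_, ?_, ?_, ?_⟩
    · rw [f₂.nat 0 rfl, f₁.nat 0 rfl, hs.nat_zero]
    · rw [f₂.nat 2 rfl, f₁.nat 2 rfl, hs.nat_two]
    · rw [f₂.real 1 rfl, f₁.real 1 rfl]; exact hs.start
    · rw [f₂.real 3 rfl, f₁.real 3 rfl, hs.stepSize]
    · rw [f₂.real 4 rfl, f₁.real 4 rfl, hs.threshold]
    · intro i hi l hl
      rw [f₂.real 5 rfl, h₁ i hi l hl, KomlosSolver.gram, KomlosSolver.extend, KomlosSolver.extend, dif_pos hi, dif_pos hl,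
        PiLp.inner_apply, ← Fin.sum_univ_eq_sum_range (fun a =>
          (if h : i < n ∧ a < m then v ⟨i, h.1⟩ ⟨a, h.2⟩ else 0) *
            (if h : l < n ∧ a < m then v ⟨l, h.1⟩ ⟨a, h.2⟩ else 0))]
      refine sum_congr rfl fun a _ => ?_
      simp [hi, hl, mul_comm]
  obtain ⟨s₃, e₃, c₃, h₃⟩ := attemptLoop_exec (ω := ω) hnB hTB hT k (k := 0) p₂
    (by rw [f₂.coins rfl, f₁.coins rfl, hc, zero_mul])
    (by rw [(h₂ 0 0).1 ⟨rfl, rfl⟩]; simp [RExpr.eval, NExpr.eval])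
    (fun k' hk' => by
      rw [zero_add, ← hblock]
      exact Nat.notMem_of_lt_sInf (s := {k | attempt k (ω ∘ streamCoins T n) ∈ _}) hk')
    (by rw [zero_add, ← hblock]; exact attempt_first hex)
  rw [zero_add, ← hblock] at h₃
  obtain ⟨s₄, e₄, c₄, h₄⟩ := outProg_runs (B := B) (ω := ω)
    ((e₃.frame.nat 0 rfl).trans p₂.nat_zero) hnB h₃
  refine ⟨s₄, .seq e₁ (.seq e₂ (.seq e₃ e₄)), ?_, h₄⟩
  -- The time bound charges B ≥ 1 rounds to the restart loop, so one copy of it per attempt covers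
  -- the whole run.
  have hB1 : 1 ≤ B := le_trans hT hTB
  have hle : failTest.cost + attemptProg.timeBound B ≤
      B * (failTest.cost + attemptProg.timeBound B) := Nat.le_mul_of_pos_left _ hB1
  have htb : walkProg.timeBound B = gramProg.timeBound B +
    ((Prog.setReal 16 (.const 0) (.const 0) (.cast (.const 1))).timeBound B +
      (B * (failTest.cost + attemptProg.timeBound B) + failTest.cost + outProg.timeBound B)) := rfl
  rw [htb]
  generalize (Prog.setReal 16 (.const 0) (.const 0) (.cast (.const 1))).timeBound B = y at *
  generalize gramProg.timeBound B = g at *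
  generalize outProg.timeBound B = o at *
  generalize failTest.cost + attemptProg.timeBound B = a at *
  generalize B * a = Ba at *
  generalize failTest.cost = f at *
  have h5 : (k + 1) * (g + (y + (Ba + f + o))) =
      k * (g + (y + (f + o))) + (k + 1) * Ba + (g + y + f + o) := by ring
  have h6 : (k + 1) * a ≤ (k + 1) * Ba := Nat.mul_le_mul_left _ hle
  rw [h5]
  omega

end RealRAM
end

noncomputable section

namespace RealRAM

open Finset KomlosSolver KomlosWalk FairCoins

local infixr:60 " ;; " => Prog.seq

/-! ## Finding a starting point and parameters -/

/-- The preprocessing ends in the same state on every stream, so the starting point and the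
parameters are fixed before any coin is tossed. -/
theorem Exec.of_not_tosses {ω ω' : ℕ → Bool} {p : Prog} {s s' : State} (h : Exec ω p s s')
    (hp : p.tosses = false) : Exec ω' p s s' := by
  induction h with
  | skip s => exact .skip s
  | setNat x e s => exact .setNat x e s
  | setReal a i j e s => exact .setReal a i j e s
  | flip x s => exact absurd hp (by simp [Prog.tosses])
  | seq _ _ ih₁ ih₂ =>
    simp only [Prog.tosses, Bool.or_eq_false_iff] at hp
    exact .seq (ih₁ hp.1) (ih₂ hp.2)
  | ite_true hb _ ih =>
    simp only [Prog.tosses, Bool.or_eq_false_iff] at hp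
    exact .ite_true hb (ih hp.1)
  | ite_false hb _ ih =>
    simp only [Prog.tosses, Bool.or_eq_false_iff] at hp
    exact .ite_false hb (ih hp.2)
  | loop_true hb _ _ ih₁ ih₂ => exact .loop_true hb (ih₁ hp) (ih₂ hp)
  | loop_false hb => exact .loop_false hb

/-- Chooses signs `sᵢ` that minimize `∑ sᵢ ⟨a, vᵢ⟩`, where array `20` holds `a`. -/
def chooseProg : Prog :=
  .forTo 3 0 (.setReal 23 (.const 0) (.const 0) (.cast (.const 0)) ;;
    .forTo 5 1 (.setReal 23 (.const 0) (.const 0) (.add (.get 23 (.const 0) (.const 0))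
      (.mul (.get 20 (.var 5) (.const 0)) (.get 0 (.var 3) (.var 5))))) ;;
    .ite (.realLt (.cast (.const 0)) (.get 23 (.const 0) (.const 0)))
      (.setReal 22 (.var 3) (.const 0) (.sub (.cast (.const 0)) (.cast (.const 1))))
      (.setReal 22 (.var 3) (.const 0) (.cast (.const 1))))

/-- Adds the signs to array `21`. -/
def tallyProg : Prog :=
  .forTo 3 0 (.setReal 21 (.var 3) (.const 0)
    (.add (.get 21 (.var 3) (.const 0)) (.get 22 (.var 3) (.const 0))))

/-- Adds `∑ sᵢ vᵢ - y` to `a`. -/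
def shiftProg : Prog :=
  .forTo 4 1 (.setReal 20 (.var 4) (.const 0)
      (.sub (.get 20 (.var 4) (.const 0)) (.get 1 (.var 4) (.const 0))) ;;
    .forTo 3 0 (.setReal 20 (.var 4) (.const 0) (.add (.get 20 (.var 4) (.const 0))
      (.mul (.get 22 (.var 3) (.const 0)) (.get 0 (.var 3) (.var 4))))))

/-- Computes a starting point whose image is close to `y`. -/
def startProg : Prog :=
  .setNat 10 (.add (.var 0) (.var 0)) ;;
    .forTo 11 10 (.forTo 12 10 (chooseProg ;; tallyProg ;; shiftProg)) ;;
    .forTo 3 0 (.setReal 1 (.var 3) (.const 0)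
      (.div (.get 21 (.var 3) (.const 0)) (.mul (.cast (.var 10)) (.cast (.var 10)))))

/-- Computes the smallest power of two above `2n` in register `13` and its logarithm in
register `14`. -/
def logProg : Prog :=
  .setNat 13 (.const 1) ;;
    .forTo 3 0 (.ite (.natLt (.var 13) (.add (.var 0) (.var 0)))
      (.setNat 13 (.add (.var 13) (.var 13)) ;; .setNat 14 (.add (.var 14) (.const 1))) .skip)

/-- Computes the parameters of the walk. -/
def paramProg : Prog :=
  .setReal 3 (.const 0) (.const 0) (.div (.cast (.const 1)) (.mul (.cast (.var 0)) (.cast (.var 0)))) ;;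
    .setReal 4 (.const 0) (.const 0) (.div (.cast (.const 1)) (.cast (.var 0))) ;;
    logProg ;;
    .forTo 3 0 (.setNat 15 (.add (.var 15) (.var 0))) ;;
    .forTo 3 15 (.setNat 16 (.add (.var 16) (.var 15))) ;;
    .forTo 3 14 (.setNat 2 (.add (.var 2)
      (.add (.add (.var 16) (.var 16)) (.add (.var 16) (.var 16)))))

/-- The sampler for the balancing problem. -/
def balanceProg : Prog := (startProg ;; paramProg) ;; walkProg

variable {B : ℕ} {ω : ℕ → Bool} {s : State} {n m : ℕ}
  {v : Fin n → EuclideanSpace ℝ (Fin m)} {y : EuclideanSpace ℝ (Fin m)}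

theorem chooseProg_runs {a : EuclideanSpace ℝ (Fin m)} (hn : s.nat 0 = n) (hm : s.nat 1 = m)
    (hnB : n ≤ B) (hmB : m ≤ B) (hv : ∀ (i : Fin n) (j : Fin m), s.real 0 i j = v i j)
    (ha : ∀ j : Fin m, s.real 20 j 0 = a j) :
    Runs B ω chooseProg s fun s' =>
      ∀ i : Fin n, s'.real 22 i 0 = if 0 < (inner ℝ a (v i) : ℝ) then -1 else 1 := by
  refine (Runs.forTo n (fun k s' => ∀ i : Fin n, (i : ℕ) < k →
    s'.real 22 i 0 = if 0 < (inner ℝ a (v i) : ℝ) then -1 else 1) rfl rfl hn hnB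
    (fun _ _ _ _ h => h) (fun i hi => absurd hi (Nat.not_lt_zero i))
    fun k hk s₁ f₁ e₁ h₁ => ?_).mono fun s' _ h i => h i i.2
  refine Runs.seq Runs.setReal_fills fun s₂ f₂ h₂ => ?_
  refine Runs.seq (Runs.accLoop (a := 23) (i₀ := 0) (j₀ := 0) (N := m)
    (fun l => s.real 20 l 0 * s.real 0 k l) rfl rfl
    ((f₂.nat 1 rfl).trans ((f₁.nat 1 rfl).trans hm)) hmB fun l hl s₃ f₃ e₃ _ => ?_)
    fun s₃ f₃ h₃ => ?_
  · refine Runs.setReal_fills.mono fun s' _ h => ?_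
    simpa only [NExpr.eval, RExpr.eval, e₃, (f₃.nat 3 rfl).trans ((f₂.nat 3 rfl).trans e₁),
      f₃.real 20 rfl, f₂.real 20 rfl, f₁.real 20 rfl, f₃.real 0 rfl, f₂.real 0 rfl,
      f₁.real 0 rfl] using h
  have hval : s₃.real 23 0 0 = inner ℝ a (v ⟨k, hk⟩) := by
    rw [(h₃ 0 0).1 ⟨rfl, rfl⟩, (h₂ 0 0).1 ⟨rfl, rfl⟩, PiLp.inner_apply,
      ← Fin.sum_univ_eq_sum_range (fun l => s.real 20 l 0 * s.real 0 k l)]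
    simp only [RExpr.eval, NExpr.eval, Nat.cast_zero, zero_add]
    refine sum_congr rfl fun l _ => ?_
    rw [ha l, hv ⟨k, hk⟩ l]
    simp [mul_comm]
  have q3 : s₃.nat 3 = k := (f₃.nat 3 rfl).trans ((f₂.nat 3 rfl).trans e₁)
  have q22 : s₃.real 22 = s₁.real 22 := (f₃.real 22 rfl).trans (f₂.real 22 rfl)
  refine Runs.ite (fun hlt => ?_) fun hlt => ?_
  all_goals
    simp only [Test.Holds, RExpr.eval, NExpr.eval, hval, Nat.cast_zero] at hlt
    refine Runs.setReal_fills.mono fun s' _ h => ?_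
    intro i hi
    rcases Nat.lt_succ_iff_lt_or_eq.1 hi with hlt' | heq
    · rw [(h i 0).2 fun h5 => absurd (h5.1.trans q3) hlt'.ne]
      exact (congrFun (congrFun q22 i) 0).trans (h₁ i hlt')
    · rw [(h i 0).1 ⟨heq.trans q3.symm, rfl⟩]
      obtain rfl : i = ⟨k, hk⟩ := Fin.ext heq
      simp [RExpr.eval, NExpr.eval, hlt]

theorem tallyProg_runs (hn : s.nat 0 = n) (hnB : n ≤ B) :
    Runs B ω tallyProg s fun s' =>
      ∀ i < n, s'.real 21 i 0 = s.real 21 i 0 + s.real 22 i 0 := by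
  refine (Runs.fillLoop (a := 21) (fun k i j => i = k ∧ j = 0)
    (fun i _ => s.real 21 i 0 + s.real 22 i 0) rfl rfl hn hnB
    fun i hi s₁ f₁ e₁ h₁ => ?_).mono fun s' _ h i hi => (h i 0).1 ⟨i, hi, rfl, rfl⟩
  refine Runs.setReal_fills.mono fun s' _ h => ?_
  have q : s₁.real 21 i 0 = s.real 21 i 0 := (h₁ i 0).2 (by rintro ⟨k', h5, h6, -⟩; omega)
  simp only [NExpr.eval, RExpr.eval, e₁, q, f₁.real 22 rfl] at h
  intro i' j
  exact ⟨fun hh => by rw [(h i' j).1 hh, hh.1], (h i' j).2⟩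

theorem shiftProg_runs (hn : s.nat 0 = n) (hm : s.nat 1 = m) (hnB : n ≤ B) (hmB : m ≤ B) :
    Runs B ω shiftProg s fun s' => ∀ j < m, s'.real 20 j 0 =
      s.real 20 j 0 - s.real 1 j 0 + ∑ i ∈ range n, s.real 22 i 0 * s.real 0 i j := by
  refine (Runs.fillLoop (a := 20) (fun k i j => i = k ∧ j = 0)
    (fun j _ => s.real 20 j 0 - s.real 1 j 0 + ∑ i ∈ range n, s.real 22 i 0 * s.real 0 i j)
    rfl rfl hm hmB fun j hj s₁ f₁ e₁ h₁ => ?_).mono fun s' _ h i hi => (h i 0).1 ⟨i, hi, rfl, rfl⟩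
  refine Runs.seq Runs.setReal_fills fun s₂ f₂ h₂ => ?_
  have q : s₁.real 20 j 0 = s.real 20 j 0 := (h₁ j 0).2 (by rintro ⟨k', h5, h6, -⟩; omega)
  simp only [NExpr.eval, RExpr.eval, e₁, q, f₁.real 1 rfl] at h₂
  have q4 : s₂.nat 4 = j := (f₂.nat 4 rfl).trans e₁
  refine (Runs.accLoop (a := 20) (i₀ := j) (j₀ := 0) (N := n)
    (fun i => s.real 22 i 0 * s.real 0 i j) rfl rfl
    ((f₂.nat 0 rfl).trans ((f₁.nat 0 rfl).trans hn)) hnB fun l hl s₃ f₃ e₃ _ => ?_).mono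
    fun s' _ h i' j' => ⟨fun hh => ?_, fun hno => ?_⟩
  · refine Runs.setReal_fills.mono fun s' _ h => ?_
    simpa only [NExpr.eval, RExpr.eval, e₃, (f₃.nat 4 rfl).trans q4, f₃.real 22 rfl,
      f₂.real 22 rfl, f₁.real 22 rfl, f₃.real 0 rfl, f₂.real 0 rfl, f₁.real 0 rfl] using h
  · rw [(h i' j').1 hh, (h₂ j 0).1 ⟨rfl, rfl⟩, hh.1]
  · rw [(h i' j').2 hno, (h₂ i' j').2 hno]

/-- The state after `k` rounds of the search for a starting point. -/
def Searched (v : Fin n → EuclideanSpace ℝ (Fin m)) (y : EuclideanSpace ℝ (Fin m)) (k : ℕ)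
    (s : State) : Prop :=
  ∃ c : Fin n → ℝ, (∀ i : Fin n, s.real 21 i 0 = c i) ∧ (∀ i, |c i| ≤ k) ∧
    (∀ j : Fin m, s.real 20 j 0 = (∑ i, c i • v i - (k : ℝ) • y) j) ∧
    ‖∑ i, c i • v i - (k : ℝ) • y‖ ^ 2 ≤ k * (2 * n) ^ 2

/-- The memory holds the input of the balancing problem. -/
structure BalanceReady (v : Fin n → EuclideanSpace ℝ (Fin m)) (y : EuclideanSpace ℝ (Fin m))
    (s : State) : Prop where
  nat_zero : s.nat 0 = n
  nat_one : s.nat 1 = m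
  vectors : ∀ (i : Fin n) (j : Fin m), s.real 0 i j = v i j
  target : ∀ j : Fin m, s.real 1 j 0 = y j

theorem BalanceReady.of_frame {p : Prog} {s' : State} (h : BalanceReady v y s)
    (f : Frame p s s')
    (h₁ : ∀ x ∈ [0, 1], p.modNat x = false) (h₂ : ∀ a ∈ [0, 1], p.modReal a = false) :
    BalanceReady v y s' where
  nat_zero := (f.nat 0 (h₁ 0 (by simp))).trans h.nat_zero
  nat_one := (f.nat 1 (h₁ 1 (by simp))).trans h.nat_one
  vectors := by rw [f.real 0 (h₂ 0 (by simp))]; exact h.vectors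
  target := by rw [f.real 1 (h₂ 1 (by simp))]; exact h.target

/-- Minimizing signs do at least as well as a representation of `y`. -/
theorem norm_sq_add_signs_le {E : Type*} [NormedAddCommGroup E] [InnerProductSpace ℝ E]
    {v : Fin n → E} (hv : ∀ i, ‖v i‖ ≤ 1) {l : Fin n → ℝ} (hl : ∀ i, |l i| ≤ 1) (a : E) :
    ‖a + (∑ i, (if 0 < (inner ℝ a (v i) : ℝ) then (-1 : ℝ) else 1) • v i - ∑ i, l i • v i)‖ ^ 2 ≤
      ‖a‖ ^ 2 + (2 * n) ^ 2 := by
  set σ : Fin n → ℝ := fun i => if 0 < (inner ℝ a (v i) : ℝ) then -1 else 1 with hσ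
  have hσ1 : ∀ i, |σ i| ≤ 1 := fun i => by simp only [hσ]; split_ifs <;> simp
  have e : ∑ i, σ i • v i - ∑ i, l i • v i = ∑ i, (σ i - l i) • v i := by
    rw [← sum_sub_distrib]
    exact sum_congr rfl fun i _ => (sub_smul _ _ _).symm
  change ‖a + (∑ i, σ i • v i - ∑ i, l i • v i)‖ ^ 2 ≤ _
  rw [e, norm_add_sq_real]
  -- The chosen sign makes the i-th term of ⟨a, ·⟩ equal to -|⟨a, vᵢ⟩|, the least that a coefficient
  -- in [-1, 1] can achieve.
  have h1 : inner ℝ a (∑ i, (σ i - l i) • v i) ≤ 0 := by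
    rw [inner_sum]
    refine sum_nonpos fun i _ => ?_
    rw [real_inner_smul_right]
    have := abs_le.1 (hl i)
    simp only [hσ]
    split_ifs with h
    · exact mul_nonpos_of_nonpos_of_nonneg (by linarith) h.le
    · exact mul_nonpos_of_nonneg_of_nonpos (by linarith) (not_lt.1 h)
  have h2 : ‖∑ i, (σ i - l i) • v i‖ ≤ 2 * n := by
    calc _ ≤ ∑ i, ‖(σ i - l i) • v i‖ := norm_sum_le _ _
      _ ≤ ∑ _i : Fin n, (2 : ℝ) := sum_le_sum fun i _ => by
          rw [norm_smul, Real.norm_eq_abs]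
          have h3 : |σ i - l i| ≤ 2 := by
            have := abs_le.1 (hl i)
            have := abs_le.1 (hσ1 i)
            rw [abs_le]; constructor <;> linarith
          calc _ ≤ (2 : ℝ) * 1 := mul_le_mul h3 (hv i) (norm_nonneg _) (by norm_num)
            _ = 2 := mul_one 2
      _ = 2 * n := by simp [mul_comm]
  have h3 := pow_le_pow_left₀ (norm_nonneg _) h2 2
  linarith

theorem searchStep_runs (hs : BalanceReady v y s) (hnB : n ≤ B) (hmB : m ≤ B)
    (hv : ∀ i, ‖v i‖ ≤ 1) {l : Fin n → ℝ} (hl : ∀ i, |l i| ≤ 1) (hy : ∑ i, l i • v i = y) {k : ℕ}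
    (hk : Searched v y k s) :
    Runs B ω (chooseProg ;; tallyProg ;; shiftProg) s (Searched v y (k + 1)) := by
  obtain ⟨c, hc, hck, ha, hnorm⟩ := hk
  set a := ∑ i, c i • v i - (k : ℝ) • y with hadef
  set σ : Fin n → ℝ := fun i => if 0 < (inner ℝ a (v i) : ℝ) then -1 else 1 with hσ
  refine Runs.seq (chooseProg_runs hs.nat_zero hs.nat_one hnB hmB hs.vectors ha)
    fun s₁ f₁ h₁ => ?_
  have p₁ := hs.of_frame f₁ (by decide) (by decide)
  refine Runs.seq (tallyProg_runs p₁.nat_zero hnB) fun s₂ f₂ h₂ => ?_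
  have p₂ := p₁.of_frame f₂ (by decide) (by decide)
  have hnew : ∑ i, (c i + σ i) • v i - ((k + 1 : ℕ) : ℝ) • y = a + (∑ i, σ i • v i - y) := by
    simp only [add_smul, sum_add_distrib, hadef, Nat.cast_add, Nat.cast_one, one_smul]
    abel
  refine (shiftProg_runs p₂.nat_zero p₂.nat_one hnB hmB).mono fun s₃ f₃ h₃ =>
    ⟨fun i => c i + σ i, fun i => ?_, fun i => ?_, fun j => ?_, ?_⟩
  · rw [f₃.real 21 rfl, h₂ i i.2, h₁ i, f₁.real 21 rfl, hc i]
  · refine (abs_add_le _ _).trans ?_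
    push_cast
    refine add_le_add (hck i) ?_
    simp only [hσ]; split_ifs <;> simp
  · rw [hnew, h₃ j j.2, f₂.real 20 rfl, f₁.real 20 rfl, ha j, p₂.target j,
      ← Fin.sum_univ_eq_sum_range (fun i => s₂.real 22 i 0 * s₂.real 0 i j)]
    have : ∀ i : Fin n, s₂.real 22 i 0 * s₂.real 0 i j = σ i * v i j := fun i => by
      rw [f₂.real 22 rfl, h₁ i, p₂.vectors i j]
    simp only [this]
    simp
    ring
  · rw [hnew]
    have h4 := norm_sq_add_signs_le hv hl a
    rw [hy] at h4
    refine h4.trans ?_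
    push_cast
    linarith

/-- After k greedy rounds the accumulated error has squared norm at most k(2n)². Averaging the signs
of K = (2n)² rounds gives a point of the cube with error at most √K·2n/K = 1, which is harmless next
to √log n. -/
theorem startProg_runs (hs : BalanceReady v y s) (hn : 2 ≤ n) (hnB : 2 * n ≤ B) (hmB : m ≤ B)
    (hv : ∀ i, ‖v i‖ ≤ 1) {l : Fin n → ℝ} (hl : ∀ i, |l i| ≤ 1) (hy : ∑ i, l i • v i = y)
    (h20 : s.real 20 = fun _ _ => 0) (h21 : s.real 21 = fun _ _ => 0) :
    Runs B ω startProg s fun s' => ∃ χ₀ : Fin n → ℝ, (∀ i : Fin n, s'.real 1 i 0 = χ₀ i) ∧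
      (∀ i, χ₀ i ∈ Set.Icc (-1) 1) ∧ ‖∑ i, χ₀ i • v i - y‖ ≤ 1 := by
  have hn2 : (2 : ℝ) ≤ n := by exact_mod_cast hn
  refine Runs.seq (R := fun s' => s'.nat 10 = 2 * n) (Runs.setNat ?_) fun s₁ f₁ h₁ => ?_
  · simp [State.tick, State.writeNat, NExpr.eval, hs.nat_zero, two_mul]
  have p₁ := hs.of_frame f₁ (by decide) (by decide)
  refine Runs.seq (Runs.forTo (2 * n) (fun k => Searched v y (k * (2 * n))) rfl rfl h₁ hnB
    (fun _ _ _ _ h => h) ?_ fun k hk s₂ f₂ e₂ h₂ => ?_) fun s₂ f₂ h₂ => ?_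
  · refine ⟨fun _ => 0, fun i => ?_, fun i => by simp, fun j => ?_, by simp⟩
    · rw [f₁.real 21 rfl, h21]
    · rw [f₁.real 20 rfl, h20]; simp
  · have p₂ := p₁.of_frame f₂ (by decide) (by decide)
    refine (Runs.forTo (2 * n) (fun q => Searched v y (k * (2 * n) + q)) rfl rfl
      ((f₂.nat 10 rfl).trans h₁) hnB (fun _ _ _ _ h => h) h₂ fun q hq s₃ f₃ e₃ h₃ => ?_).mono
      fun s' _ h => by rwa [add_mul, one_mul]
    exact searchStep_runs (p₂.of_frame f₃ (by decide) (by decide)) (by omega) hmB hv hl hy h₃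
  have p₂ := p₁.of_frame f₂ (by decide) (by decide)
  obtain ⟨c, hc, hck, -, hnorm⟩ := h₂
  set K : ℝ := ((2 * n * (2 * n) : ℕ) : ℝ) with hK
  have hK' : K = 2 * n * (2 * n) := by rw [hK]; push_cast; ring
  have hKpos : 0 < K := by rw [hK']; positivity
  have q10 : s₂.nat 10 = 2 * n := (f₂.nat 10 rfl).trans h₁
  refine (Runs.forTo n (fun k s' => ∀ i : Fin n, (i : ℕ) < k → s'.real 1 i 0 = c i / K) rfl rfl
    p₂.nat_zero (by omega) (fun _ _ _ _ h => h) (fun i hi => absurd hi (Nat.not_lt_zero i))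
    fun k hk s₃ f₃ e₃ h₃ => Runs.setReal_fills.mono fun s' _ h i hi => ?_).mono
    fun s' _ h => ⟨fun i => c i / K, fun i => h i i.2, fun i => ?_, ?_⟩
  · simp only [NExpr.eval, RExpr.eval, e₃, f₃.real 21 rfl, f₃.nat 10 rfl, q10] at h
    rcases Nat.lt_succ_iff_lt_or_eq.1 hi with hlt | heq
    · rw [(h i 0).2 fun h5 => absurd h5.1 hlt.ne]
      exact h₃ i hlt
    · rw [(h i 0).1 ⟨heq, rfl⟩, ← heq, hc i, hK]
      push_cast
      rfl
  · have h5 := abs_le.1 (hck i)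
    rw [Set.mem_Icc, le_div_iff₀ hKpos, div_le_iff₀ hKpos]
    constructor <;> linarith
  · have e : ∑ i, (c i / K) • v i - y = K⁻¹ • (∑ i, c i • v i - K • y) := by
      rw [smul_sub, smul_smul, inv_mul_cancel₀ hKpos.ne', one_smul, smul_sum]
      congr 1
      refine sum_congr rfl fun i _ => ?_
      rw [smul_smul, div_eq_mul_inv, mul_comm]
    rw [e, norm_smul, Real.norm_eq_abs, abs_of_pos (inv_pos.2 hKpos), inv_mul_le_iff₀ hKpos,
      mul_one]
    refine abs_le_of_sq_le_sq' ?_ hKpos.le |>.2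
    refine hnorm.trans (le_of_eq ?_)
    rw [hK']
    ring

/-- Doubling only below 2n keeps the power below 4n, and n doublings are enough because 2n ≤ 2ⁿ. -/
theorem logProg_runs (hn : s.nat 0 = n) (hn2 : 2 ≤ n) (hnB : n ≤ B) (h14 : s.nat 14 = 0) :
    Runs B ω logProg s fun s' =>
      2 * n ≤ 2 ^ s'.nat 14 ∧ 2 ^ s'.nat 14 ≤ 4 * n ∧ s'.nat 14 ≤ n := by
  refine Runs.seq (R := fun s' => s'.nat 13 = 1) (Runs.setNat rfl) fun s₁ f₁ h₁ => ?_
  refine (Runs.forTo (x := 3) n (fun k s' => s'.nat 13 = 2 ^ s'.nat 14 ∧ s'.nat 13 ≤ 4 * n ∧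
    s'.nat 14 ≤ k ∧ (2 * n ≤ s'.nat 13 ∨ s'.nat 14 = k)) rfl rfl ((f₁.nat 0 rfl).trans hn) hnB
    (fun _ _ _ _ h => h) ?_ fun k hk s₂ f₂ e₂ h₂ => ?_).mono fun s' _ h => ?_
  · rw [h₁, f₁.nat 14 rfl, h14]
    refine ⟨rfl, by omega, le_rfl, .inr rfl⟩
  · have q0 : s₂.nat 0 = n := (f₂.nat 0 rfl).trans ((f₁.nat 0 rfl).trans hn)
    obtain ⟨g1, g2, g3, g4⟩ := h₂
    refine Runs.ite (fun hlt => ?_) fun hlt => Runs.skip ?_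
    all_goals simp only [Test.Holds, NExpr.eval, q0] at hlt
    · refine Runs.seq (R := fun s' => s'.nat 13 = s₂.nat 13 + s₂.nat 13) (Runs.setNat rfl)
        fun s₃ f₃ h₃ => Runs.setNat ?_
      have q14 : s₃.nat 14 = s₂.nat 14 := f₃.nat 14 rfl
      simp only [State.tick, State.writeNat, NExpr.eval]
      simp only [h₃, q14, if_true, show ¬ (13 = 14) by decide, if_false]
      refine ⟨by rw [pow_succ, g1]; ring, by omega, by omega, .inr (by omega)⟩
    · exact ⟨g1, g2, Nat.le_succ_of_le g3, .inl (show 2 * n ≤ s₂.nat 13 by omega)⟩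
  · obtain ⟨g1, g2, g3, g4⟩ := h
    rw [← g1]
    refine ⟨?_, g2, g3⟩
    rcases g4 with g4 | g4
    · exact g4
    · rw [g1, g4]
      clear * - hn2
      induction n, hn2 using Nat.le_induction with
      | base => norm_num
      | succ k hk ih => rw [pow_succ]; omega

/-- Indices cannot be multiplied, so n², n⁴ and T are built by repeated addition, in loops of length
at most n². The choice of T makes γ²T = 4L exactly. -/
theorem paramProg_runs (hn : s.nat 0 = n) (hn2 : 2 ≤ n) (hnB : n ^ 2 ≤ B)
    (h14 : s.nat 14 = 0) (h15 : s.nat 15 = 0) (h16 : s.nat 16 = 0) (h2 : s.nat 2 = 0) :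
    Runs B ω paramProg s fun s' => s'.real 3 0 0 = 1 / (n * n) ∧ s'.real 4 0 0 = 1 / n ∧
      ∃ L, 2 * n ≤ 2 ^ L ∧ 2 ^ L ≤ 4 * n ∧ L ≤ n ∧ s'.nat 2 = L * (4 * n ^ 4) := by
  have hnB' : n ≤ B := (Nat.le_self_pow two_ne_zero n).trans hnB
  refine Runs.seq Runs.setReal_fills fun s₁ f₁ h₁ => ?_
  have q0 := (f₁.nat 0 rfl).trans hn
  refine Runs.seq Runs.setReal_fills fun s₂ f₂ h₂ => ?_
  have r0 := (f₂.nat 0 rfl).trans q0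
  simp only [NExpr.eval, RExpr.eval, hn, q0, Nat.cast_one] at h₁ h₂
  refine Runs.seq (logProg_runs r0 hn2 hnB' ?_) fun s₃ f₃ h₃ => ?_
  · rw [f₂.nat 14 rfl, f₁.nat 14 rfl, h14]
  have t0 := (f₃.nat 0 rfl).trans r0
  refine Runs.seq (Runs.forTo n (fun k s' => s'.nat 15 = k * n) rfl rfl t0 hnB'
    (fun _ _ _ _ h => h) ?_ fun k hk s₄ f₄ e₄ h₄ => Runs.setNat ?_) fun s₄ f₄ h₄ => ?_
  · rw [f₃.nat 15 rfl, f₂.nat 15 rfl, f₁.nat 15 rfl, h15, zero_mul]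
  · simp [State.tick, State.writeNat, NExpr.eval, h₄, (f₄.nat 0 rfl).trans t0, add_mul]
  refine Runs.seq (Runs.forTo (n * n) (fun k s' => s'.nat 16 = k * (n * n)) rfl rfl h₄
    (by rwa [← sq]) (fun _ _ _ _ h => h) ?_ fun k hk s₅ f₅ e₅ h₅ => Runs.setNat ?_)
    fun s₅ f₅ h₅ => ?_
  · rw [f₄.nat 16 rfl, f₃.nat 16 rfl, f₂.nat 16 rfl, f₁.nat 16 rfl, h16, zero_mul]
  · simp [State.tick, State.writeNat, NExpr.eval, h₅, (f₅.nat 15 rfl).trans h₄, add_mul]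
  have q14 : s₅.nat 14 = s₃.nat 14 := (f₅.nat 14 rfl).trans (f₄.nat 14 rfl)
  refine (Runs.forTo (x := 3) (s₃.nat 14) (fun k s' => s'.nat 2 = k * (4 * n ^ 4)) rfl rfl q14
    (h₃.2.2.trans hnB') (fun _ _ _ _ h => h) ?_ fun k hk s₆ f₆ e₆ h₆ => Runs.setNat ?_).mono
    fun s' f' h => ⟨?_, ?_, s₃.nat 14, h₃.1, h₃.2.1, h₃.2.2, h⟩
  · rw [f₅.nat 2 rfl, f₄.nat 2 rfl, f₃.nat 2 rfl, f₂.nat 2 rfl, f₁.nat 2 rfl, h2, zero_mul]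
  · simp only [State.tick, State.writeNat, NExpr.eval, h₆, (f₆.nat 16 rfl).trans h₅, if_true]
    ring
  · rw [f'.real 3 rfl, f₅.real 3 rfl, f₄.real 3 rfl, f₃.real 3 rfl, f₂.real 3 rfl,
      (h₁ 0 0).1 ⟨rfl, rfl⟩]
  · rw [f'.real 4 rfl, f₅.real 4 rfl, f₄.real 4 rfl, f₃.real 4 rfl, (h₂ 0 0).1 ⟨rfl, rfl⟩]

theorem mem_sum_segment {E : Type*} [AddCommGroup E] [Module ℝ E] {v : Fin n → E} {y : E}
    (hy : y ∈ ∑ i, segment ℝ (-v i) (v i)) :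
    ∃ l : Fin n → ℝ, (∀ i, l i ∈ Set.Icc (-1) 1) ∧ ∑ i, l i • v i = y := by
  rw [Set.mem_fintype_sum] at hy
  obtain ⟨g, hg, rfl⟩ := hy
  have : ∀ i, ∃ l : ℝ, l ∈ Set.Icc (-1) 1 ∧ l • v i = g i := by
    intro i
    obtain ⟨a, b, ha, hb, hab, h⟩ := hg i
    refine ⟨b - a, ⟨by linarith, by linarith⟩, ?_⟩
    rw [← h, sub_smul, smul_neg]
    abel
  choose l h1 h2 using this
  exact ⟨l, h1, sum_congr rfl fun i _ => h2 i⟩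

/-- The preprocessing stage of the sampler. -/
theorem preprocess_exec (hn : 2 ≤ n) (hv : ∀ i, ‖v i‖ ≤ 1)
    (hy : y ∈ ∑ i, segment ℝ (-v i) (v i)) (hB : 4 * n ^ 5 + m ≤ B) :
    ∃ (s' : State) (χ₀ : Fin n → ℝ) (L : ℕ),
      (∀ ω, Exec ω (startProg ;; paramProg) (balancingInput v y) s') ∧
      s'.clock ≤ (startProg ;; paramProg).timeBound B ∧ s'.coins = 0 ∧
      WalkReady v χ₀ (1 / (n * n)) (1 / n) (L * (4 * n ^ 4)) s' ∧
      (∀ i, χ₀ i ∈ Set.Icc (-1) 1) ∧ ‖∑ i, χ₀ i • v i - y‖ ≤ 1 ∧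
      2 * n ≤ 2 ^ L ∧ 2 ^ L ≤ 4 * n ∧ L ≤ n := by
  obtain ⟨l, hl, hly⟩ := mem_sum_segment hy
  have h5 : n ^ 2 ≤ n ^ 5 := Nat.pow_le_pow_right (by omega) (by norm_num)
  have h6 : 2 * n ≤ n ^ 2 := by rw [sq]; exact Nat.mul_le_mul_right n hn
  have hs : BalanceReady v y (balancingInput v y) := by
    refine ⟨rfl, rfl, fun i j => ?_, fun j => ?_⟩
    · simp [balancingInput, pad]
    · simp [balancingInput, pad]
  -- Any stream serves, since no coin is tossed.
  have key : Runs B (fun _ => false) (startProg ;; paramProg) (balancingInput v y) fun s' =>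
      ∃ (χ₀ : Fin n → ℝ) (L : ℕ), WalkReady v χ₀ (1 / (n * n)) (1 / n) (L * (4 * n ^ 4)) s' ∧
      (∀ i, χ₀ i ∈ Set.Icc (-1) 1) ∧ ‖∑ i, χ₀ i • v i - y‖ ≤ 1 ∧
      2 * n ≤ 2 ^ L ∧ 2 ^ L ≤ 4 * n ∧ L ≤ n := by
    refine Runs.seq (startProg_runs hs hn (by omega) (by omega) hv (fun i => abs_le.2 (hl i)) hly
      rfl rfl) fun s₁ f₁ h₁ => ?_
    obtain ⟨χ₀, hχ, hχ1, hχy⟩ := h₁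
    refine (paramProg_runs (n := n) ((f₁.nat 0 rfl).trans rfl) hn (by omega) ((f₁.nat 14 rfl).trans rfl)
      ((f₁.nat 15 rfl).trans rfl) ((f₁.nat 16 rfl).trans rfl) ((f₁.nat 2 rfl).trans rfl)).mono
      fun s' f' h => ?_
    obtain ⟨g1, g2, L, g3, g4, g5, g6⟩ := h
    refine ⟨χ₀, L, ⟨?_, ?_, g6, ?_, ?_, g1, g2⟩, hχ1, hχy, g3, g4, g5⟩
    · rw [f'.nat 0 rfl, f₁.nat 0 rfl]; rfl
    · rw [f'.nat 1 rfl, f₁.nat 1 rfl]; rfl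
    · rw [f'.real 0 rfl, f₁.real 0 rfl]; exact hs.vectors
    · rw [f'.real 1 rfl]; exact hχ
  obtain ⟨s', e, c, χ₀, L, h⟩ := key
  refine ⟨s', χ₀, L, fun ω => e.of_not_tosses rfl, ?_, (e.frame.coins rfl).trans rfl, h⟩
  simpa [balancingInput] using c

end RealRAM
end

noncomputable section

namespace RealRAM

open Finset KomlosSolver KomlosWalk FairCoins

/-! ## Expected running times and output distributions -/

theorem solverGuide_solves {n m : ℕ} {v : Fin n → EuclideanSpace ℝ (Fin m)}
    (hv : ∀ i, ‖v i‖ ≤ 1) : (solverGuide v).Solves v := fun _ _ A => solver_solves v hv A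

theorem first_add_one_le_count {κ : Type} (S : Set (κ → Bool)) (ω : ℕ × κ → Bool) :
    ((first S ω + 1 : ℕ) : ℝ≥0∞) ≤ count S ω :=
  le_iInf₂ fun k hk => by
    have : first S ω ≤ k := Nat.sInf_le (s := {k | attempt k ω ∈ S}) hk
    exact_mod_cast Nat.succ_le_succ this

/-- The number of attempts is infinite where no attempt succeeds, so the time is dominated pointwise
by a measurable function, and its own measurability is not needed. -/
theorem lintegral_time_le {κ : Type} [Finite κ] {S : Set (κ → Bool)}
    (hS : fairCoins κ Sᶜ ≤ 9 / 10) {p : Prog} {s : State} {c : ℕ} (hc : 0 < c)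
    {Φ : (ℕ → Bool) → ℕ × κ → Bool} (hΦ : MeasurePreserving Φ (fairCoins ℕ) (fairCoins (ℕ × κ)))
    (h : ∀ ω, (∃ k, attempt k (Φ ω) ∈ S) →
      ∃ s', Exec ω p s s' ∧ s'.clock ≤ s.clock + (first S (Φ ω) + 1) * c) :
    ∫⁻ ω, p.time s ω ∂fairCoins ℕ ≤ 10 * (c : ℝ≥0∞) := by
  have hle : ∀ ω, p.time s ω ≤ count S (Φ ω) * c := by
    intro ω
    by_cases hex : ∃ k, attempt k (Φ ω) ∈ S
    · obtain ⟨s', e, hs'⟩ := h ω hex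
      refine (Prog.time_le e).trans ?_
      refine le_trans ?_ (mul_le_mul_left (first_add_one_le_count S (Φ ω)) _)
      have : s'.clock - s.clock ≤ (first S (Φ ω) + 1) * c := by omega
      exact_mod_cast this
    · push Not at hex
      have h1 : count S (Φ ω) = ∞ := by simp [count, hex]
      rw [h1, ENNReal.top_mul (by exact_mod_cast hc.ne')]
      exact le_top
  calc _ ≤ ∫⁻ ω, count S (Φ ω) * c ∂fairCoins ℕ := lintegral_mono hle
    _ = (∫⁻ η, count S η ∂fairCoins (ℕ × κ)) * c := by
        rw [hΦ.lintegral_comp ((measurable_count S).mul_const (c : ℝ≥0∞)),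
          lintegral_mul_const _ (measurable_count S)]
    _ ≤ _ := mul_le_mul_left (lintegral_count_le hS) _

theorem measurableSet_signOut {n T : ℕ} (U : Guide n) (χ₀ : Fin n → ℝ) (γ δ : ℝ)
    (z : Fin n → ℝ) :
    MeasurableSet {η : ℕ × (Fin T × Fin n) → Bool | signOut U χ₀ γ δ η = z} :=
  measurableSet_first (good U χ₀ γ δ T)
    {x | (fun i => if 0 ≤ endOf U χ₀ γ δ x i then (1 : ℝ) else -1) = z}

theorem measurePreserving_streamCoins (T n : ℕ) :
    MeasurePreserving (fun ω : ℕ → Bool => ω ∘ streamCoins T n) (fairCoins ℕ)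
      (fairCoins (ℕ × (Fin T × Fin n))) :=
  measurePreserving_comp streamCoins_injective

theorem measurePreserving_usedCoins (T n : ℕ) :
    MeasurePreserving (fun ω : Coins n => ω ∘ usedCoins T n) (fairCoins (ℕ × ℕ × Fin n))
      (fairCoins (ℕ × (Fin T × Fin n))) :=
  measurePreserving_comp usedCoins_injective

theorem walkReady_walkInput {n m : ℕ} (v : Fin n → EuclideanSpace ℝ (Fin m)) (χ₀ : Fin n → ℝ)
    (γ δ : ℝ) (T : ℕ) : WalkReady v χ₀ γ δ T (walkInput v χ₀ γ δ T) := by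
  refine ⟨rfl, rfl, rfl, fun i j => ?_, fun i => ?_, ?_, ?_⟩ <;> simp [walkInput, pad]

theorem walkProg_timeBound_pos (B : ℕ) : 0 < walkProg.timeBound B :=
  Nat.add_pos_right _ (show 0 < _ + _ from Nat.add_pos_left (by simp [Prog.timeBound]) _)

theorem le_add_pow {n m k : ℕ} (hn : 2 ≤ n) (hk : k ≤ 7) :
    4 * n ^ k + m + 1 ≤ (n + m) ^ 10 := by
  have h1 : n ^ k ≤ (n + m) ^ 7 :=
    (Nat.pow_le_pow_left (Nat.le_add_right n m) k).trans (Nat.pow_le_pow_right (by omega) hk)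
  have h2 : m ≤ (n + m) ^ 7 := (Nat.le_add_left m n).trans (Nat.le_self_pow (by norm_num) _)
  have h3 : 1 ≤ (n + m) ^ 7 := Nat.one_le_pow _ _ (by omega)
  have h4 : 8 ≤ (n + m) ^ 3 := by
    calc 8 = 2 ^ 3 := by norm_num
      _ ≤ _ := Nat.pow_le_pow_left (by omega) 3
  calc _ ≤ (n + m) ^ 7 * 8 := by omega
    _ ≤ (n + m) ^ 7 * (n + m) ^ 3 := Nat.mul_le_mul_left _ h4
    _ = _ := by rw [← pow_add]

theorem timeBound_le_pow {p : Prog} {K d : ℕ} (h : ∀ B, p.timeBound B ≤ K * (B + 1) ^ d)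
    {n m k : ℕ} (hn : 2 ≤ n) (hk : k ≤ 7) {K' d' : ℕ} (hK : 10 * K ≤ K') (hd : 10 * d ≤ d') :
    10 * (p.timeBound (4 * n ^ k + m) : ℝ≥0∞) ≤ K' * ((n : ℝ≥0∞) + m) ^ d' := by
  have h1 : 10 * p.timeBound (4 * n ^ k + m) ≤ K' * (n + m) ^ d' :=
    calc _ ≤ 10 * (K * (4 * n ^ k + m + 1) ^ d) := Nat.mul_le_mul_left _ (h _)
      _ ≤ 10 * (K * ((n + m) ^ 10) ^ d) :=
          Nat.mul_le_mul_left _ (Nat.mul_le_mul_left _ (Nat.pow_le_pow_left (le_add_pow hn hk) d))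
      _ = 10 * K * (n + m) ^ (10 * d) := by rw [← pow_mul, mul_assoc]
      _ ≤ _ := Nat.mul_le_mul hK (Nat.pow_le_pow_right (by omega) hd)
  exact_mod_cast h1

end RealRAM

/-! ### Guarantees for the walk with arbitrary solutions. -/

namespace KomlosWalk

open RealRAM FairCoins

variable {n m : ℕ} {v : Fin n → EuclideanSpace ℝ (Fin m)}

theorem log_pos_of_two_le (hn : 2 ≤ n) : 16 / 25 ≤ Real.log n := by
  have h := Real.log_le_log (by norm_num) (by exact_mod_cast hn : (2 : ℝ) ≤ n)
  linarith [Real.log_two_gt_d9]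

/-- The origin of the constant 30: 49·18 = 882 ≤ 30². -/
theorem sq_le_sq_sqrt_log (hn : 2 ≤ n) {a : ℝ} (h : a ≤ 18 * Real.log n) :
    49 * a ≤ (30 * Real.sqrt (Real.log n)) ^ 2 := by
  have h0 := log_pos_of_two_le hn
  rw [mul_pow, Real.sq_sqrt (by linarith)]
  linarith

/-- The walk solves the balancing problem, for every choice of the starting point and of the
solutions of the vector Komlós program. -/
theorem isSubgaussian_output (hn : 2 ≤ n) (hv : ∀ i, ‖v i‖ ≤ 1) {χ₀ : Fin n → ℝ}
    (hχ : ∀ i, χ₀ i ∈ Set.Icc (-1) 1) {U : Guide n} (hU : U.Solves v) :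
    IsSubgaussian (fairCoins (ℕ × ℕ × Fin n))
      (fun ω => ∑ i, output U χ₀ (stepSize n) (threshold n) (numSteps n) ω i • v i -
        ∑ i, χ₀ i • v i) (30 * Real.sqrt (Real.log n)) := by
  have hlog := log_pos_of_two_le hn
  have hs : 0 < Real.sqrt (Real.log n) := Real.sqrt_pos.2 (by linarith)
  refine isSubgaussian_of_eq_signOut (measurePreserving_usedCoins (numSteps n) n)
    (Filter.Eventually.of_forall fun ω => output_eq ω) hv hU hχ (stepSize_pos n hn)
    (numSteps_pos n hn) (stepSize_mul_sqrt_le_threshold n hn)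
    (measure_not_good_stepSize_le hn hU hχ) (ε := 0) (by simp) (by positivity)
    (sq_le_sq_sqrt_log hn (stepSize_sq_mul_numSteps_le n hn)) ?_
  linarith [mul_threshold_le n hn]

theorem lintegral_attempts_le (hn : 2 ≤ n) {χ₀ : Fin n → ℝ}
    (hχ : ∀ i, χ₀ i ∈ Set.Icc (-1) 1) {U : Guide n} (hU : U.Solves v) :
    ∫⁻ ω, attempts U χ₀ (stepSize n) (threshold n) (numSteps n) ω * numSteps n
      ∂(fairCoins (ℕ × ℕ × Fin n)) ≤ 10 * (n : ℝ≥0∞) ^ 7 := by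
  have hΦ := measurePreserving_usedCoins (numSteps n) n
  have hm := measurable_count (good U χ₀ (stepSize n) (threshold n) (numSteps n))
  simp only [attempts_eq]
  rw [hΦ.lintegral_comp (hm.mul_const (numSteps n : ℝ≥0∞)), lintegral_mul_const _ hm]
  refine mul_le_mul' (lintegral_count_le (measure_not_good_stepSize_le hn hU hχ)) ?_
  exact_mod_cast numSteps_le n hn

end KomlosWalk

/-! ### Guarantees for the two programs. -/

namespace RealRAM

open KomlosWalk FairCoins

variable {n m : ℕ} {v : Fin n → EuclideanSpace ℝ (Fin m)}

/-- The program runs the walk in expected polynomial time. -/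
theorem walkProg_spec (hn : 2 ≤ n) (hv : ∀ i, ‖v i‖ ≤ 1) {χ₀ : Fin n → ℝ}
    (hχ : ∀ i, χ₀ i ∈ Set.Icc (-1) 1) :
    ∫⁻ ω, walkProg.time (walkInput v χ₀ (stepSize n) (threshold n) (numSteps n)) ω
        ∂(fairCoins ℕ) ≤ 10 * (walkProg.timeBound (4 * n ^ 7 + m) : ℝ≥0∞) ∧
      ∀ z : Fin n → ℝ,
        fairCoins ℕ {ω | walkProg.output (walkInput v χ₀ (stepSize n) (threshold n) (numSteps n))
          n ω = z} =
        fairCoins (ℕ × ℕ × Fin n) {ω | output (solverGuide v) χ₀ (stepSize n) (threshold n)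
          (numSteps n) ω = z} := by
  have hU := solverGuide_solves hv
  have hgood := measure_not_good_stepSize_le hn hU hχ
  have hΦ := measurePreserving_streamCoins (numSteps n) n
  have hT := numSteps_le n hn
  have hn7 : n ≤ n ^ 7 := Nat.le_self_pow (by norm_num) n
  have hexec := fun ω hex => walkProg_exec (ω := ω) (B := 4 * n ^ 7 + m)
    (walkReady_walkInput v χ₀ (stepSize n) (threshold n) (numSteps n)) rfl (by omega) (by omega)
    (by omega) (numSteps_pos n hn) hex
  refine ⟨lintegral_time_le hgood (walkProg_timeBound_pos _) hΦ fun ω hex => ?_, fun z => ?_⟩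
  · obtain ⟨s', e, h, -⟩ := hexec ω hex
    exact ⟨s', e, h⟩
  · have hm := (measurableSet_signOut (T := numSteps n) (solverGuide v) χ₀ (stepSize n)
      (threshold n) z).nullMeasurableSet
      (μ := fairCoins (ℕ × (Fin (numSteps n) × Fin n)))
    -- Both outputs are `signOut` of injectively read coins, the machine's almost surely, so both
    -- events have the measure of one and the same set.
    have h1 := hΦ.measure_preimage hm
    have h2 := (measurePreserving_usedCoins (numSteps n) n).measure_preimage hm
    simp only [output_eq]
    refine Eq.trans (measure_congr ?_) (h1.trans h2.symm)
    filter_upwards [hΦ.quasiMeasurePreserving.ae (ae_exists_attempt hgood)] with ω hex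
    obtain ⟨s', e, -, h⟩ := hexec ω hex
    have : walkProg.output (walkInput v χ₀ (stepSize n) (threshold n) (numSteps n)) n ω =
        signOut (solverGuide v) χ₀ (stepSize n) (threshold n)
          (ω ∘ streamCoins (numSteps n) n) := by
      funext i
      rw [Prog.output, Prog.final_eq e, h i]
    exact congrArg (· = z) this

/-- The sampler for the balancing problem. -/
theorem balanceProg_spec (hn : 2 ≤ n) (hv : ∀ i, ‖v i‖ ≤ 1) {y : EuclideanSpace ℝ (Fin m)}
    (hy : y ∈ ∑ i, segment ℝ (-v i) (v i)) :
    ∫⁻ ω, balanceProg.time (balancingInput v y) ω ∂(fairCoins ℕ) ≤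
        10 * (balanceProg.timeBound (4 * n ^ 5 + m) : ℝ≥0∞) ∧
      (∀ᵐ ω ∂(fairCoins ℕ), ∀ i, balanceProg.output (balancingInput v y) n ω i = 1 ∨
        balanceProg.output (balancingInput v y) n ω i = -1) ∧
      IsSubgaussian (fairCoins ℕ)
        (fun ω => ∑ i, balanceProg.output (balancingInput v y) n ω i • v i - y)
        (30 * Real.sqrt (Real.log n)) := by
  obtain ⟨s₁, χ₀, L, e₁, c₁, hc, hs, hχ, hχy, hL1, hL2, hL3⟩ :=
    preprocess_exec (B := 4 * n ^ 5 + m) hn hv hy le_rfl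
  set T := L * (4 * n ^ 4) with hTdef
  set γ : ℝ := 1 / (n * n) with hγdef
  set δ : ℝ := 1 / n with hδdef
  have hU := solverGuide_solves hv
  have hn2 : (2 : ℝ) ≤ n := by exact_mod_cast hn
  have hLpos : 0 < L := by
    rcases Nat.eq_zero_or_pos L with rfl | h
    · simp only [pow_zero] at hL1; omega
    · exact h
  have hTpos : 0 < T := by positivity
  have hT : T ≤ 4 * n ^ 5 :=
    calc T ≤ n * (4 * n ^ 4) := Nat.mul_le_mul_right _ hL3
      _ = 4 * n ^ 5 := by ring
  have hn5 : n ≤ n ^ 5 := Nat.le_self_pow (by norm_num) n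
  have hγ : 0 < γ := by positivity
  have hγδ : γ * Real.sqrt n ≤ δ := by
    have h : Real.sqrt n ≤ n := by
      rw [Real.sqrt_le_left (by positivity)]
      nlinarith
    rw [hγdef, hδdef, div_mul_eq_mul_div, div_le_div_iff₀ (by positivity) (by positivity)]
    nlinarith
  have hδ2 : δ ≤ 1 / 2 := one_div_le_one_div_of_le (by norm_num) hn2
  have hγT : γ ^ 2 * T = 4 * L := by
    rw [hγdef, hTdef]
    push_cast
    field_simp
  have hL1' : Real.log (2 * n) ≤ L * Real.log 2 := by
    rw [← Real.log_pow]
    exact Real.log_le_log (by positivity) (by exact_mod_cast hL1)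
  have hL2' : L * Real.log 2 ≤ Real.log (4 * n) := by
    rw [← Real.log_pow]
    exact Real.log_le_log (by positivity) (by exact_mod_cast hL2)
  have hlog := log_pos_of_two_le hn
  have hgood : fairCoins (Fin T × Fin n) (good (solverGuide v) χ₀ γ δ T)ᶜ ≤ 9 / 10 := by
    refine measure_not_good_le hU hγ (by positivity) (by linarith) hχ ?_
    rw [hγT]
    have h1 : -(729 / 2000) * (4 * (L : ℝ)) ≤ -Real.log (2 * n) := by
      have := Real.log_two_lt_d9
      have hL0 : (0 : ℝ) ≤ L := Nat.cast_nonneg L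
      nlinarith
    calc _ ≤ n * Real.exp (-Real.log (2 * n)) :=
          mul_le_mul_of_nonneg_left (Real.exp_le_exp.2 h1) (by positivity)
      _ = 1 / 2 := by
          rw [Real.exp_neg, Real.exp_log (by positivity)]
          field_simp
  have hΦ := measurePreserving_streamCoins T n
  have hexec : ∀ ω, (∃ k, attempt k (ω ∘ streamCoins T n) ∈ good (solverGuide v) χ₀ γ δ T) →
      ∃ s', Exec ω balanceProg (balancingInput v y) s' ∧
        s'.clock ≤ (balancingInput v y).clock +
          (first (good (solverGuide v) χ₀ γ δ T) (ω ∘ streamCoins T n) + 1) *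
            balanceProg.timeBound (4 * n ^ 5 + m) ∧
        ∀ i : Fin n, s'.real 2 i 0 = signOut (solverGuide v) χ₀ γ δ (ω ∘ streamCoins T n) i := by
    intro ω hex
    obtain ⟨s₂, e₂, c₂, h₂⟩ := walkProg_exec (B := 4 * n ^ 5 + m) hs hc (by omega) (by omega)
      (by omega) hTpos hex
    refine ⟨s₂, .seq (e₁ ω) e₂, ?_, h₂⟩
    have htb : balanceProg.timeBound (4 * n ^ 5 + m) =
      (Prog.seq startProg paramProg).timeBound (4 * n ^ 5 + m) +
        walkProg.timeBound (4 * n ^ 5 + m) := rfl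
    rw [htb, mul_add]
    have h3 := Nat.le_mul_of_pos_left
      ((Prog.seq startProg paramProg).timeBound (4 * n ^ 5 + m))
      (Nat.succ_pos (first (good (solverGuide v) χ₀ γ δ T) (ω ∘ streamCoins T n)))
    simp only [Nat.succ_eq_add_one] at h3
    omega
  have hout : ∀ᵐ ω ∂fairCoins ℕ, balanceProg.output (balancingInput v y) n ω =
      signOut (solverGuide v) χ₀ γ δ (ω ∘ streamCoins T n) := by
    filter_upwards [hΦ.quasiMeasurePreserving.ae (ae_exists_attempt hgood)] with ω hex
    obtain ⟨s', e, -, h⟩ := hexec ω hex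
    funext i
    rw [Prog.output, Prog.final_eq e, h i]
  refine ⟨lintegral_time_le hgood (Nat.add_pos_right _ (walkProg_timeBound_pos _)) hΦ
    fun ω hex => ?_, ?_, ?_⟩
  · obtain ⟨s', e, h, -⟩ := hexec ω hex
    exact ⟨s', e, h⟩
  · filter_upwards [hout] with ω hω i
    rw [hω, signOut]
    split_ifs <;> simp
  · have hsqrt : 4 / 5 ≤ Real.sqrt (Real.log n) := Real.le_sqrt_of_sq_le (by linarith)
    refine isSubgaussian_of_eq_signOut hΦ hout hv hU hχ hγ hTpos hγδ hgood hχy (by positivity)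
      (sq_le_sq_sqrt_log hn ?_) ?_
    · rw [hγT]
      -- Then 4L ≤ 12·log n / ln 2, which is below 18·log n.
      have h1 : Real.log (4 * n) ≤ 3 * Real.log n := by
        have h2 := Real.log_le_log (by norm_num) hn2
        have h4 : Real.log 4 = 2 * Real.log 2 := by
          rw [show (4 : ℝ) = 2 ^ 2 by norm_num, Real.log_pow]; norm_num
        rw [Real.log_mul (by norm_num) (by positivity), h4]
        linarith
      have := Real.log_two_gt_d9
      have hL0 : (0 : ℝ) ≤ L := Nat.cast_nonneg L
      nlinarith
    · have : n * δ = 1 := by rw [hδdef]; field_simp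
      rw [this]
      linarith

end RealRAM

end

/-! ### Assembly of the three statements. -/

theorem theorem1p4 :
    ∃ (C : ℝ) (K d : ℕ), 0 < C ∧
      -- an expected polynomial time sampler for the problem itself
      (∃ P : RealRAM.Prog, ∀ (n m : ℕ), 2 ≤ n →
        ∀ v : Fin n → EuclideanSpace ℝ (Fin m), (∀ i, ‖v i‖ ≤ 1) →
        ∀ y ∈ ∑ i, segment ℝ (-v i) (v i),
          ∫⁻ ω, P.time (RealRAM.balancingInput v y) ω ∂(fairCoins ℕ) ≤ K * ((n : ℝ≥0∞) + m) ^ d ∧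
          (∀ᵐ ω ∂(fairCoins ℕ), ∀ i,
            P.output (RealRAM.balancingInput v y) n ω i = 1 ∨
              P.output (RealRAM.balancingInput v y) n ω i = -1) ∧
          IsSubgaussian (fairCoins ℕ)
            (fun ω => ∑ i, P.output (RealRAM.balancingInput v y) n ω i • v i - y)
            (C * Real.sqrt (Real.log n))) ∧
      -- the walk, for every starting point and every choice of solutions of the program
      (∀ (n m : ℕ), 2 ≤ n →
        ∀ v : Fin n → EuclideanSpace ℝ (Fin m), (∀ i, ‖v i‖ ≤ 1) →
        ∀ y ∈ ∑ i, segment ℝ (-v i) (v i),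
          (∃ χ₀ : Fin n → ℝ, (∀ i, χ₀ i ∈ Set.Icc (-1) 1) ∧ ∑ i, χ₀ i • v i = y) ∧
          (∃ U : KomlosWalk.Guide n, U.Solves v) ∧
          ∀ χ₀ : Fin n → ℝ, (∀ i, χ₀ i ∈ Set.Icc (-1) 1) → ∑ i, χ₀ i • v i = y →
          ∀ U : KomlosWalk.Guide n, U.Solves v →
            ∫⁻ ω, KomlosWalk.attempts U χ₀ (KomlosWalk.stepSize n) (KomlosWalk.threshold n)
                (KomlosWalk.numSteps n) ω * KomlosWalk.numSteps n
              ∂(fairCoins (ℕ × ℕ × Fin n)) ≤ K * (n : ℝ≥0∞) ^ d ∧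
            IsSubgaussian (fairCoins (ℕ × ℕ × Fin n))
              (fun ω => ∑ i, KomlosWalk.output U χ₀ (KomlosWalk.stepSize n)
                (KomlosWalk.threshold n) (KomlosWalk.numSteps n) ω i • v i - y)
              (C * Real.sqrt (Real.log n))) ∧
      -- an expected polynomial time implementation of the walk
      (∃ W : RealRAM.Prog, ∀ (n m : ℕ), 2 ≤ n →
        ∀ v : Fin n → EuclideanSpace ℝ (Fin m), (∀ i, ‖v i‖ ≤ 1) →
        ∀ χ₀ : Fin n → ℝ, (∀ i, χ₀ i ∈ Set.Icc (-1) 1) →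
          ∫⁻ ω, W.time (RealRAM.walkInput v χ₀ (KomlosWalk.stepSize n) (KomlosWalk.threshold n)
              (KomlosWalk.numSteps n)) ω ∂(fairCoins ℕ) ≤ K * ((n : ℝ≥0∞) + m) ^ d ∧
          ∃ U : KomlosWalk.Guide n, U.Solves v ∧
            ∀ z : Fin n → ℝ,
              fairCoins ℕ {ω | W.output (RealRAM.walkInput v χ₀ (KomlosWalk.stepSize n)
                (KomlosWalk.threshold n) (KomlosWalk.numSteps n)) n ω = z} =
              fairCoins (ℕ × ℕ × Fin n) {ω | KomlosWalk.output U χ₀ (KomlosWalk.stepSize n)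
                (KomlosWalk.threshold n) (KomlosWalk.numSteps n) ω = z}) := by
  obtain ⟨K₁, d₁, h₁⟩ := RealRAM.balanceProg.exists_timeBound_le
  obtain ⟨K₂, d₂, h₂⟩ := RealRAM.walkProg.exists_timeBound_le
  -- The factor 10 in K is the expected number of attempts, the one in d comes from 4nᵏ + m + 1 ≤ (n
  -- + m)¹⁰. The summands 1 ensure K ≥ 10 and d ≥ 7, as the bound 10·n⁷ for the walk requires.
  refine ⟨30, 10 * (K₁ + K₂ + 1), 10 * (d₁ + d₂ + 1), by norm_num,
    ⟨RealRAM.balanceProg, fun n m hn v hv y hy => ?_⟩, fun n m hn v hv y hy => ?_,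
    ⟨RealRAM.walkProg, fun n m hn v hv χ₀ hχ => ?_⟩⟩
  · obtain ⟨ht, hpm, hsub⟩ := RealRAM.balanceProg_spec hn hv hy
    exact ⟨ht.trans (RealRAM.timeBound_le_pow h₁ hn (by norm_num) (by omega) (by omega)),
      hpm, hsub⟩
  · refine ⟨RealRAM.mem_sum_segment hy, ⟨RealRAM.solverGuide v, RealRAM.solverGuide_solves hv⟩,
      fun χ₀ hχ hχy U hU => ⟨(KomlosWalk.lintegral_attempts_le hn hχ hU).trans ?_, ?_⟩⟩
    · have : 10 * n ^ 7 ≤ 10 * (K₁ + K₂ + 1) * n ^ (10 * (d₁ + d₂ + 1)) :=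
        Nat.mul_le_mul (by omega) (Nat.pow_le_pow_right (by omega) (by omega))
      exact_mod_cast this
    · subst hχy
      exact KomlosWalk.isSubgaussian_output hn hv hχ hU
  · obtain ⟨ht, hz⟩ := RealRAM.walkProg_spec hn hv hχ
    exact ⟨ht.trans (RealRAM.timeBound_le_pow h₂ hn (by norm_num) (by omega) (by omega)),
      RealRAM.solverGuide v, RealRAM.solverGuide_solves hv, hz⟩
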